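/- For $a\in(0,1)$ let $f_a(z)=z\,\frac{z+a}{1+az}$ on the unit disk $\mathbb D$, let $\varphi_a(z)=\lim_{n\to\infty}a^{-n}f_a^{\circ n}(z)$ be its linearizing coordinate at the attracting fixed point $0$, and let $c\in\mathbb D$ be its critical point. For $\theta\in\mathbb R$ the linearizing ray $\tilde\gamma_\theta\subset\mathbb D$ is the lift of $\{se^{i\theta}:s>0\}$ under $\varphi_a$ that emanates from $0$. Put $\theta_c=\arg\varphi_a(c)$. The half-petal (which is here the whole half-flower) is $$\mathcal P=\bigcup_{|\theta-\theta_c-\pi|<\pi/2}\tilde\gamma_\theta ,$$ and the half-flower garden is $\mathcal G(f_a)=\bigcup_{n\ge0}f_a^{-n}(\mathcal P)\subset\mathbb D$. A pre-petal is a connected component of some $f_a^{-n}(\mathcal P)$, $n\ge0$. Let $d_{\mathbb D}$ be the hyperbolic distance of the metric $2|dz|/(1-|z|^2)$, let $S_r=\{|z|=r\}$, and let $|\cdot|$ denote arc length of subsets of $S_r$. A geodesic segment is allowed to be infinite in one or both directions. **Theorem.** There is a constant $C$ such that for every real $a\in[1/2,1)$: 1. $\displaystyle\limsup_{r\to1^-}|\mathcal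 G(f_a)\cap S_r|\le C\sqrt{1-|a|}$; 2. every pre-petal $P$ is a hyperbolic quasi-geodesic in the sense that there is a hyperbolic geodesic segment $S$ such that each of $P$, $S$ lies in the closed $C$-neighbourhood of the other for $d_{\mathbb D}$; 3. any two distinct pre-petals $P\ne Q$ satisfy $d_{\mathbb D}(z,w)\ge d_{\mathbb D}(0,a)-C$ for all $z\in P$, $w\in Q$. -/

import Mathlib

open Filter Topology MeasureTheory
open scoped ComplexConjugate ENNReal

noncomputable section

namespace HalfFlower

/-- The hyperbolic distance of the unit disk, for the metric `2|dz| / (1 - |z|^2)`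
(curvature `-1`). It is only used for points of the unit disk. -/
def hypDist (z w : ℂ) : ℝ :=
  2 * Real.artanh ‖(z - w) / (1 - conj w * z)‖

/-- A geodesic segment of the hyperbolic disk, possibly infinite in one or both directions: the
image of a nonempty interval under a map into the disk that preserves distances. -/
def IsGeodesicSegment (S : Set ℂ) : Prop :=
  ∃ (I : Set ℝ) (g : ℝ → ℂ), I.Nonempty ∧ I.OrdConnected ∧
    (∀ s ∈ I, g s ∈ Metric.ball (0 : ℂ) 1) ∧
    (∀ s ∈ I, ∀ t ∈ I, hypDist (g s) (g t) = |s - t|) ∧ S = g '' I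

/-- The degree two Blaschke product `f_a`, with an attracting fixed point of multiplier `a`
at the origin. -/
def blaschke (a : ℂ) (z : ℂ) : ℂ := z * ((z + a) / (1 + conj a * z))

/-- The linearizing coordinate `φ_a(z) = lim a^{-n} f_a^n(z)` (for `0 < |a| < 1`, `|z| < 1`). -/
def linCoord (a : ℂ) (z : ℂ) : ℂ :=
  limUnder atTop (fun n : ℕ => (a ^ n)⁻¹ * (blaschke a)^[n] z)

/-- The critical point of `f_a` in the unit disk (for `0 < |a| < 1`): the root in the disk of
`conj a * z ^ 2 + 2 * z + a`, the numerator of the derivative. -/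
def criticalPoint (a : ℂ) : ℂ := -(1 - (Real.sqrt (1 - ‖a‖ ^ 2) : ℂ)) / conj a

/-- The argument of the singular line: the image under the linearizing coordinate of the
critical point, which is the puncture of the quotient torus. -/
def singularArg (a : ℝ) : ℝ := Complex.arg (linCoord a (criticalPoint a))

/-- The linearizing ray of argument `θ` for `0 < a < 1`: the lift under `φ_a` of the open ray
`{s e^{iθ} : s > 0}` that emanates from the attracting fixed point `0`. -/
def linearizingRay (a θ : ℝ) : Set ℂ :=
  {z | ∃ (s : ℝ) (γ : ℝ → ℂ), 0 < s ∧ ContinuousOn γ (Set.Icc 0 s) ∧ γ 0 = 0 ∧ γ s = z ∧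
    ∀ t ∈ Set.Icc 0 s, γ t ∈ Metric.ball (0 : ℂ) 1 ∧
      linCoord a (γ t) = (t : ℂ) * Complex.exp ((θ : ℂ) * Complex.I)}

/-- The `α`-petal of `f_a`, `0 < a < 1`. The complement of the singular line in the quotient torus
is foliated by the rays with arguments in an interval of length `2π`; the middle annulus
of relative area `α` consists of those with arguments in the concentric interval of
length `2πα`. -/
def petal (a α : ℝ) : Set ℂ :=
  ⋃ θ ∈ Set.Ioo (singularArg a + Real.pi - α * Real.pi) (singularArg a + Real.pi + α * Real.pi),
    linearizingRay a θ

/-- The half-petal, which is also the half-flower since the rotation number is `0/1`. -/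
def halfPetal (a : ℝ) : Set ℂ := petal a (1 / 2)

/-- The `n`-th iterated preimage `f_a^{-n}(E)` in the unit disk. -/
def preim (a : ℝ) (n : ℕ) (E : Set ℂ) : Set ℂ :=
  {z | z ∈ Metric.ball (0 : ℂ) 1 ∧ (blaschke a)^[n] z ∈ E}

/-- The half-flower garden `G(f_a)`. -/
def garden (a : ℝ) : Set ℂ := ⋃ n : ℕ, preim a n (halfPetal a)

/-- Pre-petals: connected components of the iterated preimages of the half-petal, the half-petal
itself (`n = 0`) included. -/
def IsPrePetal (a : ℝ) (P : Set ℂ) : Prop :=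
  ∃ n : ℕ, ∃ z ∈ preim a n (halfPetal a), P = connectedComponentIn (preim a n (halfPetal a)) z

/-- The arc length `|E ∩ S_r|` of the part of the circle `S_r = {|z| = r}` that lies in `E`. -/
def circleLength (E : Set ℂ) (r : ℝ) : ℝ≥0∞ :=
  ENNReal.ofReal r * volume {θ : ℝ | θ ∈ Set.Ioc (-Real.pi) Real.pi ∧ circleMap 0 r θ ∈ E}

end HalfFlower

end

noncomputable section

namespace HalfFlower

/-! ### The hyperbolic distance of the unit disk -/

/-! For real `a` the critical point is negative, the singular argument is π, and the half-petal
consists of rays on which Re φ_a > 0. It equals `core a`, the points with Re φ_a > 0 whose orbit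
stays in the right half-plane (`halfPetal_eq_core`). The Koebe function k(z) = z/(1-z)^2 locates it:
k∘f_a = k·(a + (1-a)^2 z/(1+z)^2), so arg k increases along orbits in the upper half-disk, and its
limit is arg φ_a. Hence Re k > 0 on the half-petal (`core_subset_koebeCone`), and this region is
within bounded distance of the radius [0,1), uniformly in `a`.

The involution `deck` exchanges the two preimages of a point. It is a hyperbolic isometry that
carries [0,1) to (-1,-a]. Every pre-petal other than the half-petal is the image of the half-petal
under a map g with f_a^n∘g = `deck`, and g is holomorphic on a fixed disk, `horodisk`, which
contains the half-petal and is tangent to the unit circle at 1 (`exists_branch`). The Schwarz–Pick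
lemma applies twice: f_a^n does not expand, so g does not shrink distances; and g maps `horodisk`
into the unit disk, so on the radius it lengthens them by at most log 3. Thus each pre-petal follows
a ray that is geodesic up to an additive constant (`IsQuasiRay`), and such a ray stays near a true
geodesic (`IsQuasiRay.exists_geodesic`).

Separation: the half-petal is near [0,1) and its `deck` image near (-1,-a], so they are d(0,a) apart
up to a constant. Since f_a does not expand, this passes to pre-petals that enter the half-petal at
different times. For equal times, push forward to the last moment at which the images are in
different components. They then lie on opposite sides of the real axis, and each is at distance at
least d(0,a)/2, up to a constant, from that axis (`le_hypDist_ofReal`).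

Length: on S_r, separation gives Euclidean gaps of order (1-r^2)/√(1-a) between different
pre-petals, while a single pre-petal occupies at most two clusters of size O(1-r^2)
(`IsQuasiRay.three_point`). The ratio of the two scales is √(1-a). -/

/-- The pseudo-hyperbolic distance of the unit disk. -/
def pseudoDist (z w : ℂ) : ℝ := ‖(z - w) / (1 - conj w * z)‖

theorem one_sub_conj_mul_ne_zero {z w : ℂ} (hz : ‖z‖ < 1) (hw : ‖w‖ < 1) :
    1 - conj w * z ≠ 0 := by
  intro h
  have h1 : ‖conj w * z‖ = 1 := by
    rw [← sub_eq_zero.mp h, norm_one]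
  rw [norm_mul, RCLike.norm_conj] at h1
  nlinarith [norm_nonneg z, norm_nonneg w]

theorem norm_sq_eq_re_im (z : ℂ) : ‖z‖ ^ 2 = z.re ^ 2 + z.im ^ 2 := by
  rw [Complex.sq_norm, Complex.normSq_apply]; ring

theorem norm_one_sub_conj_mul_sq (z w : ℂ) :
    ‖1 - conj w * z‖ ^ 2 = ‖z - w‖ ^ 2 + (1 - ‖z‖ ^ 2) * (1 - ‖w‖ ^ 2) := by
  simp only [norm_sq_eq_re_im, Complex.sub_re, Complex.sub_im, Complex.mul_re, Complex.mul_im,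
    Complex.conj_re, Complex.conj_im, Complex.one_re, Complex.one_im]
  ring

theorem one_sub_norm_sq_pos {z : ℂ} (hz : ‖z‖ < 1) : 0 < 1 - ‖z‖ ^ 2 := by
  nlinarith [norm_nonneg z]

theorem pseudoDist_sq {z w : ℂ} (hz : ‖z‖ < 1) (hw : ‖w‖ < 1) :
    1 - pseudoDist z w ^ 2 = (1 - ‖z‖ ^ 2) * (1 - ‖w‖ ^ 2) / ‖1 - conj w * z‖ ^ 2 := by
  have h : ‖1 - conj w * z‖ ≠ 0 := norm_ne_zero_iff.mpr (one_sub_conj_mul_ne_zero hz hw)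
  rw [pseudoDist, norm_div, div_pow, eq_div_iff (by positivity), sub_mul,
    div_mul_cancel₀ _ (by positivity), norm_one_sub_conj_mul_sq]
  ring

theorem pseudoDist_nonneg (z w : ℂ) : 0 ≤ pseudoDist z w := norm_nonneg _

theorem pseudoDist_lt_one {z w : ℂ} (hz : ‖z‖ < 1) (hw : ‖w‖ < 1) : pseudoDist z w < 1 := by
  have h : 0 < ‖1 - conj w * z‖ := norm_pos_iff.mpr (one_sub_conj_mul_ne_zero hz hw)
  have h1 := pseudoDist_sq hz hw
  have : 0 < (1 - ‖z‖ ^ 2) * (1 - ‖w‖ ^ 2) / ‖1 - conj w * z‖ ^ 2 := by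
    have := one_sub_norm_sq_pos hz
    have := one_sub_norm_sq_pos hw
    positivity
  nlinarith [pseudoDist_nonneg z w]

theorem hypDist_eq (z w : ℂ) : hypDist z w = 2 * Real.artanh (pseudoDist z w) := rfl

theorem hypDist_nonneg (z w : ℂ) : 0 ≤ hypDist z w := by
  have := Real.artanh_nonneg (pseudoDist_nonneg z w)
  rw [hypDist_eq]; linarith

theorem pseudoDist_mem {z w : ℂ} (hz : ‖z‖ < 1) (hw : ‖w‖ < 1) :
    pseudoDist z w ∈ Set.Ioo (-1 : ℝ) 1 :=
  ⟨by linarith [pseudoDist_nonneg z w], pseudoDist_lt_one hz hw⟩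

theorem sinh_half_hypDist {z w : ℂ} (hz : ‖z‖ < 1) (hw : ‖w‖ < 1) :
    Real.sinh (hypDist z w / 2) = ‖z - w‖ / √((1 - ‖z‖ ^ 2) * (1 - ‖w‖ ^ 2)) := by
  have h : 0 < ‖1 - conj w * z‖ := norm_pos_iff.mpr (one_sub_conj_mul_ne_zero hz hw)
  have h1 := one_sub_norm_sq_pos hz
  have h2 := one_sub_norm_sq_pos hw
  rw [hypDist_eq, mul_div_cancel_left₀ _ two_ne_zero, Real.sinh_artanh (pseudoDist_mem hz hw),
    pseudoDist_sq hz hw, Real.sqrt_div (by positivity), Real.sqrt_sq h.le, pseudoDist, norm_div,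
    div_div_div_cancel_right₀ h.ne']

/-- This form has no factor 1 - conj w * z, so a Euclidean bound on z - w becomes a hyperbolic one
directly. -/
theorem hypDist_eq_arsinh {z w : ℂ} (hz : ‖z‖ < 1) (hw : ‖w‖ < 1) :
    hypDist z w = 2 * Real.arsinh (‖z - w‖ / √((1 - ‖z‖ ^ 2) * (1 - ‖w‖ ^ 2))) := by
  rw [← sinh_half_hypDist hz hw, Real.arsinh_sinh]; ring

theorem hypDist_comm {z w : ℂ} (hz : ‖z‖ < 1) (hw : ‖w‖ < 1) : hypDist z w = hypDist w z := by
  rw [hypDist_eq_arsinh hz hw, hypDist_eq_arsinh hw hz, norm_sub_rev, mul_comm (1 - ‖z‖ ^ 2)]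

theorem hypDist_le_of_pseudoDist_le {z w z' w' : ℂ} (hz : ‖z'‖ < 1) (hw : ‖w'‖ < 1)
    (h : pseudoDist z w ≤ pseudoDist z' w') : hypDist z w ≤ hypDist z' w' := by
  rw [hypDist_eq, hypDist_eq]
  have := Real.artanh_le_artanh (by linarith [pseudoDist_nonneg z w]) (pseudoDist_lt_one hz hw) h
  linarith

theorem exp_hypDist {z w : ℂ} (hz : ‖z‖ < 1) (hw : ‖w‖ < 1) :
    Real.exp (hypDist z w) = (1 + pseudoDist z w) / (1 - pseudoDist z w) := by
  have h0 := pseudoDist_nonneg z w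
  have h1 := pseudoDist_lt_one hz hw
  rw [hypDist_eq, two_mul, Real.exp_add, Real.exp_artanh (pseudoDist_mem hz hw)]
  exact Real.mul_self_sqrt (div_nonneg (by linarith) (by linarith))

/-- The disk automorphism that takes `p` to `0`. -/
def mob (p z : ℂ) : ℂ := (z - p) / (1 - conj p * z)

theorem norm_mob_lt_one {p z : ℂ} (hp : ‖p‖ < 1) (hz : ‖z‖ < 1) : ‖mob p z‖ < 1 :=
  pseudoDist_lt_one hz hp

theorem mob_neg_mob {p z : ℂ} (hp : ‖p‖ < 1) (hz : ‖z‖ < 1) : mob (-p) (mob p z) = z := by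
  have h := one_sub_conj_mul_ne_zero hz hp
  have h2 : 1 - conj p * p ≠ 0 := one_sub_conj_mul_ne_zero hp hp
  have h' : 1 - z * conj p ≠ 0 := by rwa [mul_comm]
  have h2' : 1 - p * conj p ≠ 0 := by rwa [mul_comm]
  simp only [mob, map_neg]
  have h3 : 1 - -conj p * ((z - p) / (1 - conj p * z))
      = (1 - conj p * p) / (1 - conj p * z) := by field_simp; ring
  rw [h3, div_eq_iff (div_ne_zero h2 h), sub_neg_eq_add, div_add' _ _ _ h, mul_div_assoc']
  congr 1
  ring

theorem one_sub_norm_mob_sq {p z : ℂ} (hp : ‖p‖ < 1) (hz : ‖z‖ < 1) :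
    1 - ‖mob p z‖ ^ 2 = (1 - ‖z‖ ^ 2) * (1 - ‖p‖ ^ 2) / ‖1 - conj p * z‖ ^ 2 :=
  pseudoDist_sq hz hp

theorem mob_sub_mob {p z w : ℂ} (hp : ‖p‖ < 1) (hz : ‖z‖ < 1) (hw : ‖w‖ < 1) :
    mob p z - mob p w
      = (z - w) * (1 - conj p * p) / ((1 - conj p * z) * (1 - conj p * w)) := by
  have h := one_sub_conj_mul_ne_zero hz hp
  have h2 := one_sub_conj_mul_ne_zero hw hp
  have h' : 1 - z * conj p ≠ 0 := by rwa [mul_comm]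
  have h2' : 1 - w * conj p ≠ 0 := by rwa [mul_comm]
  simp only [mob]
  field_simp
  ring

theorem hypDist_mob {p z w : ℂ} (hp : ‖p‖ < 1) (hz : ‖z‖ < 1) (hw : ‖w‖ < 1) :
    hypDist (mob p z) (mob p w) = hypDist z w := by
  have h : 0 < ‖1 - conj p * z‖ := norm_pos_iff.mpr (one_sub_conj_mul_ne_zero hz hp)
  have h2 : 0 < ‖1 - conj p * w‖ := norm_pos_iff.mpr (one_sub_conj_mul_ne_zero hw hp)
  have hpp := one_sub_norm_sq_pos hp
  have hzz := one_sub_norm_sq_pos hz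
  have hww := one_sub_norm_sq_pos hw
  rw [hypDist_eq_arsinh (norm_mob_lt_one hp hz) (norm_mob_lt_one hp hw), hypDist_eq_arsinh hz hw,
    one_sub_norm_mob_sq hp hz, one_sub_norm_mob_sq hp hw, mob_sub_mob hp hz hw]
  have e1 : ‖1 - conj p * p‖ = 1 - ‖p‖ ^ 2 := by
    rw [← Complex.normSq_eq_conj_mul_self, Complex.normSq_eq_norm_sq, ← Complex.ofReal_one,
      ← Complex.ofReal_sub, Complex.norm_real, Real.norm_of_nonneg hpp.le]
  have e2 : (1 - ‖z‖ ^ 2) * (1 - ‖p‖ ^ 2) / ‖1 - conj p * z‖ ^ 2 *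
      ((1 - ‖w‖ ^ 2) * (1 - ‖p‖ ^ 2) / ‖1 - conj p * w‖ ^ 2) = ((1 - ‖z‖ ^ 2) * (1 - ‖w‖ ^ 2)) *
      ((1 - ‖p‖ ^ 2) / (‖1 - conj p * z‖ * ‖1 - conj p * w‖)) ^ 2 := by
    field_simp
  rw [e2, Real.sqrt_mul (by positivity), Real.sqrt_sq (by positivity), norm_div, norm_mul,
    norm_mul, e1]
  congr 2
  have : 0 < √((1 - ‖z‖ ^ 2) * (1 - ‖w‖ ^ 2)) := Real.sqrt_pos.mpr (by positivity)
  generalize ‖1 - conj p * z‖ = A at *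
  generalize ‖1 - conj p * w‖ = B at *
  field_simp

theorem mob_self (p : ℂ) : mob p p = 0 := by simp [mob]

theorem pseudoDist_zero_right (z : ℂ) : pseudoDist z 0 = ‖z‖ := by simp [pseudoDist]

theorem pseudoDist_zero_left (z : ℂ) : pseudoDist 0 z = ‖z‖ := by simp [pseudoDist]

theorem exp_hypDist_zero {z : ℂ} (hz : ‖z‖ < 1) :
    Real.exp (hypDist 0 z) = (1 + ‖z‖) / (1 - ‖z‖) := by
  rw [exp_hypDist (by simp) hz, pseudoDist_zero_left]

/-- After exponentiation this is p ≤ (r + s)/(1 + rs), the addition formula of tanh. It follows from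
the formula for 1 - p^2 and |1 - conj w * z| ≤ 1 + rs. The general triangle inequality moves the
middle point to 0. -/
theorem hypDist_triangle_zero {z w : ℂ} (hz : ‖z‖ < 1) (hw : ‖w‖ < 1) :
    hypDist z w ≤ hypDist z 0 + hypDist 0 w := by
  rw [← Real.exp_le_exp, Real.exp_add, exp_hypDist hz hw, exp_hypDist hz (by simp),
    exp_hypDist (by simp) hw, pseudoDist_zero_left, pseudoDist_zero_right]
  have h0 := pseudoDist_nonneg z w
  have h1 := pseudoDist_lt_one hz hw
  have hr := norm_nonneg z
  have hs := norm_nonneg w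
  set p := pseudoDist z w with hp
  set r := ‖z‖
  set s := ‖w‖
  have hrs := mul_nonneg hr hs
  have key : p * (1 + r * s) ≤ r + s := by
    have h2 : ‖1 - conj w * z‖ ≤ 1 + r * s := by
      refine (norm_sub_le _ _).trans ?_
      rw [norm_one, norm_mul, RCLike.norm_conj, mul_comm]
    have h3 : 0 < ‖1 - conj w * z‖ := norm_pos_iff.mpr (one_sub_conj_mul_ne_zero hz hw)
    have h4 : (1 - p ^ 2) * ‖1 - conj w * z‖ ^ 2 = (1 - r ^ 2) * (1 - s ^ 2) := by
      rw [hp, pseudoDist_sq hz hw]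
      field_simp
      rfl
    have h5 : (1 - r ^ 2) * (1 - s ^ 2) ≤ (1 - p ^ 2) * (1 + r * s) ^ 2 := by
      rw [← h4]
      have : 0 ≤ 1 - p ^ 2 := by nlinarith
      gcongr
    refine abs_le_of_sq_le_sq' ?_ (by positivity) |>.2
    nlinarith
  rw [div_mul_div_comm, div_le_div_iff₀ (by linarith)
    (mul_pos (by linarith) (by linarith))]
  nlinarith

theorem hypDist_triangle {z w v : ℂ} (hz : ‖z‖ < 1) (hw : ‖w‖ < 1) (hv : ‖v‖ < 1) :
    hypDist z v ≤ hypDist z w + hypDist w v := by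
  have := hypDist_triangle_zero (norm_mob_lt_one hw hz) (norm_mob_lt_one hw hv)
  rw [← mob_self w, hypDist_mob hw hz hv, hypDist_mob hw hz hw, hypDist_mob hw hw hv] at this
  exact this

theorem norm_ofReal_lt_one {x : ℝ} (h0 : -1 < x) (h1 : x < 1) : ‖(x : ℂ)‖ < 1 := by
  rw [Complex.norm_real, Real.norm_eq_abs, abs_lt]; exact ⟨h0, h1⟩

theorem exp_hypDist_real {x y : ℝ} (hx : -1 < x) (hxy : x ≤ y) (hy : y < 1) :
    Real.exp (hypDist x y) = (1 + y) * (1 - x) / ((1 - y) * (1 + x)) := by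
  have h1 : 0 < 1 - y * x := by nlinarith
  have : pseudoDist (x : ℂ) y = (y - x) / (1 - y * x) := by
    rw [pseudoDist, Complex.conj_ofReal, ← Complex.ofReal_mul, ← Complex.ofReal_one,
      ← Complex.ofReal_sub, ← Complex.ofReal_sub, ← Complex.ofReal_div, Complex.norm_real,
      norm_div, Real.norm_of_nonneg h1.le, Real.norm_eq_abs, abs_sub_comm,
      abs_of_nonneg (by linarith)]
  rw [exp_hypDist (norm_ofReal_lt_one hx (by linarith)) (norm_ofReal_lt_one (by linarith) hy), this]
  have h2 : 0 < 1 - y := by linarith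
  have h3 : 0 < 1 + x := by linarith
  have h4 : 1 - (y - x) / (1 - y * x) = (1 - y) * (1 + x) / (1 - y * x) := by
    field_simp; ring
  rw [h4]
  field_simp
  ring

theorem hypDist_real_add {x y t : ℝ} (hx : -1 < x) (hxy : x ≤ y) (hyt : y ≤ t) (ht : t < 1) :
    hypDist x t = hypDist x y + hypDist y t := by
  apply Real.exp_injective
  rw [Real.exp_add, exp_hypDist_real hx (by linarith) ht, exp_hypDist_real hx hxy (by linarith),
    exp_hypDist_real (by linarith) hyt ht]
  have : 0 < 1 + y := by linarith
  have : 0 < 1 - y := by linarith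
  have : 0 < 1 + x := by linarith
  have : 0 < 1 - t := by linarith
  field_simp

/-- The Schwarz–Pick lemma. -/
theorem hypDist_le_of_mapsTo {g : ℂ → ℂ} (hd : DifferentiableOn ℂ g (Metric.ball 0 1))
    (hg : ∀ z, ‖z‖ < 1 → ‖g z‖ < 1) {z w : ℂ} (hz : ‖z‖ < 1) (hw : ‖w‖ < 1) :
    hypDist (g z) (g w) ≤ hypDist z w := by
  have hnw : ‖-w‖ < 1 := by rwa [norm_neg]
  have hd1 : DifferentiableOn ℂ (mob (g w) ∘ g ∘ mob (-w)) (Metric.ball 0 1) := by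
    have hm : ∀ p : ℂ, ‖p‖ < 1 → DifferentiableOn ℂ (mob p) (Metric.ball 0 1) := by
      intro p hp
      refine DifferentiableOn.div (by fun_prop) (by fun_prop) ?_
      intro x hx
      exact one_sub_conj_mul_ne_zero (by simpa using hx) hp
    refine (hm _ (hg w hw)).comp (hd.comp (hm _ hnw) ?_) ?_
    · intro x hx; simpa using norm_mob_lt_one hnw (by simpa using hx)
    · intro x hx; simpa using hg _ (norm_mob_lt_one hnw (by simpa using hx))
  have h := Complex.norm_le_norm_of_mapsTo_ball (z := mob w z) hd1 ?_ ?_ ?_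
  · simp only [Function.comp_apply, mob_neg_mob hw hz] at h
    exact hypDist_le_of_pseudoDist_le hz hw h
  · intro x hx
    have := norm_mob_lt_one (hg w hw) (hg _ (norm_mob_lt_one hnw (by simpa using hx : ‖x‖ < 1)))
    simpa using this.le
  · have : mob (-w) 0 = w := by simp [mob]
    simp [this, mob_self]
  · exact norm_mob_lt_one hw hz

theorem hypDist_le_of_norm_sub_le {z w : ℂ} {M : ℝ} (hz : ‖z‖ < 1) (hw : ‖w‖ < 1)
    (h : ‖z - w‖ ≤ M * √((1 - ‖z‖ ^ 2) * (1 - ‖w‖ ^ 2))) :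
    hypDist z w ≤ 2 * Real.arsinh M := by
  have h1 := one_sub_norm_sq_pos hz
  have h2 := one_sub_norm_sq_pos hw
  have : 0 < √((1 - ‖z‖ ^ 2) * (1 - ‖w‖ ^ 2)) := Real.sqrt_pos.mpr (by positivity)
  rw [hypDist_eq_arsinh hz hw]
  have := Real.arsinh_le_arsinh.mpr ((div_le_iff₀ this).mpr h)
  linarith

/-! ### Coarse geodesic rays -/

/-- The point at distance `s` from the origin on the positive radius. -/
def radial (s : ℝ) : ℝ := Real.tanh (s / 2)

theorem radial_lt_one (s : ℝ) : radial s < 1 := (Real.tanh_bijOn.mapsTo (Set.mem_univ (s / 2))).2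

theorem neg_one_lt_radial (s : ℝ) : -1 < radial s :=
  (Real.tanh_bijOn.mapsTo (Set.mem_univ (s / 2))).1

theorem one_add_radial_div (s : ℝ) : (1 + radial s) / (1 - radial s) = Real.exp s := by
  have h := Real.exp_artanh ⟨neg_one_lt_radial s, radial_lt_one s⟩
  rw [radial, Real.artanh_tanh] at h
  have h1 := radial_lt_one s
  have h2 := neg_one_lt_radial s
  have h3 : Real.exp s = Real.exp (s / 2) * Real.exp (s / 2) := by
    rw [← Real.exp_add]; ring_nf
  rw [h3, h, Real.mul_self_sqrt]
  · rfl
  · exact div_nonneg (by rw [radial] at h2; linarith) (by rw [radial] at h1; linarith)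

theorem radial_mono {s t : ℝ} (h : s ≤ t) : radial s ≤ radial t := by
  rw [← Real.artanh_le_artanh_iff ⟨neg_one_lt_radial s, radial_lt_one s⟩
    ⟨neg_one_lt_radial t, radial_lt_one t⟩, radial, radial, Real.artanh_tanh, Real.artanh_tanh]
  linarith

theorem radial_nonneg {s : ℝ} (h : 0 ≤ s) : 0 ≤ radial s := by
  have := radial_mono h
  simpa [radial] using this

theorem norm_radial_lt_one (s : ℝ) : ‖(radial s : ℂ)‖ < 1 :=
  norm_ofReal_lt_one (neg_one_lt_radial s) (radial_lt_one s)

theorem hypDist_radial_of_le {s t : ℝ} (h : s ≤ t) :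
    hypDist (radial s) (radial t) = t - s := by
  apply Real.exp_injective
  rw [exp_hypDist_real (neg_one_lt_radial s) (radial_mono h) (radial_lt_one t), Real.exp_sub,
    ← one_add_radial_div s, ← one_add_radial_div t]
  have := neg_one_lt_radial s
  have := radial_lt_one s
  have : 0 < 1 + radial s := by linarith
  have : 0 < 1 - radial s := by linarith
  have : 0 < 1 - radial t := by linarith [radial_lt_one t]
  field_simp

theorem hypDist_radial (s t : ℝ) : hypDist (radial s) (radial t) = |s - t| := by
  rcases le_total s t with h | h
  · rw [hypDist_radial_of_le h, abs_sub_comm, abs_of_nonneg (by linarith)]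
  · rw [hypDist_comm (norm_radial_lt_one s) (norm_radial_lt_one t), hypDist_radial_of_le h,
      abs_of_nonneg (by linarith)]

theorem hypDist_mul_right {u z w : ℂ} (hu : ‖u‖ = 1) (hz : ‖z‖ < 1) (hw : ‖w‖ < 1) :
    hypDist (z * u) (w * u) = hypDist z w := by
  rw [hypDist_eq_arsinh hz hw, hypDist_eq_arsinh (by simpa [hu]) (by simpa [hu]), ← sub_mul,
    norm_mul, norm_mul, norm_mul, hu]
  simp

theorem radial_hypDist_zero {z : ℂ} (hz : ‖z‖ < 1) : radial (hypDist 0 z) = ‖z‖ := by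
  rw [hypDist_eq, pseudoDist_zero_left, radial, mul_div_cancel_left₀ _ two_ne_zero,
    Real.tanh_artanh ⟨by linarith [norm_nonneg z], hz⟩]

/-- A set `P` is a coarse geodesic ray with constant `C`: it is within distance `C` of a ray `q`
that stretches distances by at most the additive constant `C`. -/
structure IsQuasiRay (C : ℝ) (P : Set ℂ) (q : ℝ → ℂ) : Prop where
  norm_lt : ∀ s, 0 ≤ s → ‖q s‖ < 1
  le_dist : ∀ s t, 0 ≤ s → s ≤ t → t - s ≤ hypDist (q s) (q t)
  dist_le : ∀ s t, 0 ≤ s → s ≤ t → hypDist (q s) (q t) ≤ t - s + C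
  mem_norm_lt : ∀ z ∈ P, ‖z‖ < 1
  near : ∀ z ∈ P, ∃ s, 0 ≤ s ∧ hypDist z (q s) ≤ C
  near' : ∀ s, 0 ≤ s → ∃ z ∈ P, hypDist (q s) z ≤ C

/-- The hypothesis says that z is almost on the geodesic from 0 to w. Then w lies in the shadow of
z, whose Euclidean size is comparable to 1 - |z|. -/
theorem norm_sub_le_of_hypDist_le {z w : ℂ} {C : ℝ} (hz : ‖z‖ < 1) (hw : ‖w‖ < 1)
    (h : hypDist z w ≤ hypDist 0 w - hypDist 0 z + 2 * C) :
    ‖z - w‖ ≤ 2 * Real.exp C * (1 - ‖z‖) := by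
  have h1 := one_sub_norm_sq_pos hz
  have h2 := one_sub_norm_sq_pos hw
  have h3 : 0 < 1 - ‖z‖ := by linarith
  have h4 : 0 < 1 - ‖w‖ := by linarith
  have h5 : 0 < 1 + ‖z‖ := by linarith [norm_nonneg z]
  have h6 := Real.exp_le_exp.mpr h
  rw [Real.exp_add, Real.exp_sub, exp_hypDist_zero hz, exp_hypDist_zero hw, two_mul C,
    Real.exp_add] at h6
  have h7 : Real.sinh (hypDist z w / 2) ^ 2 ≤ Real.exp (hypDist z w) := by
    have e : Real.exp (hypDist z w) = Real.exp (hypDist z w / 2) ^ 2 := by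
      rw [← Real.exp_nat_mul]; congr 1; push_cast; ring
    rw [e]
    have hd := hypDist_nonneg z w
    have := Real.exp_pos (hypDist z w / 2)
    have := Real.exp_pos (-(hypDist z w / 2))
    refine pow_le_pow_left₀ (Real.sinh_nonneg_iff.mpr (by linarith)) ?_ 2
    rw [Real.sinh_eq]; linarith
  rw [sinh_half_hypDist hz hw, div_pow, Real.sq_sqrt (by positivity),
    div_le_iff₀ (by positivity)] at h7
  have h8 : ‖z - w‖ ^ 2 ≤ (2 * Real.exp C * (1 - ‖z‖)) ^ 2 := by
    refine h7.trans ((mul_le_mul_of_nonneg_right h6 (by positivity)).trans ?_)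
    have e : (1 + ‖w‖) / (1 - ‖w‖) / ((1 + ‖z‖) / (1 - ‖z‖)) * (Real.exp C * Real.exp C) *
        ((1 - ‖z‖ ^ 2) * (1 - ‖w‖ ^ 2)) = (Real.exp C * (1 - ‖z‖)) ^ 2 * (1 + ‖w‖) ^ 2 := by
      field_simp; ring
    rw [e, mul_assoc 2, mul_pow 2, mul_comm (2 ^ 2)]
    gcongr
    linarith
  have := Real.exp_pos C
  exact abs_le_of_sq_le_sq' h8 (by positivity) |>.2

/-- The constant of the geodesic approximation of a coarse ray. -/
def geodesicConst (C : ℝ) : ℝ := 2 * Real.arsinh (2 * Real.exp C + 1) + 2 * C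

/-- Move `q 0` to the origin. All later points of the moved ray Q lie in the shadow of Q s, so any
accumulation point u of Q n, which is on the unit circle, lies in all these shadows. The radius
towards u is the required geodesic. -/
theorem IsQuasiRay.exists_geodesic {C : ℝ} {P : Set ℂ} {q : ℝ → ℂ} (h : IsQuasiRay C P q) :
    ∃ S : Set ℂ, IsGeodesicSegment S ∧
      (∀ z ∈ P, ∃ w ∈ S, hypDist z w ≤ geodesicConst C) ∧
      (∀ w ∈ S, ∃ z ∈ P, hypDist w z ≤ geodesicConst C) := by
  set p := q 0 with hp
  have hp1 : ‖p‖ < 1 := h.norm_lt 0 le_rfl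
  have hnp1 : ‖-p‖ < 1 := by rwa [norm_neg]
  set Q : ℝ → ℂ := fun s => mob p (q s) with hQ
  have hQ1 : ∀ s, 0 ≤ s → ‖Q s‖ < 1 := fun s hs => norm_mob_lt_one hp1 (h.norm_lt s hs)
  have hQ0 : Q 0 = 0 := mob_self p
  have hQd : ∀ s t, 0 ≤ s → 0 ≤ t → hypDist (Q s) (Q t) = hypDist (q s) (q t) :=
    fun s t hs ht => hypDist_mob hp1 (h.norm_lt s hs) (h.norm_lt t ht)
  have hlow : ∀ s, 0 ≤ s → s ≤ hypDist 0 (Q s) := fun s hs => by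
    rw [← hQ0, hQd 0 s le_rfl hs]; simpa using h.le_dist 0 s le_rfl hs
  have hupp : ∀ s, 0 ≤ s → hypDist 0 (Q s) ≤ s + C := fun s hs => by
    rw [← hQ0, hQd 0 s le_rfl hs]; simpa using h.dist_le 0 s le_rfl hs
  have hmain : ∀ s t, 0 ≤ s → s ≤ t → ‖Q s - Q t‖ ≤ 2 * Real.exp C * (1 - ‖Q s‖) := by
    intro s t hs hst
    refine norm_sub_le_of_hypDist_le (hQ1 s hs) (hQ1 t (hs.trans hst)) ?_
    rw [hQd s t hs (hs.trans hst)]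
    linarith [h.dist_le s t hs hst, hlow t (hs.trans hst), hupp s hs]
  obtain ⟨u, -, φ, hφ, hu⟩ := (isCompact_closedBall (0 : ℂ) 1).tendsto_subseq
    (x := fun n : ℕ => Q n) (fun n => by simpa using (hQ1 n (Nat.cast_nonneg n)).le)
  have hcast : Tendsto (fun n => ((φ n : ℕ) : ℝ)) atTop atTop :=
    tendsto_natCast_atTop_atTop.comp hφ.tendsto_atTop
  have hrad : Tendsto (fun n => radial (φ n)) atTop (𝓝 1) := by
    have e : ∀ s, radial s = 1 - 2 / (Real.exp s + 1) := by
      intro s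
      have h1 : 0 < 1 - radial s := by linarith [radial_lt_one s]
      have h2 : 0 < Real.exp s + 1 := by positivity
      rw [← one_add_radial_div s]
      field_simp
      ring
    simp_rw [e]
    have := ((tendsto_atTop_add_const_right _ 1 (Real.tendsto_exp_atTop.comp hcast)).const_div_atTop
      2).const_sub 1
    simpa using this
  have hu1 : ‖u‖ = 1 := by
    refine tendsto_nhds_unique hu.norm ?_
    refine tendsto_of_tendsto_of_tendsto_of_le_of_le hrad tendsto_const_nhds ?_ ?_
    · intro n
      simp only [Function.comp_apply]
      rw [← radial_hypDist_zero (hQ1 _ (Nat.cast_nonneg _))]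
      exact radial_mono (hlow _ (Nat.cast_nonneg _))
    · intro n
      exact (hQ1 _ (Nat.cast_nonneg _)).le
  have hlim : ∀ s, 0 ≤ s → ‖Q s - u‖ ≤ 2 * Real.exp C * (1 - ‖Q s‖) := by
    intro s hs
    refine le_of_tendsto (hu.const_sub (Q s)).norm ?_
    filter_upwards [hcast.eventually_ge_atTop s] with n hn
    exact hmain s _ hs hn
  have hradu : ∀ s, ‖(radial s : ℂ) * u‖ < 1 := fun s => by
    rw [norm_mul, hu1, mul_one]; exact norm_radial_lt_one s
  -- Compare Q s with the point of the radius of the same modulus, then slide along the radius by at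
  -- most `C`.
  have hclose : ∀ s, 0 ≤ s →
      hypDist (Q s) (radial s * u) ≤ 2 * Real.arsinh (2 * Real.exp C + 1) + C := by
    intro s hs
    have hr := hQ1 s hs
    set r := ‖Q s‖ with hrdef
    have hr0 : 0 ≤ r := norm_nonneg _
    have hru : ‖(r : ℂ) * u‖ = r := by
      rw [norm_mul, hu1, mul_one, Complex.norm_real, Real.norm_of_nonneg hr0]
    have h1 : hypDist (Q s) (r * u) ≤ 2 * Real.arsinh (2 * Real.exp C + 1) := by
      refine hypDist_le_of_norm_sub_le hr (by rwa [hru]) ?_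
      rw [hru, ← hrdef, Real.sqrt_mul_self (by nlinarith)]
      have h2 : ‖Q s - r * u‖ ≤ ‖Q s - u‖ + (1 - r) := by
        have : Q s - r * u = (Q s - u) + ((1 - r : ℝ) : ℂ) * u := by push_cast; ring
        rw [this]
        refine (norm_add_le _ _).trans ?_
        rw [norm_mul, hu1, mul_one, Complex.norm_real, Real.norm_of_nonneg (by linarith)]
      have h3 := hlim s hs
      have h4 : (2 * Real.exp C + 1) * (1 - r) ≤ (2 * Real.exp C + 1) * (1 - r ^ 2) := by
        have := Real.exp_pos C
        gcongr
        nlinarith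
      linarith
    have h2 : hypDist (r * u) (radial s * u) ≤ C := by
      rw [hypDist_mul_right hu1 (norm_ofReal_lt_one (by linarith) hr) (norm_radial_lt_one s), hrdef,
        ← radial_hypDist_zero hr, hypDist_radial, abs_of_nonneg (by linarith [hlow s hs])]
      linarith [hupp s hs]
    have := hypDist_triangle hr (by rwa [hru] : ‖(r : ℂ) * u‖ < 1) (hradu s)
    linarith
  set g : ℝ → ℂ := fun s => mob (-p) (radial s * u) with hg
  have hg1 : ∀ s, ‖g s‖ < 1 := fun s => norm_mob_lt_one hnp1 (hradu s)
  have hqg : ∀ s, 0 ≤ s →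
      hypDist (q s) (g s) ≤ 2 * Real.arsinh (2 * Real.exp C + 1) + C := by
    intro s hs
    have := hypDist_mob hnp1 (hQ1 s hs) (hradu s)
    rw [hQ, mob_neg_mob hp1 (h.norm_lt s hs)] at this
    rw [hg, this]
    exact hclose s hs
  refine ⟨g '' Set.Ici 0, ⟨Set.Ici 0, g, Set.nonempty_Ici, Set.ordConnected_Ici, ?_, ?_, rfl⟩,
    ?_, ?_⟩
  · intro s _
    simpa using hg1 s
  · intro s _ t _
    rw [hg, hypDist_mob hnp1 (hradu s) (hradu t),
      hypDist_mul_right hu1 (norm_radial_lt_one s) (norm_radial_lt_one t), hypDist_radial]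
  · intro z hz
    obtain ⟨s, hs, hzs⟩ := h.near z hz
    refine ⟨g s, ⟨s, hs, rfl⟩, ?_⟩
    have := hypDist_triangle (h.mem_norm_lt z hz) (h.norm_lt s hs) (hg1 s)
    rw [geodesicConst]
    linarith [hqg s hs]
  · rintro _ ⟨s, hs, rfl⟩
    obtain ⟨z, hz, hzs⟩ := h.near' s hs
    refine ⟨z, hz, ?_⟩
    have := hypDist_triangle (hg1 s) (h.norm_lt s hs) (h.mem_norm_lt z hz)
    rw [hypDist_comm (hg1 s) (h.norm_lt s hs)] at this
    rw [geodesicConst]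
    linarith [hqg s hs]

theorem norm_sub_eq_of_norm_eq {z w : ℂ} {r : ℝ} (hz : ‖z‖ = r) (hw : ‖w‖ = r) (hr : r < 1) :
    ‖z - w‖ = (1 - r ^ 2) * Real.sinh (hypDist z w / 2) := by
  have h1 : 0 < 1 - r ^ 2 := by
    have := one_sub_norm_sq_pos (z := z) (by rwa [hz])
    rwa [hz] at this
  rw [sinh_half_hypDist (by rwa [hz]) (by rwa [hw]), hz, hw, Real.sqrt_mul_self h1.le]
  field_simp

/-- The middle point makes the hyperbolic triangle inequality an equality up to a constant. On a
circle, chords are proportional to sinh(d/2), and they satisfy the Euclidean triangle inequality.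
With X, Y the exponentials of the two half-distances this gives XY ≤ (X + Y + 1)e^{4C}, so the
smaller of X and Y is at most 3e^{4C}. -/
theorem IsQuasiRay.three_point_of_le {C : ℝ} {P : Set ℂ} {q : ℝ → ℂ} (h : IsQuasiRay C P q)
    {z₁ z₂ z₃ : ℂ} {r s₁ s₂ s₃ : ℝ} (hr : r < 1) (h₁ : ‖z₁‖ = r) (h₂ : ‖z₂‖ = r) (h₃ : ‖z₃‖ = r)
    (hs : 0 ≤ s₁) (h₁₂ : s₁ ≤ s₂) (h₂₃ : s₂ ≤ s₃) (hd₁ : hypDist z₁ (q s₁) ≤ C)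
    (hd₂ : hypDist z₂ (q s₂) ≤ C) (hd₃ : hypDist z₃ (q s₃) ≤ C) :
    ‖z₁ - z₂‖ ≤ 3 * Real.exp (4 * C) * (1 - r ^ 2) ∨
      ‖z₂ - z₃‖ ≤ 3 * Real.exp (4 * C) * (1 - r ^ 2) := by
  have hn1 : ‖z₁‖ < 1 := by rwa [h₁]
  have hn2 : ‖z₂‖ < 1 := by rwa [h₂]
  have hn3 : ‖z₃‖ < 1 := by rwa [h₃]
  have hq1 := h.norm_lt s₁ hs
  have hq2 := h.norm_lt s₂ (hs.trans h₁₂)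
  have hq3 := h.norm_lt s₃ ((hs.trans h₁₂).trans h₂₃)
  have hr2 : 0 < 1 - r ^ 2 := by
    have := one_sub_norm_sq_pos hn1
    rwa [h₁] at this
  have a1 := hypDist_triangle hn1 hq1 hn2
  have a2 := hypDist_triangle hq1 hq2 hn2
  have a3 := hypDist_triangle hn2 hq2 hn3
  have a4 := hypDist_triangle hq2 hq3 hn3
  have a5 := hypDist_triangle hq1 hn1 hq3
  have a6 := hypDist_triangle hn1 hn3 hq3
  rw [hypDist_comm hq2 hn2] at a2
  rw [hypDist_comm hq3 hn3] at a4
  rw [hypDist_comm hq1 hn1] at a5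
  have b1 := h.dist_le s₁ s₂ hs h₁₂
  have b2 := h.dist_le s₂ s₃ (hs.trans h₁₂) h₂₃
  have b3 := h.le_dist s₁ s₃ hs (h₁₂.trans h₂₃)
  -- Each of the two short distances loses 3C and the long one 2C; the total 8C is halved.
  have hsum : hypDist z₁ z₂ / 2 + hypDist z₂ z₃ / 2 ≤ hypDist z₁ z₃ / 2 + 4 * C := by linarith
  have htri : ‖z₁ - z₃‖ ≤ ‖z₁ - z₂‖ + ‖z₂ - z₃‖ := norm_sub_le_norm_sub_add_norm_sub _ _ _
  rw [norm_sub_eq_of_norm_eq h₁ h₂ hr, norm_sub_eq_of_norm_eq h₂ h₃ hr] at *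
  rw [norm_sub_eq_of_norm_eq h₁ h₃ hr, ← mul_add, mul_le_mul_iff_right₀ hr2, Real.sinh_eq,
    Real.sinh_eq, Real.sinh_eq] at htri
  have hx := Real.one_le_exp (show 0 ≤ hypDist z₁ z₂ / 2 by linarith [hypDist_nonneg z₁ z₂])
  have hy := Real.one_le_exp (show 0 ≤ hypDist z₂ z₃ / 2 by linarith [hypDist_nonneg z₂ z₃])
  have hw : Real.exp (-(hypDist z₁ z₃ / 2)) ≤ 1 :=
    Real.exp_le_one_iff.mpr (by linarith [hypDist_nonneg z₁ z₃])
  have hxn := Real.exp_pos (-(hypDist z₁ z₂ / 2))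
  have hyn := Real.exp_pos (-(hypDist z₂ z₃ / 2))
  have hexp := Real.exp_le_exp.mpr hsum
  rw [Real.exp_add, Real.exp_add] at hexp
  have hE := Real.exp_pos (4 * C)
  rw [Real.sinh_eq, Real.sinh_eq]
  set X := Real.exp (hypDist z₁ z₂ / 2)
  set Y := Real.exp (hypDist z₂ z₃ / 2)
  set E := Real.exp (4 * C)
  have hmain : X * Y ≤ (X + Y + 1) * E :=
    hexp.trans (mul_le_mul_of_nonneg_right (by linarith) hE.le)
  clear_value X Y E
  have hfin : ∀ T T' : ℝ, 0 < T' → T ≤ 3 * E →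
      (1 - r ^ 2) * ((T - T') / 2) ≤ 3 * E * (1 - r ^ 2) := by
    intro T T' hT' hT
    rw [mul_comm]
    exact mul_le_mul_of_nonneg_right (by linarith) hr2.le
  rcases le_total X Y with hXY | hXY
  · refine Or.inl (hfin _ _ hxn (le_of_mul_le_mul_right (a := Y) ?_ (by linarith)))
    refine hmain.trans ?_
    rw [mul_comm, mul_assoc 3, mul_left_comm, mul_comm 3]
    exact mul_le_mul_of_nonneg_left (by linarith) hE.le
  · refine Or.inr (hfin _ _ hyn (le_of_mul_le_mul_left (a := X) ?_ (by linarith)))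
    refine hmain.trans ?_
    rw [mul_comm, mul_left_comm X 3, mul_comm X E, mul_left_comm 3 E, mul_comm 3]
    exact mul_le_mul_of_nonneg_left (by linarith) hE.le

/-- Among three points of a coarse ray on a circle centered at the origin, two are close. -/
theorem IsQuasiRay.three_point {C : ℝ} {P : Set ℂ} {q : ℝ → ℂ} (h : IsQuasiRay C P q)
    {z₁ z₂ z₃ : ℂ} {r : ℝ} (hr : r < 1) (h₁ : ‖z₁‖ = r) (h₂ : ‖z₂‖ = r) (h₃ : ‖z₃‖ = r)
    (hz₁ : z₁ ∈ P) (hz₂ : z₂ ∈ P) (hz₃ : z₃ ∈ P) :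
    ‖z₁ - z₂‖ ≤ 3 * Real.exp (4 * C) * (1 - r ^ 2) ∨
      ‖z₂ - z₃‖ ≤ 3 * Real.exp (4 * C) * (1 - r ^ 2) ∨
      ‖z₁ - z₃‖ ≤ 3 * Real.exp (4 * C) * (1 - r ^ 2) := by
  obtain ⟨s₁, hs₁, hd₁⟩ := h.near z₁ hz₁
  obtain ⟨s₂, hs₂, hd₂⟩ := h.near z₂ hz₂
  obtain ⟨s₃, hs₃, hd₃⟩ := h.near z₃ hz₃
  rcases le_total s₁ s₂ with h12 | h12 <;> rcases le_total s₂ s₃ with h23 | h23 <;>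
    rcases le_total s₁ s₃ with h13 | h13
  · have := h.three_point_of_le hr h₁ h₂ h₃ hs₁ h12 h23 hd₁ hd₂ hd₃; tauto
  · have := h.three_point_of_le hr h₁ h₂ h₃ hs₁ h12 h23 hd₁ hd₂ hd₃; tauto
  · have := h.three_point_of_le hr h₁ h₃ h₂ hs₁ h13 h23 hd₁ hd₃ hd₂
    rw [norm_sub_rev z₃ z₂] at this; tauto
  · have := h.three_point_of_le hr h₃ h₁ h₂ hs₃ h13 h12 hd₃ hd₁ hd₂
    rw [norm_sub_rev z₃ z₁] at this; tauto
  · have := h.three_point_of_le hr h₂ h₁ h₃ hs₂ h12 h13 hd₂ hd₁ hd₃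
    rw [norm_sub_rev z₂ z₁] at this; tauto
  · have := h.three_point_of_le hr h₂ h₃ h₁ hs₂ h23 h13 hd₂ hd₃ hd₁
    rw [norm_sub_rev z₃ z₁] at this; tauto
  · have := h.three_point_of_le hr h₃ h₂ h₁ hs₃ h23 h12 hd₃ hd₂ hd₁
    rw [norm_sub_rev z₃ z₂, norm_sub_rev z₂ z₁] at this; tauto
  · have := h.three_point_of_le hr h₃ h₂ h₁ hs₃ h23 h12 hd₃ hd₂ hd₁
    rw [norm_sub_rev z₃ z₂, norm_sub_rev z₂ z₁] at this; tauto

/-! ### Length of subsets of a circle -/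

/-- If two points are farther apart than η, every other point is within η of one of them, so two
intervals of length 2η cover the set. -/
theorem volume_le_of_three_point {E : Set ℝ} {η : ℝ}
    (h : ∀ x ∈ E, ∀ y ∈ E, ∀ z ∈ E, |x - y| ≤ η ∨ |y - z| ≤ η ∨ |x - z| ≤ η) :
    volume E ≤ ENNReal.ofReal (4 * η) := by
  by_cases hη : η < 0
  · have : E = ∅ := by
      by_contra hne
      obtain ⟨x, hx⟩ := Set.nonempty_iff_ne_empty.mpr hne
      have := h x hx x hx x hx
      simp only [sub_self, abs_zero, or_self] at this
      linarith
    simp [this]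
  push Not at hη
  by_cases hE : ∃ x ∈ E, ∃ y ∈ E, η < |x - y|
  · obtain ⟨x, hx, y, hy, hxy⟩ := hE
    have hsub : E ⊆ Metric.closedBall x η ∪ Metric.closedBall y η := by
      intro z hz
      rcases h x hx y hy z hz with h1 | h1 | h1
      · linarith
      · right; rwa [Metric.mem_closedBall, dist_comm, Real.dist_eq]
      · left; rwa [Metric.mem_closedBall, dist_comm, Real.dist_eq]
    refine (measure_mono hsub).trans ((measure_union_le _ _).trans ?_)
    rw [Real.volume_closedBall, Real.volume_closedBall, ← ENNReal.ofReal_add (by linarith)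
      (by linarith)]
    exact ENNReal.ofReal_le_ofReal (by linarith)
  · push Not at hE
    rcases E.eq_empty_or_nonempty with rfl | ⟨x, hx⟩
    · simp
    · have hsub : E ⊆ Metric.closedBall x η := fun z hz => by
        rw [Metric.mem_closedBall, dist_comm, Real.dist_eq]; exact hE x hx z hz
      refine (measure_mono hsub).trans ?_
      rw [Real.volume_closedBall]
      exact ENNReal.ofReal_le_ofReal (by linarith)

theorem norm_circleMap_sub (r θ θ' : ℝ) :
    ‖circleMap 0 r θ - circleMap 0 r θ'‖ = |r| * (2 * |Real.sin ((θ - θ') / 2)|) := by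
  have : circleMap 0 r θ - circleMap 0 r θ'
      = circleMap 0 r θ' * (Complex.exp (Complex.I * ((θ - θ' : ℝ) : ℂ)) - 1) := by
    simp only [circleMap, zero_add]
    rw [mul_sub, mul_assoc, ← Complex.exp_add, mul_one]
    congr 3
    push_cast
    ring
  rw [this, norm_mul, Complex.norm_exp_I_mul_ofReal_sub_one, norm_mul]
  simp

theorem norm_circleMap_sub_le {r θ θ' : ℝ} (hr : |r| ≤ 1) :
    ‖circleMap 0 r θ - circleMap 0 r θ'‖ ≤ |θ - θ'| := by
  rw [norm_circleMap_sub]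
  have h1 : |Real.sin ((θ - θ') / 2)| ≤ |(θ - θ') / 2| := Real.abs_sin_le_abs
  rw [abs_div, abs_two] at h1
  nlinarith [abs_nonneg r, abs_nonneg (Real.sin ((θ - θ') / 2))]

theorem abs_sub_le_of_norm_circleMap_sub_le {r θ θ' δ : ℝ} (hr : 1 / 2 ≤ r)
    (hθ : |θ - θ'| ≤ Real.pi) (h : ‖circleMap 0 r θ - circleMap 0 r θ'‖ ≤ δ) :
    |θ - θ'| ≤ Real.pi * δ := by
  rw [norm_circleMap_sub, abs_of_nonneg (by linarith)] at h
  have h1 := Real.mul_le_sin (x := |θ - θ'| / 2) (by positivity) (by linarith)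
  have h2 : Real.sin (|θ - θ'| / 2) ≤ |Real.sin ((θ - θ') / 2)| := by
    rcases abs_cases (θ - θ') with ⟨h, -⟩ | ⟨h, -⟩ <;> rw [h]
    · exact le_abs_self _
    · rw [neg_div, Real.sin_neg]; exact neg_le_abs _
  have hpi := Real.pi_pos
  have h3 : |θ - θ'| / Real.pi ≤ |Real.sin ((θ - θ') / 2)| := by
    refine le_trans (le_of_eq ?_) (h1.trans h2)
    field_simp
  have h4 : |θ - θ'| / Real.pi ≤ δ := by
    have := abs_nonneg (Real.sin ((θ - θ') / 2))
    nlinarith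
  rwa [div_le_iff₀' hpi] at h4

/-- Cut the circle into angular intervals shorter than ε. Within each, the three point condition
bounds the measure by a multiple of δ, and there are about 2π/ε of them. -/
theorem circleLength_le {G : Set ℂ} {r ε δ : ℝ} (hr : 1 / 2 ≤ r) (hr1 : r < 1) (hε : 0 < ε)
    (hδ : 0 ≤ δ)
    (h : ∀ z₁ ∈ G, ∀ z₂ ∈ G, ∀ z₃ ∈ G, ‖z₁‖ = r → ‖z₂‖ = r → ‖z₃‖ = r → ‖z₁ - z₂‖ < ε →
      ‖z₂ - z₃‖ < ε → ‖z₁ - z₃‖ < ε → ‖z₁ - z₂‖ ≤ δ ∨ ‖z₂ - z₃‖ ≤ δ ∨ ‖z₁ - z₃‖ ≤ δ) :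
    circleLength G r ≤ ENNReal.ofReal ((2 * Real.pi / ε + 3) * (4 * (Real.pi * δ))) := by
  have hpi := Real.pi_pos
  -- One unit gives ℓ < ε; the second gives N ≥ 2, so that ℓ ≤ π and chords control angles.
  set N : ℕ := ⌊2 * Real.pi / ε⌋₊ + 2 with hN
  have hN1 : 2 * Real.pi / ε < N := by
    rw [hN]; push_cast
    linarith [Nat.lt_floor_add_one (2 * Real.pi / ε)]
  have hN2 : (N : ℝ) ≤ 2 * Real.pi / ε + 2 := by
    rw [hN]; push_cast
    linarith [Nat.floor_le (show 0 ≤ 2 * Real.pi / ε by positivity)]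
  have hN3 : (2 : ℝ) ≤ N := by rw [hN]; push_cast; linarith [Nat.cast_nonneg (α := ℝ) ⌊2 * Real.pi / ε⌋₊]
  have hN0 : (0 : ℝ) < N := by linarith
  set ℓ : ℝ := 2 * Real.pi / N with hℓ
  have hℓ0 : 0 < ℓ := by positivity
  have hℓε : ℓ < ε := by
    rw [hℓ, div_lt_iff₀ hN0]; rw [div_lt_iff₀ hε] at hN1; linarith
  have hℓπ : ℓ ≤ Real.pi := by
    rw [hℓ, div_le_iff₀ hN0]; nlinarith
  set E : Set ℝ := {θ : ℝ | θ ∈ Set.Ioc (-Real.pi) Real.pi ∧ circleMap 0 r θ ∈ G} with hE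
  set A : ℕ → Set ℝ := fun i => {θ ∈ E | ⌊(θ + Real.pi) / ℓ⌋₊ = i} with hA
  -- The index N occurs only for θ = π; this is the extra piece.
  have hcover : E ⊆ ⋃ i ∈ Finset.range (N + 1), A i := by
    intro θ hθ
    simp only [Set.mem_iUnion, exists_prop, Finset.mem_range]
    refine ⟨⌊(θ + Real.pi) / ℓ⌋₊, ?_, hθ, rfl⟩
    refine Nat.lt_succ_of_le (Nat.floor_le_of_le ?_)
    rw [div_le_iff₀ hℓ0, hℓ, mul_div_cancel₀ _ hN0.ne']
    linarith [hθ.1.2]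
  have hA1 : ∀ i, volume (A i) ≤ ENNReal.ofReal (4 * (Real.pi * δ)) := by
    intro i
    have hclose : ∀ x ∈ A i, ∀ y ∈ A i, |x - y| < ℓ := by
      have hb : ∀ x ∈ A i, i * ℓ ≤ x + Real.pi ∧ x + Real.pi < (i + 1) * ℓ := by
        intro x hx
        have h0 : 0 ≤ (x + Real.pi) / ℓ := div_nonneg (by linarith [hx.1.1.1]) hℓ0.le
        have h1 := Nat.floor_le h0
        have h2 := Nat.lt_floor_add_one ((x + Real.pi) / ℓ)
        rw [hx.2] at h1 h2
        rw [le_div_iff₀ hℓ0] at h1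
        rw [div_lt_iff₀ hℓ0] at h2
        exact ⟨h1, h2⟩
      intro x hx y hy
      have := hb x hx
      have := hb y hy
      rw [abs_lt]
      constructor <;> linarith
    refine volume_le_of_three_point ?_
    intro x hx y hy z hz
    have hnorm : ∀ θ, ‖circleMap 0 r θ‖ = r := fun θ => by
      rw [norm_circleMap_zero, abs_of_nonneg (by linarith)]
    have hdist : ∀ θ ∈ A i, ∀ θ' ∈ A i, ‖circleMap 0 r θ - circleMap 0 r θ'‖ < ε := by
      intro θ hθ θ' hθ'
      refine (norm_circleMap_sub_le ?_).trans_lt ((hclose θ hθ θ' hθ').trans hℓε)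
      rw [abs_of_nonneg (by linarith)]; exact hr1.le
    have hback : ∀ θ ∈ A i, ∀ θ' ∈ A i, ‖circleMap 0 r θ - circleMap 0 r θ'‖ ≤ δ →
        |θ - θ'| ≤ Real.pi * δ := fun θ hθ θ' hθ' hd =>
      abs_sub_le_of_norm_circleMap_sub_le hr ((hclose θ hθ θ' hθ').le.trans hℓπ) hd
    rcases h _ hx.1.2 _ hy.1.2 _ hz.1.2 (hnorm x) (hnorm y) (hnorm z) (hdist x hx y hy)
      (hdist y hy z hz) (hdist x hx z hz) with h1 | h1 | h1
    · exact Or.inl (hback _ hx _ hy h1)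
    · exact Or.inr (Or.inl (hback _ hy _ hz h1))
    · exact Or.inr (Or.inr (hback _ hx _ hz h1))
  have hEvol : volume E ≤ ENNReal.ofReal ((2 * Real.pi / ε + 3) * (4 * (Real.pi * δ))) := by
    calc volume E ≤ ∑ i ∈ Finset.range (N + 1), volume (A i) :=
          (measure_mono hcover).trans (measure_biUnion_finset_le _ _)
      _ ≤ ∑ _i ∈ Finset.range (N + 1), ENNReal.ofReal (4 * (Real.pi * δ)) :=
          Finset.sum_le_sum fun i _ => hA1 i
      _ = ENNReal.ofReal ((N + 1 : ℝ) * (4 * (Real.pi * δ))) := by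
          rw [Finset.sum_const, Finset.card_range, nsmul_eq_mul, ← Nat.cast_succ,
            ENNReal.ofReal_mul (p := (N.succ : ℝ)) (by positivity), ENNReal.ofReal_natCast]
      _ ≤ _ := by
          refine ENNReal.ofReal_le_ofReal (mul_le_mul_of_nonneg_right ?_ (by positivity))
          linarith
  calc circleLength G r ≤ 1 * volume E := by
        refine mul_le_mul_left ?_ _
        rw [← ENNReal.ofReal_one]
        exact ENNReal.ofReal_le_ofReal hr1.le
    _ ≤ _ := by rw [one_mul]; exact hEvol

/-! ### The Blaschke product with a real parameter -/

section Blaschke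

variable {a : ℝ}

theorem blaschke_apply (a : ℝ) (z : ℂ) : blaschke a z = z * ((z + a) / (1 + a * z)) := by
  rw [blaschke, Complex.conj_ofReal]

/-- The involution of the disk that exchanges the two preimages of a point under `f_a`. -/
def deck (a : ℝ) (z : ℂ) : ℂ := -((z + a) / (1 + a * z))

theorem blaschke_eq_deck (a : ℝ) (z : ℂ) : blaschke a z = -(z * deck a z) := by
  rw [blaschke_apply, deck]; ring

theorem one_add_mul_ne_zero (ha : a ∈ Set.Ioo (0 : ℝ) 1) {z : ℂ} (hz : ‖z‖ < 1) :
    1 + (a : ℂ) * z ≠ 0 := by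
  have := one_sub_conj_mul_ne_zero hz (w := -(a : ℂ))
    (by rw [norm_neg]; exact norm_ofReal_lt_one (by linarith [ha.1]) ha.2)
  simpa using this

theorem deck_eq_mob (a : ℝ) (z : ℂ) : deck a z = -mob (-(a : ℂ)) z := by
  simp [deck, mob]

theorem norm_ofReal_param_lt_one (ha : a ∈ Set.Ioo (0 : ℝ) 1) : ‖(a : ℂ)‖ < 1 :=
  norm_ofReal_lt_one (by linarith [ha.1]) ha.2

theorem norm_neg_param_lt_one (ha : a ∈ Set.Ioo (0 : ℝ) 1) : ‖-(a : ℂ)‖ < 1 := by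
  rw [norm_neg]; exact norm_ofReal_param_lt_one ha

theorem norm_deck_lt_one (ha : a ∈ Set.Ioo (0 : ℝ) 1) {z : ℂ} (hz : ‖z‖ < 1) :
    ‖deck a z‖ < 1 := by
  rw [deck_eq_mob, norm_neg]
  exact norm_mob_lt_one (norm_neg_param_lt_one ha) hz

theorem hypDist_neg (z w : ℂ) : hypDist (-z) (-w) = hypDist z w := by
  simp only [hypDist, map_neg, neg_mul_neg]
  rw [show -z - -w = -(z - w) by ring, neg_div, norm_neg]

theorem hypDist_deck (ha : a ∈ Set.Ioo (0 : ℝ) 1) {z w : ℂ} (hz : ‖z‖ < 1) (hw : ‖w‖ < 1) :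
    hypDist (deck a z) (deck a w) = hypDist z w := by
  rw [deck_eq_mob, deck_eq_mob, hypDist_neg, hypDist_mob (norm_neg_param_lt_one ha) hz hw]

theorem one_sub_sq_ne_zero (ha : a ∈ Set.Ioo (0 : ℝ) 1) : (1 : ℂ) - (a : ℂ) ^ 2 ≠ 0 := by
  have : (1 : ℝ) - a ^ 2 ≠ 0 := by nlinarith [ha.1, ha.2]
  exact_mod_cast this

theorem deck_deck (ha : a ∈ Set.Ioo (0 : ℝ) 1) {z : ℂ} (hz : ‖z‖ < 1) :
    deck a (deck a z) = z := by
  have h := one_add_mul_ne_zero ha hz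
  have h' : 1 + z * (a : ℂ) ≠ 0 := by rwa [mul_comm]
  have h1 := one_sub_sq_ne_zero ha
  have h2 : 1 + (a : ℂ) * -((z + a) / (1 + a * z)) = (1 - (a : ℂ) ^ 2) / (1 + a * z) := by
    field_simp; ring
  rw [deck, deck, h2, neg_eq_iff_eq_neg, div_eq_iff (div_ne_zero h1 h)]
  field_simp
  ring

theorem blaschke_deck (ha : a ∈ Set.Ioo (0 : ℝ) 1) {z : ℂ} (hz : ‖z‖ < 1) :
    blaschke a (deck a z) = blaschke a z := by
  rw [blaschke_eq_deck, blaschke_eq_deck, deck_deck ha hz, mul_comm]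

theorem norm_blaschke_lt_one (ha : a ∈ Set.Ioo (0 : ℝ) 1) {z : ℂ} (hz : ‖z‖ < 1) :
    ‖blaschke a z‖ < 1 := by
  rw [blaschke_eq_deck, norm_neg, norm_mul]
  nlinarith [norm_deck_lt_one ha hz, norm_nonneg z, norm_nonneg (deck a z)]

theorem norm_blaschke_le (ha : a ∈ Set.Ioo (0 : ℝ) 1) {z : ℂ} (hz : ‖z‖ < 1) :
    ‖blaschke a z‖ ≤ ‖z‖ := by
  rw [blaschke_eq_deck, norm_neg, norm_mul]
  nlinarith [norm_deck_lt_one ha hz, norm_nonneg z, norm_nonneg (deck a z)]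

/-- The extreme case is z = ρ. Since |f_a(z)| = |z||`deck a z`|, this is a contraction rate of f_a
on |z| ≤ ρ. -/
theorem norm_deck_le (ha : a ∈ Set.Ioo (0 : ℝ) 1) {z : ℂ} {ρ : ℝ} (hz : ‖z‖ ≤ ρ) (hρ : ρ < 1) :
    ‖deck a z‖ ≤ (ρ + a) / (1 + a * ρ) := by
  obtain ⟨ha0, ha1⟩ := ha
  have hz1 : ‖z‖ < 1 := hz.trans_lt hρ
  have hr := norm_nonneg z
  have h0 : 0 < ‖1 + (a : ℂ) * z‖ := norm_pos_iff.mpr (one_add_mul_ne_zero ⟨ha0, ha1⟩ hz1)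
  have h1 : ‖z + a‖ ≤ ρ + a := by
    refine (norm_add_le _ _).trans ?_
    rw [Complex.norm_real, Real.norm_of_nonneg ha0.le]; linarith
  have h2 := norm_one_sub_conj_mul_sq z (-(a : ℂ))
  rw [map_neg, Complex.conj_ofReal, neg_mul, sub_neg_eq_add, sub_neg_eq_add, norm_neg,
    Complex.norm_real, Real.norm_of_nonneg ha0.le] at h2
  have haρ : 0 ≤ a * ρ := by nlinarith
  rw [deck, norm_neg, norm_div, div_le_div_iff₀ h0 (by linarith)]
  refine abs_le_of_sq_le_sq' ?_ (by nlinarith [norm_nonneg (z + a)]) |>.2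
  rw [mul_pow, mul_pow, h2]
  have h3 : ‖z + a‖ ^ 2 ≤ (ρ + a) ^ 2 := pow_le_pow_left₀ (norm_nonneg _) h1 2
  have h4 : (1 - ρ ^ 2) * (1 - a ^ 2) ≤ (1 - ‖z‖ ^ 2) * (1 - a ^ 2) := by
    refine mul_le_mul_of_nonneg_right ?_ (by nlinarith)
    nlinarith
  have h5 : (1 + a * ρ) ^ 2 = (ρ + a) ^ 2 + (1 - ρ ^ 2) * (1 - a ^ 2) := by ring
  rw [h5]
  have h6 : 0 ≤ (1 - ρ ^ 2) * (1 - a ^ 2) := mul_nonneg (by nlinarith) (by nlinarith)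
  nlinarith [mul_le_mul_of_nonneg_right h3 h6, mul_le_mul_of_nonneg_left h4 (sq_nonneg (ρ + a))]

theorem norm_blaschke_le_mul (ha : a ∈ Set.Ioo (0 : ℝ) 1) {z : ℂ} {ρ : ℝ} (hz : ‖z‖ ≤ ρ)
    (hρ : ρ < 1) : ‖blaschke a z‖ ≤ (ρ + a) / (1 + a * ρ) * ‖z‖ := by
  rw [blaschke_eq_deck, norm_neg, norm_mul, mul_comm]
  exact mul_le_mul_of_nonneg_right (norm_deck_le ha hz hρ) (norm_nonneg z)

theorem eq_or_eq_deck_of_blaschke_eq (ha : a ∈ Set.Ioo (0 : ℝ) 1) {z w : ℂ} (hz : ‖z‖ < 1)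
    (hw : ‖w‖ < 1) (h : blaschke a z = blaschke a w) : z = w ∨ z = deck a w := by
  have h1 := one_add_mul_ne_zero ha hz
  have h2 := one_add_mul_ne_zero ha hw
  rw [blaschke_apply, blaschke_apply, mul_div_assoc', mul_div_assoc', div_eq_div_iff h1 h2] at h
  have h3 : (z - w) * (z * (1 + a * w) + (w + a)) = 0 := by linear_combination h
  rcases mul_eq_zero.mp h3 with h4 | h4
  · exact Or.inl (sub_eq_zero.mp h4)
  · right
    rw [deck, ← neg_div, eq_div_iff h2]
    linear_combination h4

theorem differentiableOn_blaschke (ha : a ∈ Set.Ioo (0 : ℝ) 1) :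
    DifferentiableOn ℂ (blaschke a) (Metric.ball 0 1) := by
  have : blaschke (a : ℂ) = fun z : ℂ => z * ((z + a) / (1 + a * z)) := funext (blaschke_apply a)
  rw [this]
  refine DifferentiableOn.mul (by fun_prop) (DifferentiableOn.div (by fun_prop) (by fun_prop) ?_)
  intro z hz
  exact one_add_mul_ne_zero ha (by simpa using hz)

theorem differentiableOn_deck (ha : a ∈ Set.Ioo (0 : ℝ) 1) :
    DifferentiableOn ℂ (deck a) (Metric.ball 0 1) := by
  unfold deck
  refine DifferentiableOn.neg (DifferentiableOn.div (by fun_prop) (by fun_prop) ?_)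
  intro z hz
  exact one_add_mul_ne_zero ha (by simpa using hz)

theorem norm_iterate_lt_one (ha : a ∈ Set.Ioo (0 : ℝ) 1) {z : ℂ} (hz : ‖z‖ < 1) (n : ℕ) :
    ‖(blaschke a)^[n] z‖ < 1 := by
  induction n with
  | zero => simpa
  | succ n ih => rw [Function.iterate_succ_apply']; exact norm_blaschke_lt_one ha ih

theorem norm_iterate_le (ha : a ∈ Set.Ioo (0 : ℝ) 1) {z : ℂ} (hz : ‖z‖ < 1) (n : ℕ) :
    ‖(blaschke a)^[n] z‖ ≤ ‖z‖ := by
  induction n with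
  | zero => simp
  | succ n ih =>
    rw [Function.iterate_succ_apply']
    exact (norm_blaschke_le ha (norm_iterate_lt_one ha hz n)).trans ih

theorem norm_iterate_le_pow (ha : a ∈ Set.Ioo (0 : ℝ) 1) {z : ℂ} {ρ : ℝ} (hz : ‖z‖ ≤ ρ)
    (hρ : ρ < 1) (n : ℕ) : ‖(blaschke a)^[n] z‖ ≤ ((ρ + a) / (1 + a * ρ)) ^ n * ‖z‖ := by
  have hρ0 : 0 ≤ ρ := (norm_nonneg z).trans hz
  have ha0 := ha.1
  induction n with
  | zero => simp
  | succ n ih =>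
    rw [Function.iterate_succ_apply', pow_succ', mul_assoc]
    refine (norm_blaschke_le_mul ha ((norm_iterate_le ha (hz.trans_lt hρ) n).trans hz) hρ).trans ?_
    gcongr

theorem tendsto_iterate_zero (ha : a ∈ Set.Ioo (0 : ℝ) 1) {z : ℂ} (hz : ‖z‖ < 1) :
    Tendsto (fun n => (blaschke a)^[n] z) atTop (𝓝 0) := by
  have h0 := norm_nonneg z
  obtain ⟨ha0, ha1⟩ := ha
  have hlt : (‖z‖ + a) / (1 + a * ‖z‖) < 1 := by
    rw [div_lt_one (by positivity)]; nlinarith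
  refine squeeze_zero_norm (norm_iterate_le_pow ⟨ha0, ha1⟩ le_rfl hz) ?_
  simpa using (tendsto_pow_atTop_nhds_zero_of_lt_one (by positivity) hlt).mul_const ‖z‖

theorem exists_norm_iterate_lt (ha : a ∈ Set.Ioo (0 : ℝ) 1) {z : ℂ} (hz : ‖z‖ < 1) {ε : ℝ}
    (hε : 0 < ε) : ∃ N, ‖(blaschke a)^[N] z‖ < ε := by
  have := (tendsto_iterate_zero ha hz).norm
  rw [norm_zero] at this
  exact (this.eventually_lt_const hε).exists

theorem differentiableOn_iterate (ha : a ∈ Set.Ioo (0 : ℝ) 1) (n : ℕ) :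
    DifferentiableOn ℂ ((blaschke a)^[n]) (Metric.ball 0 1) := by
  refine (differentiableOn_blaschke ha).iterate ?_ n
  intro z hz
  simpa using norm_blaschke_lt_one ha (by simpa using hz)

theorem hypDist_blaschke_le (ha : a ∈ Set.Ioo (0 : ℝ) 1) {z w : ℂ} (hz : ‖z‖ < 1)
    (hw : ‖w‖ < 1) : hypDist (blaschke a z) (blaschke a w) ≤ hypDist z w :=
  hypDist_le_of_mapsTo (differentiableOn_blaschke ha) (fun _ h => norm_blaschke_lt_one ha h) hz hw

theorem hypDist_iterate_le (ha : a ∈ Set.Ioo (0 : ℝ) 1) (n : ℕ) {z w : ℂ} (hz : ‖z‖ < 1)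
    (hw : ‖w‖ < 1) : hypDist ((blaschke a)^[n] z) ((blaschke a)^[n] w) ≤ hypDist z w :=
  hypDist_le_of_mapsTo (differentiableOn_iterate ha n) (fun _ h => norm_iterate_lt_one ha h n) hz hw

theorem blaschke_conj (a : ℝ) (z : ℂ) : blaschke a (conj z) = conj (blaschke a z) := by
  rw [blaschke_apply, blaschke_apply]; simp

theorem iterate_conj (a : ℝ) (z : ℂ) (n : ℕ) :
    (blaschke a)^[n] (conj z) = conj ((blaschke a)^[n] z) := by
  induction n with
  | zero => rfl
  | succ n ih => rw [Function.iterate_succ_apply', ih, blaschke_conj, Function.iterate_succ_apply']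

theorem blaschke_zero (a : ℝ) : blaschke (a : ℂ) 0 = 0 := by simp [blaschke]

/-- The restriction of `f_a` to the real axis. -/
theorem blaschke_ofReal (a x : ℝ) :
    blaschke (a : ℂ) x = ((x * ((x + a) / (1 + a * x)) : ℝ) : ℂ) := by
  rw [blaschke_apply]; push_cast; rfl

theorem blaschke_im_mul (ha : a ∈ Set.Ioo (0 : ℝ) 1) {z : ℂ} (hz : ‖z‖ < 1) :
    (blaschke a z).im * ‖1 + (a : ℂ) * z‖ ^ 2 = z.im * (2 * z.re + a + a * ‖z‖ ^ 2) := by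
  have h0 : ‖1 + (a : ℂ) * z‖ ^ 2 ≠ 0 :=
    pow_ne_zero 2 (norm_ne_zero_iff.mpr (one_add_mul_ne_zero ha hz))
  rw [blaschke_apply, mul_div_assoc', Complex.div_im, Complex.normSq_eq_norm_sq, sub_mul,
    div_mul_cancel₀ _ h0, div_mul_cancel₀ _ h0, norm_sq_eq_re_im]
  simp only [Complex.mul_re, Complex.mul_im, Complex.add_re, Complex.add_im, Complex.ofReal_re,
    Complex.ofReal_im, Complex.one_re, Complex.one_im]
  ring

theorem blaschke_im_pos (ha : a ∈ Set.Ioo (0 : ℝ) 1) {z : ℂ} (hz : ‖z‖ < 1) (him : 0 < z.im)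
    (h : 0 < 2 * z.re + a) : 0 < (blaschke a z).im := by
  have h1 := blaschke_im_mul ha hz
  have h2 : 0 < z.im * (2 * z.re + a + a * ‖z‖ ^ 2) :=
    mul_pos him (by have := ha.1; positivity)
  rw [← h1] at h2
  exact pos_of_mul_pos_left h2 (by positivity)

/-! ### The Koebe function as a comparison coordinate -/

/-- The Koebe function. -/
def koebe (z : ℂ) : ℂ := z / (1 - z) ^ 2

theorem one_sub_ne_zero {z : ℂ} (hz : ‖z‖ < 1) : 1 - z ≠ 0 := by
  intro h
  rw [← sub_eq_zero.mp h, norm_one] at hz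
  exact lt_irrefl _ hz

theorem one_add_ne_zero {z : ℂ} (hz : ‖z‖ < 1) : 1 + z ≠ 0 := by
  have := one_sub_ne_zero (z := -z) (by rwa [norm_neg])
  rwa [sub_neg_eq_add] at this

/-- Since 1 - f_a = (1-z)(1+z)/(1+az), the quotient of the two values of k is (z+a)(1+az)/(1+z)^2,
and (z+a)(1+az) = a(1+z)^2 + (1-a)^2 z. This exhibits a factor in the upper half-plane whenever Im z
> 0. -/
theorem koebe_blaschke (ha : a ∈ Set.Ioo (0 : ℝ) 1) {z : ℂ} (hz : ‖z‖ < 1) :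
    koebe (blaschke a z) = koebe z * (a + (1 - a) ^ 2 * (z / (1 + z) ^ 2)) := by
  have h1 := one_add_mul_ne_zero ha hz
  have h1' : 1 + z * (a : ℂ) ≠ 0 := by rwa [mul_comm]
  have h2 := one_sub_ne_zero hz
  have h3 := one_add_ne_zero hz
  have h4 : 1 - blaschke a z = (1 - z) * (1 + z) / (1 + a * z) := by
    rw [blaschke_apply]; field_simp; ring
  rw [koebe, h4, koebe, blaschke_apply]
  field_simp
  ring

theorem koebe_im_pos {z : ℂ} (hz : ‖z‖ < 1) (him : 0 < z.im) : 0 < (koebe z).im := by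
  have h0 : 0 < ‖1 - z‖ := norm_pos_iff.mpr (one_sub_ne_zero hz)
  have h1 := one_sub_norm_sq_pos hz
  have e : (koebe z).im = z.im * (1 - ‖z‖ ^ 2) / ‖1 - z‖ ^ 4 := by
    rw [koebe, Complex.div_im, Complex.normSq_eq_norm_sq, norm_pow, ← pow_mul, norm_sq_eq_re_im,
      ← sub_div]
    congr 1
    simp only [pow_two, Complex.mul_re, Complex.mul_im, Complex.sub_re, Complex.sub_im,
      Complex.one_re, Complex.one_im]
    ring
  rw [e]; positivity

theorem koebe_re_mul {z : ℂ} (hz : ‖z‖ < 1) :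
    (koebe z).re * ‖1 - z‖ ^ 4 = z.re * (1 + ‖z‖ ^ 2) - 2 * ‖z‖ ^ 2 := by
  have h0 : 0 < ‖1 - z‖ := norm_pos_iff.mpr (one_sub_ne_zero hz)
  rw [koebe, Complex.div_re, Complex.normSq_eq_norm_sq, norm_pow, ← pow_mul, ← add_div,
    div_mul_cancel₀ _ (by positivity), norm_sq_eq_re_im]
  simp only [pow_two, Complex.mul_re, Complex.mul_im, Complex.sub_re, Complex.sub_im,
    Complex.one_re, Complex.one_im]
  ring

/-- The function is -k(-z), and z ↦ -conj z preserves the upper half-disk. -/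
theorem div_one_add_sq_im_pos {z : ℂ} (hz : ‖z‖ < 1) (him : 0 < z.im) :
    0 < (z / (1 + z) ^ 2).im := by
  have h := koebe_im_pos (z := -conj z) (by simpa) (by simpa)
  have : koebe (-conj z) = -conj (z / (1 + z) ^ 2) := by simp [koebe, neg_div]
  rwa [this, Complex.neg_im, Complex.conj_im, neg_neg] at h

end Blaschke

/-! ### The linearizing coordinate -/

section LinCoord

variable {a : ℝ}

/-- The approximants of the linearizing coordinate. -/
def linApprox (a : ℝ) (n : ℕ) (z : ℂ) : ℂ := ((a : ℂ) ^ n)⁻¹ * (blaschke a)^[n] z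

/-- A radius on which the approximants converge uniformly. -/
def linRadius (a : ℝ) : ℝ := (√a - a) / 2

theorem lt_sqrt_param (ha : a ∈ Set.Ioo (0 : ℝ) 1) : a < √a := by
  refine Real.lt_sqrt_of_sq_lt ?_
  nlinarith [ha.1, ha.2]

theorem linRadius_pos (ha : a ∈ Set.Ioo (0 : ℝ) 1) : 0 < linRadius a := by
  have := lt_sqrt_param ha
  rw [linRadius]; linarith

theorem linRadius_lt_one (ha : a ∈ Set.Ioo (0 : ℝ) 1) : linRadius a < 1 := by
  have : √a ≤ 1 := Real.sqrt_le_one.mpr ha.2.le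
  rw [linRadius]; linarith [ha.1]

theorem ofReal_param_ne_zero (ha : a ∈ Set.Ioo (0 : ℝ) 1) : (a : ℂ) ≠ 0 :=
  Complex.ofReal_ne_zero.mpr ha.1.ne'

/-- The error f_a(ζ) - aζ = ζ^2(1-a^2)/(1+aζ) is quadratic in ζ = f_a^n(z). The choice of
`linRadius` gives |ζ| ≤ q^n with q < √a, so ζ^2 beats the factor a^{-n}. -/
theorem norm_linApprox_succ_sub_le (ha : a ∈ Set.Ioo (0 : ℝ) 1) {z : ℂ} (hz : ‖z‖ ≤ linRadius a)
    (n : ℕ) : ‖linApprox a (n + 1) z - linApprox a n z‖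
      ≤ 2 / a * ((linRadius a + a) ^ 2 / a) ^ n := by
  have hρ := linRadius_pos ha
  have hρ1 := linRadius_lt_one ha
  have hz1 := hz.trans_lt hρ1
  obtain ⟨ha0, ha1⟩ := ha
  set ζ := (blaschke a)^[n] z with hζ
  have hζ1 : ‖ζ‖ < 1 := norm_iterate_lt_one ⟨ha0, ha1⟩ hz1 n
  have hne := one_add_mul_ne_zero ⟨ha0, ha1⟩ hζ1
  have hne' : 1 + ζ * (a : ℂ) ≠ 0 := by rwa [mul_comm]
  have hac := ofReal_param_ne_zero ⟨ha0, ha1⟩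
  have e : linApprox a (n + 1) z - linApprox a n z
      = ((a : ℂ) ^ (n + 1))⁻¹ * (ζ ^ 2 * ((1 - (a : ℂ) ^ 2) / (1 + a * ζ))) := by
    rw [linApprox, linApprox, Function.iterate_succ_apply', ← hζ, blaschke_apply]
    field_simp
    ring
  have hζq : ‖ζ‖ ≤ (linRadius a + a) ^ n := by
    have h1 := norm_iterate_le_pow ⟨ha0, ha1⟩ hz hρ1 n
    have h2 : ((linRadius a + a) / (1 + a * linRadius a)) ^ n ≤ (linRadius a + a) ^ n := by
      refine pow_le_pow_left₀ (by positivity) (div_le_self (by positivity) ?_) n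
      nlinarith
    calc ‖ζ‖ ≤ _ := h1
      _ ≤ (linRadius a + a) ^ n * 1 := by gcongr
      _ = _ := mul_one _
  have hfac : ‖(1 - (a : ℂ) ^ 2) / (1 + a * ζ)‖ ≤ 2 := by
    have h1 : 1 - a ≤ ‖1 + (a : ℂ) * ζ‖ := by
      have := norm_sub_norm_le (1 : ℂ) (-((a : ℂ) * ζ))
      rw [sub_neg_eq_add, norm_one, norm_neg, norm_mul, Complex.norm_real,
        Real.norm_of_nonneg ha0.le] at this
      nlinarith
    have h2 : ‖1 - (a : ℂ) ^ 2‖ = 1 - a ^ 2 := by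
      have : (1 - (a : ℂ) ^ 2) = ((1 - a ^ 2 : ℝ) : ℂ) := by push_cast; rfl
      rw [this, Complex.norm_real, Real.norm_of_nonneg (by nlinarith)]
    rw [norm_div, h2, div_le_iff₀ (by linarith)]
    nlinarith
  rw [e, norm_mul, norm_mul, norm_pow, norm_inv, norm_pow, Complex.norm_real,
    Real.norm_of_nonneg ha0.le]
  calc (a ^ (n + 1))⁻¹ * (‖ζ‖ ^ 2 * ‖(1 - (a : ℂ) ^ 2) / (1 + a * ζ)‖)
      ≤ (a ^ (n + 1))⁻¹ * (((linRadius a + a) ^ n) ^ 2 * 2) := by gcongr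
    _ = _ := by rw [div_pow, ← pow_mul, ← pow_mul, pow_succ, mul_comm 2 n]; field_simp

theorem linRatio_lt_one (ha : a ∈ Set.Ioo (0 : ℝ) 1) : (linRadius a + a) ^ 2 / a < 1 := by
  have h := lt_sqrt_param ha
  have ha0 := ha.1
  rw [div_lt_one ha0, linRadius]
  nlinarith [Real.sq_sqrt ha0.le]

theorem tendstoUniformlyOn_linApprox (ha : a ∈ Set.Ioo (0 : ℝ) 1) :
    TendstoUniformlyOn (linApprox a) (linCoord a) atTop (Metric.ball 0 (linRadius a)) := by
  have ha0 := ha.1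
  have hu : Summable fun n : ℕ => 2 / a * ((linRadius a + a) ^ 2 / a) ^ n :=
    (summable_geometric_of_lt_one (by positivity) (linRatio_lt_one ha)).mul_left _
  have h := tendstoUniformlyOn_tsum_nat hu
    (f := fun n z => linApprox a (n + 1) z - linApprox a n z) (s := Metric.ball 0 (linRadius a))
    (fun n z hz => norm_linApprox_succ_sub_le ha (by simpa using (Metric.mem_ball.mp hz).le) n)
  have h' : TendstoUniformlyOn (linApprox a)
      (fun z => (∑' n, (linApprox a (n + 1) z - linApprox a n z)) + z) atTop
      (Metric.ball 0 (linRadius a)) := by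
    rw [Metric.tendstoUniformlyOn_iff] at h ⊢
    intro ε hε
    filter_upwards [h ε hε] with n hn z hz
    have := hn z hz
    rw [Finset.sum_range_sub (fun n => linApprox a n z)] at this
    rw [dist_eq_norm] at this ⊢
    have e : linApprox a 0 z = z := by simp [linApprox]
    rw [e] at this
    convert this using 2
    ring
  refine h'.congr_right fun z hz => ?_
  have := h'.tendsto_at hz
  exact this.limUnder_eq.symm

theorem linApprox_add (ha : a ∈ Set.Ioo (0 : ℝ) 1) (n N : ℕ) (z : ℂ) :
    linApprox a (n + N) z = ((a : ℂ) ^ N)⁻¹ * linApprox a n ((blaschke a)^[N] z) := by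
  have := ofReal_param_ne_zero ha
  rw [linApprox, linApprox, ← Function.iterate_add_apply, pow_add]
  field_simp

/-- Every orbit reaches the disk of uniform convergence, and the functional equation carries
convergence back. This makes the `limUnder` in `linCoord` a genuine limit on the whole unit disk. -/
theorem tendsto_linApprox (ha : a ∈ Set.Ioo (0 : ℝ) 1) {z : ℂ} (hz : ‖z‖ < 1) :
    Tendsto (fun n => linApprox a n z) atTop (𝓝 (linCoord a z)) := by
  obtain ⟨N, hN⟩ := exists_norm_iterate_lt ha hz (linRadius_pos ha)
  have h1 := (tendstoUniformlyOn_linApprox ha).tendsto_at (x := (blaschke a)^[N] z) (by simpa)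
  have h2 := h1.const_mul ((a : ℂ) ^ N)⁻¹
  simp_rw [← linApprox_add ha] at h2
  exact tendsto_nhds_limUnder ⟨_, (tendsto_add_atTop_iff_nat N).mp h2⟩

theorem linCoord_iterate (ha : a ∈ Set.Ioo (0 : ℝ) 1) {z : ℂ} (hz : ‖z‖ < 1) (N : ℕ) :
    linCoord a ((blaschke a)^[N] z) = (a : ℂ) ^ N * linCoord a z := by
  have h1 := (tendsto_linApprox ha (norm_iterate_lt_one ha hz N)).const_mul ((a : ℂ) ^ N)⁻¹
  simp_rw [← linApprox_add ha] at h1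
  have h2 := tendsto_nhds_unique ((tendsto_add_atTop_iff_nat (f := fun n => linApprox a n z) N).mp h1)
    (tendsto_linApprox ha hz)
  have := ofReal_param_ne_zero ha
  rw [← h2]
  field_simp

theorem linCoord_blaschke (ha : a ∈ Set.Ioo (0 : ℝ) 1) {z : ℂ} (hz : ‖z‖ < 1) :
    linCoord a (blaschke a z) = a * linCoord a z := by
  simpa using linCoord_iterate ha hz 1

theorem iterate_zero (a : ℝ) (n : ℕ) : (blaschke (a : ℂ))^[n] 0 = 0 :=
  Function.iterate_fixed (blaschke_zero a) n

theorem linCoord_zero (ha : a ∈ Set.Ioo (0 : ℝ) 1) : linCoord a 0 = 0 := by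
  refine tendsto_nhds_unique (tendsto_linApprox ha (z := 0) (by simp)) ?_
  simp [linApprox, iterate_zero]

theorem linCoord_conj (ha : a ∈ Set.Ioo (0 : ℝ) 1) {z : ℂ} (hz : ‖z‖ < 1) :
    linCoord a (conj z) = conj (linCoord a z) := by
  refine tendsto_nhds_unique (tendsto_linApprox ha (z := conj z) (by simpa)) ?_
  have := (Complex.continuous_conj.tendsto _).comp (tendsto_linApprox ha hz)
  refine this.congr fun n => ?_
  simp [linApprox, iterate_conj]

theorem differentiableOn_linApprox (ha : a ∈ Set.Ioo (0 : ℝ) 1) (n : ℕ) :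
    DifferentiableOn ℂ (linApprox a n) (Metric.ball 0 1) :=
  (differentiableOn_iterate ha n).const_mul _

theorem differentiableOn_linCoord_ball (ha : a ∈ Set.Ioo (0 : ℝ) 1) :
    DifferentiableOn ℂ (linCoord a) (Metric.ball 0 (linRadius a)) := by
  refine (tendstoUniformlyOn_linApprox ha).tendstoLocallyUniformlyOn.differentiableOn
    (Eventually.of_forall fun n => ?_) Metric.isOpen_ball
  exact (differentiableOn_linApprox ha n).mono
    (Metric.ball_subset_ball (linRadius_lt_one ha).le)

theorem hasDerivAt_blaschke_zero (a : ℝ) : HasDerivAt (blaschke (a : ℂ)) a 0 := by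
  have h : blaschke (a : ℂ) = fun z : ℂ => z * ((z + a) / (1 + a * z)) := funext (blaschke_apply a)
  have h1 : DifferentiableAt ℂ (fun z : ℂ => (z + a) / (1 + a * z)) 0 :=
    DifferentiableAt.div (by fun_prop) (by fun_prop) (by simp)
  have := (hasDerivAt_id (0 : ℂ)).mul h1.hasDerivAt
  rw [h]
  simpa [Pi.mul_def] using this

theorem hasDerivAt_linApprox_zero (ha : a ∈ Set.Ioo (0 : ℝ) 1) (n : ℕ) :
    HasDerivAt (linApprox a n) 1 0 := by
  have h := ((hasDerivAt_blaschke_zero a).iterate _ (blaschke_zero a) n).const_mul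
    ((a : ℂ) ^ n)⁻¹
  rwa [inv_mul_cancel₀ (pow_ne_zero n (ofReal_param_ne_zero ha))] at h

theorem hasStrictDerivAt_linCoord_zero (ha : a ∈ Set.Ioo (0 : ℝ) 1) :
    HasStrictDerivAt (linCoord a) 1 0 := by
  have h0 : (0 : ℂ) ∈ Metric.ball (0 : ℂ) (linRadius a) := Metric.mem_ball_self (linRadius_pos ha)
  have h1 := (tendstoUniformlyOn_linApprox ha).tendstoLocallyUniformlyOn.deriv
    (Eventually.of_forall fun n => (differentiableOn_linApprox ha n).mono
      (Metric.ball_subset_ball (linRadius_lt_one ha).le)) Metric.isOpen_ball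
  have h2 := h1.tendsto_at h0
  simp only [Function.comp_apply, (hasDerivAt_linApprox_zero ha _).deriv] at h2
  have h3 : deriv (linCoord a) 0 = 1 := tendsto_nhds_unique h2 tendsto_const_nhds
  have h4 : AnalyticAt ℂ (linCoord a) 0 :=
    (differentiableOn_linCoord_ball ha).analyticAt (Metric.ball_mem_nhds 0 (linRadius_pos ha))
  rw [← h3]
  exact h4.hasStrictDerivAt

theorem continuousOn_linCoord (ha : a ∈ Set.Ioo (0 : ℝ) 1) :
    ContinuousOn (linCoord a) (Metric.ball 0 1) := by
  intro z hz
  refine ContinuousAt.continuousWithinAt ?_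
  have hz1 : ‖z‖ < 1 := by simpa using hz
  obtain ⟨N, hN⟩ := exists_norm_iterate_lt ha hz1 (linRadius_pos ha)
  have hit : ContinuousAt ((blaschke (a : ℂ))^[N]) z :=
    (differentiableOn_iterate ha N).continuousOn.continuousAt (Metric.isOpen_ball.mem_nhds hz)
  have hφ : ContinuousAt (linCoord a) ((blaschke (a : ℂ))^[N] z) :=
    (differentiableOn_linCoord_ball ha).continuousOn.continuousAt
      (Metric.isOpen_ball.mem_nhds (by simpa))
  have h1 := (ContinuousAt.comp hφ hit).const_mul ((a : ℂ) ^ N)⁻¹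
  refine h1.congr ?_
  filter_upwards [Metric.isOpen_ball.mem_nhds hz] with w hw
  have hw1 : ‖w‖ < 1 := by simpa using hw
  rw [Function.comp_apply, linCoord_iterate ha hw1 N, inv_mul_cancel_left₀
    (pow_ne_zero N (ofReal_param_ne_zero ha))]

/-- The linearizing coordinate has a continuous inverse near the attracting fixed point. -/
theorem exists_local_inverse (ha : a ∈ Set.Ioo (0 : ℝ) 1) :
    ∃ δ > 0, ∃ ψ : ℂ → ℂ, ContinuousOn ψ (Metric.ball 0 δ) ∧ ψ 0 = 0 ∧
      (∀ w, ‖w‖ < δ → ‖ψ w‖ < 1 ∧ linCoord a (ψ w) = w) ∧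
      ∃ ε > 0, ∀ z, ‖z‖ < ε → ‖linCoord a z‖ < δ ∧ ψ (linCoord a z) = z := by
  have hs := (hasStrictDerivAt_linCoord_zero ha).hasStrictFDerivAt_equiv one_ne_zero
  set e := hs.toOpenPartialHomeomorph (linCoord a) with he
  have hee : ⇑e = linCoord a := rfl
  have h0s : (0 : ℂ) ∈ e.source := hs.mem_toOpenPartialHomeomorph_source
  have h0t : (0 : ℂ) ∈ e.target := by
    have := hs.image_mem_toOpenPartialHomeomorph_target
    rwa [linCoord_zero ha] at this
  have hψ0 : e.symm 0 = 0 := by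
    have := e.left_inv h0s
    rwa [hee, linCoord_zero ha] at this
  have hc : ContinuousAt e.symm 0 := e.continuousAt_symm h0t
  have hev : ∀ᶠ w in 𝓝 (0 : ℂ), w ∈ e.target ∧ ‖e.symm w‖ < 1 := by
    refine Eventually.and (e.open_target.mem_nhds h0t) ?_
    have := hc.norm
    rw [ContinuousAt, hψ0, norm_zero] at this
    exact this.eventually_lt_const one_pos
  obtain ⟨δ, hδ, hδ'⟩ := Metric.eventually_nhds_iff.mp hev
  refine ⟨δ, hδ, e.symm, ?_, hψ0, ?_, ?_⟩
  · intro w hw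
    exact (e.continuousAt_symm (hδ' (Metric.mem_ball.mp hw)).1).continuousWithinAt
  · intro w hw
    have := hδ' (y := w) (by simpa using hw)
    exact ⟨this.2, e.right_inv this.1⟩
  · have hev2 : ∀ᶠ z in 𝓝 (0 : ℂ), z ∈ e.source ∧ ‖linCoord a z‖ < δ := by
      refine Eventually.and (e.open_source.mem_nhds h0s) ?_
      have := (hasStrictDerivAt_linCoord_zero ha).hasDerivAt.continuousAt.norm
      rw [ContinuousAt, linCoord_zero ha, norm_zero] at this
      exact this.eventually_lt_const hδ
    obtain ⟨ε, hε, hε'⟩ := Metric.eventually_nhds_iff.mp hev2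
    refine ⟨ε, hε, fun z hz => ?_⟩
    have := hε' (y := z) (by simpa using hz)
    exact ⟨this.2, e.left_inv this.1⟩

/-- φ_a is injective near 0, so its zeros are the iterated preimages of 0. -/
theorem linCoord_ne_zero (ha : a ∈ Set.Ioo (0 : ℝ) 1) {z : ℂ} (hz : ‖z‖ < 1)
    (h : ∀ n, (blaschke a)^[n] z ≠ 0) : linCoord a z ≠ 0 := by
  intro h0
  obtain ⟨δ, -, ψ, -, hψ0, -, ε, hε, hψ⟩ := exists_local_inverse ha
  obtain ⟨N, hN⟩ := exists_norm_iterate_lt ha hz hε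
  have h1 := (hψ _ hN).2
  rw [linCoord_iterate ha hz, h0, mul_zero, hψ0] at h1
  exact h N h1.symm

end LinCoord

/-! ### The half-petal -/

section Core

variable {a : ℝ}

/-- As the product is again in the upper half-plane, the sum of the arguments cannot exceed π, so
they add without wrapping. -/
theorem arg_le_arg_mul {p q : ℂ} (hp : 0 < p.im) (hq : 0 < q.im) (hpq : 0 < (p * q).im) :
    p.arg ≤ (p * q).arg := by
  have hp0 : p ≠ 0 := by rintro rfl; simp at hp
  have hq0 : q ≠ 0 := by rintro rfl; simp at hq
  have h1 : 0 ≤ p.arg := Complex.arg_nonneg_iff.mpr hp.le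
  have h2 : 0 ≤ q.arg := Complex.arg_nonneg_iff.mpr hq.le
  have hle : p.arg + q.arg ≤ Real.pi := by
    by_contra hlt
    push Not at hlt
    have hs : Real.sin (p.arg + q.arg) ≤ 0 := by
      have := Real.sin_nonneg_of_nonneg_of_le_pi (x := p.arg + q.arg - Real.pi) (by linarith)
        (by linarith [Complex.arg_le_pi p, Complex.arg_le_pi q])
      rw [Real.sin_sub_pi] at this
      linarith
    have e : (p * q).im = ‖p‖ * ‖q‖ * Real.sin (p.arg + q.arg) := by
      rw [Complex.mul_im, Real.sin_add]
      nth_rewrite 1 [← Complex.norm_mul_cos_arg p]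
      nth_rewrite 1 [← Complex.norm_mul_sin_arg q]
      nth_rewrite 1 [← Complex.norm_mul_sin_arg p]
      nth_rewrite 1 [← Complex.norm_mul_cos_arg q]
      ring
    have : (p * q).im ≤ 0 := by
      rw [e]; exact mul_nonpos_of_nonneg_of_nonpos (by positivity) hs
    linarith
  rw [Complex.arg_mul hp0 hq0 ⟨by linarith [Real.pi_pos], hle⟩]
  linarith

theorem arg_koebe_le_iterate (ha : a ∈ Set.Ioo (0 : ℝ) 1) {z : ℂ} (hz : ‖z‖ < 1)
    (him : ∀ n, 0 < ((blaschke a)^[n] z).im) (n : ℕ) :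
    (koebe z).arg ≤ (koebe ((blaschke a)^[n] z)).arg := by
  induction n with
  | zero => simp
  | succ n ih =>
    refine ih.trans ?_
    have hn := norm_iterate_lt_one ha hz n
    have hs := koebe_im_pos (norm_iterate_lt_one ha hz (n + 1)) (him (n + 1))
    rw [Function.iterate_succ_apply', koebe_blaschke ha hn] at hs ⊢
    refine arg_le_arg_mul (koebe_im_pos hn (him n)) ?_ hs
    have h1 : (1 - (a : ℂ)) ^ 2 = (((1 - a) ^ 2 : ℝ) : ℂ) := by push_cast; rfl
    rw [h1, Complex.add_im, Complex.ofReal_im, Complex.im_ofReal_mul, zero_add]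
    exact mul_pos (by have := ha.2; nlinarith) (div_one_add_sq_im_pos hn (him n))

theorem tendsto_koebe_iterate (ha : a ∈ Set.Ioo (0 : ℝ) 1) {z : ℂ} (hz : ‖z‖ < 1) :
    Tendsto (fun n => ((a : ℂ) ^ n)⁻¹ * koebe ((blaschke a)^[n] z)) atTop (𝓝 (linCoord a z)) := by
  have h1 := ((tendsto_iterate_zero ha hz).const_sub 1).pow 2
  have h2 := (tendsto_linApprox ha hz).div h1 (by simp)
  simp only [sub_zero, one_pow, div_one] at h2
  refine h2.congr fun n => ?_
  simp [linApprox, koebe, mul_div_assoc]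

/-- The argument of k increases along the orbit, and a^{-n}k(f_a^n(z)) tends to φ_a(z) because k(w)
~ w at 0. So 0 ≤ arg k(z) ≤ arg φ_a(z) < π/2. -/
theorem koebe_re_pos_of_im_pos (ha : a ∈ Set.Ioo (0 : ℝ) 1) {z : ℂ} (hz : ‖z‖ < 1)
    (him : ∀ n, 0 < ((blaschke a)^[n] z).im) (hφ : 0 < (linCoord a z).re) :
    0 < (koebe z).re := by
  have hslit : linCoord a z ∈ Complex.slitPlane := Or.inl hφ
  have h1 := ((Complex.continuousAt_arg hslit).tendsto).comp (tendsto_koebe_iterate ha hz)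
  have h2 : (koebe z).arg ≤ (linCoord a z).arg := by
    refine ge_of_tendsto h1 (Eventually.of_forall fun n => ?_)
    have : ((a : ℂ) ^ n)⁻¹ = (((a ^ n)⁻¹ : ℝ) : ℂ) := by push_cast; rfl
    rw [Function.comp_apply, this, Complex.arg_real_mul _ (inv_pos.mpr (pow_pos ha.1 n))]
    exact arg_koebe_le_iterate ha hz him n
  have him0 := koebe_im_pos hz (him 0)
  have h3 : 0 ≤ (koebe z).arg := Complex.arg_nonneg_iff.mpr him0.le
  have h4 := (abs_lt.mp (Complex.abs_arg_lt_pi_div_two_iff.mpr (Or.inl hφ))).2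
  have h5 : |(koebe z).arg| < Real.pi / 2 := by rw [abs_of_nonneg h3]; linarith
  rcases Complex.abs_arg_lt_pi_div_two_iff.mp h5 with h | h
  · exact h
  · rw [h] at him0; simp at him0

/-- The part of the disk that the Koebe function maps to the right half-plane. -/
def koebeCone : Set ℂ := {z | ‖z‖ < 1 ∧ 2 * ‖z‖ ^ 2 < z.re * (1 + ‖z‖ ^ 2)}

theorem re_pos_of_mem_koebeCone {z : ℂ} (hz : z ∈ koebeCone) : 0 < z.re := by
  have := hz.2
  exact pos_of_mul_pos_left ((by positivity : 0 ≤ 2 * ‖z‖ ^ 2).trans_lt this) (by positivity)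

theorem mem_koebeCone_of_im_pos (ha : a ∈ Set.Ioo (0 : ℝ) 1) {z : ℂ} (hz : ‖z‖ < 1)
    (him : ∀ n, 0 < ((blaschke a)^[n] z).im) (hφ : 0 < (linCoord a z).re) : z ∈ koebeCone := by
  have h := koebe_re_pos_of_im_pos ha hz him hφ
  have h0 : 0 < ‖1 - z‖ := norm_pos_iff.mpr (one_sub_ne_zero hz)
  have h1 : 0 < (koebe z).re * ‖1 - z‖ ^ 4 := by positivity
  rw [koebe_re_mul hz] at h1
  exact ⟨hz, by linarith⟩

theorem mem_koebeCone_conj {z : ℂ} : conj z ∈ koebeCone ↔ z ∈ koebeCone := by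
  simp [koebeCone]

/-- If the imaginary part keeps its sign in the upper half-disk along orbits, then the points of
the right half-plane of the linearizing coordinate are in the Koebe cone. -/
theorem mem_koebeCone_of_im_ne_zero (ha : a ∈ Set.Ioo (0 : ℝ) 1) {z : ℂ} (hz : ‖z‖ < 1)
    (hre : ∀ n, 0 < 2 * ((blaschke a)^[n] z).re + a) (him : z.im ≠ 0)
    (hφ : 0 < (linCoord a z).re) : z ∈ koebeCone := by
  have key : ∀ w : ℂ, ‖w‖ < 1 → (∀ n, 0 < 2 * ((blaschke a)^[n] w).re + a) → 0 < w.im →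
      ∀ n, 0 < ((blaschke a)^[n] w).im := by
    intro w hw hwre hwim n
    induction n with
    | zero => exact hwim
    | succ n ih =>
      rw [Function.iterate_succ_apply']
      exact blaschke_im_pos ha (norm_iterate_lt_one ha hw n) ih (hwre n)
  rcases lt_or_gt_of_ne him with h | h
  · have hz' : ‖conj z‖ < 1 := by simpa
    rw [← mem_koebeCone_conj]
    refine mem_koebeCone_of_im_pos ha hz' (key _ hz' ?_ (by simpa)) ?_
    · intro n; rw [iterate_conj]; simpa using hre n
    · rw [linCoord_conj ha hz]; simpa
  · exact mem_koebeCone_of_im_pos ha hz (key z hz hre h) hφ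

theorem iterate_real_nonpos (ha : a ∈ Set.Ioo (0 : ℝ) 1) {x : ℝ} (hx : x ∈ Set.Ioc (-a) 0)
    (n : ℕ) : ∃ y ∈ Set.Ioc (-a) 0, (blaschke (a : ℂ))^[n] x = ((y : ℝ) : ℂ) := by
  obtain ⟨ha0, ha1⟩ := ha
  induction n with
  | zero => exact ⟨x, hx, rfl⟩
  | succ n ih =>
    obtain ⟨y, ⟨hy1, hy2⟩, hy⟩ := ih
    refine ⟨_, ?_, by rw [Function.iterate_succ_apply', hy, blaschke_ofReal]⟩
    have h1 : 0 < 1 + a * y := by nlinarith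
    have h2 : (y + a) / (1 + a * y) ≤ 1 := by rw [div_le_one h1]; nlinarith
    have h3 : 0 ≤ (y + a) / (1 + a * y) := div_nonneg (by linarith) h1.le
    constructor <;> nlinarith

theorem linCoord_re_nonpos (ha : a ∈ Set.Ioo (0 : ℝ) 1) {x : ℝ} (hx : x ∈ Set.Ioc (-a) 0) :
    (linCoord a x).re ≤ 0 ∧ (linCoord a x).im = 0 := by
  have hx1 : ‖(x : ℂ)‖ < 1 := norm_ofReal_lt_one (by linarith [hx.1, ha.2]) (by linarith [hx.2])
  have h := tendsto_linApprox ha hx1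
  have e : ∀ n, ∃ y ≤ (0 : ℝ), linApprox a n x = (y : ℂ) := by
    intro n
    obtain ⟨y, hy, hn⟩ := iterate_real_nonpos ha hx n
    refine ⟨(a ^ n)⁻¹ * y, ?_, by rw [linApprox, hn]; push_cast; rfl⟩
    exact mul_nonpos_of_nonneg_of_nonpos (inv_nonneg.mpr (pow_nonneg ha.1.le n)) hy.2
  constructor
  · refine le_of_tendsto ((Complex.continuous_re.tendsto _).comp h) (Eventually.of_forall fun n => ?_)
    obtain ⟨y, hy, hn⟩ := e n
    simpa [hn] using hy
  · refine tendsto_nhds_unique ((Complex.continuous_im.tendsto _).comp h) ?_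
    refine tendsto_const_nhds.congr fun n => ?_
    obtain ⟨y, hy, hn⟩ := e n
    simp [hn]

/-- The points of the right half-plane of the linearizing coordinate whose orbit stays in the
right half-plane. -/
def core (a : ℝ) : Set ℂ :=
  {z | ‖z‖ < 1 ∧ (∀ n, 0 < ((blaschke a)^[n] z).re) ∧ 0 < (linCoord a z).re}

theorem core_subset_koebeCone (ha : a ∈ Set.Ioo (0 : ℝ) 1) : core a ⊆ koebeCone := by
  rintro z ⟨hz, hre, hφ⟩
  by_cases him : z.im = 0
  · have h0 : 0 < z.re := hre 0
    have h1 : ‖z‖ = z.re := by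
      rw [← abs_of_pos h0]; exact (Complex.abs_re_eq_norm.mpr him).symm
    refine ⟨hz, ?_⟩
    have h2 : z.re < 1 := by rwa [← h1]
    rw [h1]
    nlinarith [mul_pos h0 (mul_pos (sub_pos.mpr h2) (sub_pos.mpr h2))]
  · exact mem_koebeCone_of_im_ne_zero ha hz (fun n => by linarith [hre n, ha.1]) him hφ

theorem linCoord_iterate_re_pos (ha : a ∈ Set.Ioo (0 : ℝ) 1) {z : ℂ} (hz : ‖z‖ < 1) (n : ℕ) :
    0 < (linCoord a ((blaschke a)^[n] z)).re ↔ 0 < (linCoord a z).re := by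
  rw [linCoord_iterate ha hz, ← Complex.ofReal_pow, Complex.re_ofReal_mul,
    mul_pos_iff_of_pos_left (pow_pos ha.1 n)]

theorem re_pos_of_norm_lt (ha : a ∈ Set.Ioo (0 : ℝ) 1) {z : ℂ} (hz : ‖z‖ < a / 2)
    (hφ : 0 < (linCoord a z).re) : 0 < z.re := by
  have hz1 : ‖z‖ < 1 := by linarith [ha.2]
  by_cases him : z.im = 0
  · by_contra hle
    push Not at hle
    have e : z = (z.re : ℂ) := Complex.ext rfl (by simpa using him)
    have h1 := abs_le.mp (Complex.abs_re_le_norm z)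
    rw [e] at hφ
    linarith [(linCoord_re_nonpos ha (x := z.re) ⟨by linarith [h1.1, ha.1], hle⟩).1]
  · refine re_pos_of_mem_koebeCone (mem_koebeCone_of_im_ne_zero ha hz1 ?_ him hφ)
    intro n
    have h1 := abs_le.mp (Complex.abs_re_le_norm ((blaschke a)^[n] z))
    linarith [h1.1, norm_iterate_le ha hz1 n]

/-- Near 0 the condition on the orbit is automatic: off the real axis by the Koebe cone, on it
because Re φ_a ≤ 0 on (-a,0]. So every ray with cos θ > 0 starts in the core. -/
theorem mem_core_of_norm_lt (ha : a ∈ Set.Ioo (0 : ℝ) 1) {z : ℂ} (hz : ‖z‖ < a / 2)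
    (hφ : 0 < (linCoord a z).re) : z ∈ core a := by
  have hz1 : ‖z‖ < 1 := by linarith [ha.2]
  refine ⟨hz1, fun n => ?_, hφ⟩
  exact re_pos_of_norm_lt ha ((norm_iterate_le ha hz1 n).trans_lt hz)
    ((linCoord_iterate_re_pos ha hz1 n).mpr hφ)

theorem iterate_mem_core (ha : a ∈ Set.Ioo (0 : ℝ) 1) {z : ℂ} (hz : z ∈ core a) (n : ℕ) :
    (blaschke a)^[n] z ∈ core a := by
  refine ⟨norm_iterate_lt_one ha hz.1 n, fun m => ?_, (linCoord_iterate_re_pos ha hz.1 n).mpr hz.2.2⟩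
  rw [← Function.iterate_add_apply]
  exact hz.2.1 _

theorem continuousAt_iterate (ha : a ∈ Set.Ioo (0 : ℝ) 1) (n : ℕ) {z : ℂ} (hz : ‖z‖ < 1) :
    ContinuousAt ((blaschke (a : ℂ))^[n]) z :=
  (differentiableOn_iterate ha n).continuousOn.continuousAt
    (Metric.isOpen_ball.mem_nhds (by simpa))

theorem continuousAt_linCoord (ha : a ∈ Set.Ioo (0 : ℝ) 1) {z : ℂ} (hz : ‖z‖ < 1) :
    ContinuousAt (linCoord a) z :=
  (continuousOn_linCoord ha).continuousAt (Metric.isOpen_ball.mem_nhds (by simpa))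

/-- Once the orbit is near 0 the remaining conditions follow from Re φ_a > 0, so only finitely many
open conditions matter. -/
theorem isOpen_core (ha : a ∈ Set.Ioo (0 : ℝ) 1) : IsOpen (core a) := by
  rw [isOpen_iff_mem_nhds]
  rintro z ⟨hz, hre, hφ⟩
  obtain ⟨N, hN⟩ := exists_norm_iterate_lt ha hz (half_pos ha.1)
  have h1 : ∀ᶠ w in 𝓝 z, ‖w‖ < 1 := continuous_norm.continuousAt.eventually_lt_const hz
  have h2 : ∀ᶠ w in 𝓝 z, ∀ j ∈ Finset.range N, 0 < ((blaschke (a : ℂ))^[j] w).re := by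
    rw [eventually_all_finset]
    intro j _
    exact (Complex.continuous_re.continuousAt.comp (continuousAt_iterate ha j hz)).eventually_const_lt
      (hre j)
  have h3 : ∀ᶠ w in 𝓝 z, ‖(blaschke (a : ℂ))^[N] w‖ < a / 2 :=
    (continuousAt_iterate ha N hz).norm.eventually_lt_const hN
  have h4 : ∀ᶠ w in 𝓝 z, 0 < (linCoord a w).re :=
    (Complex.continuous_re.continuousAt.comp (continuousAt_linCoord ha hz)).eventually_const_lt hφ
  filter_upwards [h1, h2, h3, h4] with w hw1 hw2 hw3 hw4
  have hc := mem_core_of_norm_lt ha hw3 ((linCoord_iterate_re_pos ha hw1 N).mpr hw4)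
  refine ⟨hw1, fun n => ?_, hw4⟩
  rcases lt_or_ge n N with hn | hn
  · exact hw2 n (Finset.mem_range.mpr hn)
  · have := hc.2.1 (n - N)
    rwa [← Function.iterate_add_apply, Nat.sub_add_cancel hn] at this

/-- The closed Koebe cone touches the imaginary axis only at 0, where φ_a vanishes. So the core is
closed relative to Re φ_a > 0, and a ray cannot leave it. -/
theorem mem_core_of_mem_closure (ha : a ∈ Set.Ioo (0 : ℝ) 1) {z : ℂ} (hz : ‖z‖ < 1)
    (hcl : z ∈ closure (core a)) (hφ : 0 < (linCoord a z).re) : z ∈ core a := by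
  have key : ∀ w : ℂ, ‖w‖ < 1 → w ∈ closure (core a) → 0 < (linCoord a w).re → 0 < w.re := by
    intro w hw hwc hwφ
    have h1 : closure (core a) ⊆ {w : ℂ | 2 * ‖w‖ ^ 2 ≤ w.re * (1 + ‖w‖ ^ 2)} := by
      refine closure_minimal (fun v hv => (core_subset_koebeCone ha hv).2.le) ?_
      exact isClosed_le (by fun_prop) (by fun_prop)
    have h2 : 2 * ‖w‖ ^ 2 ≤ w.re * (1 + ‖w‖ ^ 2) := h1 hwc
    have h3 : 0 < ‖w‖ := by
      rw [norm_pos_iff]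
      rintro rfl
      rw [linCoord_zero ha] at hwφ
      simp at hwφ
    exact pos_of_mul_pos_left ((by positivity : 0 < 2 * ‖w‖ ^ 2).trans_le h2) (by positivity)
  refine ⟨hz, fun n => ?_, hφ⟩
  refine key _ (norm_iterate_lt_one ha hz n) ?_ ((linCoord_iterate_re_pos ha hz n).mpr hφ)
  have := (continuousAt_iterate ha n hz).continuousWithinAt.mem_closure_image hcl
  refine closure_mono ?_ this
  rintro _ ⟨w, hw, rfl⟩
  exact iterate_mem_core ha hw n

theorem criticalPoint_eq (ha : a ∈ Set.Ioo (0 : ℝ) 1) :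
    ∃ x ∈ Set.Ioo (-a) 0, criticalPoint a = (x : ℂ) := by
  obtain ⟨ha0, ha1⟩ := ha
  have hs0 : 0 < 1 - a ^ 2 := by nlinarith
  have hs1 : √(1 - a ^ 2) < 1 := by rw [Real.sqrt_lt' one_pos]; nlinarith
  have hs2 := Real.sqrt_pos.mpr hs0
  have hs3 := Real.sq_sqrt hs0.le
  refine ⟨-(1 - √(1 - a ^ 2)) / a, ⟨?_, ?_⟩, ?_⟩
  · rw [lt_div_iff₀ ha0]; nlinarith
  · exact div_neg_of_neg_of_pos (by linarith) ha0
  · rw [criticalPoint, Complex.norm_real, Real.norm_of_nonneg ha0.le, Complex.conj_ofReal]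
    push_cast
    rfl

/-- The critical point lies in (-a,0), which f_a maps into itself, so its linearizing coordinate is
negative. -/
theorem singularArg_eq_pi (ha : a ∈ Set.Ioo (0 : ℝ) 1) : singularArg a = Real.pi := by
  obtain ⟨x, ⟨hx1, hx2⟩, hx⟩ := criticalPoint_eq ha
  have hxn : ‖(x : ℂ)‖ < 1 := norm_ofReal_lt_one (by linarith [ha.2]) (by linarith)
  rw [singularArg, hx, Complex.arg_eq_pi_iff]
  obtain ⟨h1, h2⟩ := linCoord_re_nonpos ha ⟨hx1, hx2.le⟩
  refine ⟨lt_of_le_of_ne h1 fun h => ?_, h2⟩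
  refine linCoord_ne_zero ha hxn (fun n => ?_) (Complex.ext h h2)
  induction n with
  | zero => simpa using hx2.ne
  | succ n ih =>
    obtain ⟨y, ⟨hy1, hy2⟩, hy⟩ := iterate_real_nonpos ha ⟨hx1, hx2.le⟩ n
    rw [Function.iterate_succ_apply', hy, blaschke_ofReal, Complex.ofReal_ne_zero]
    rw [hy, Complex.ofReal_ne_zero] at ih
    have h3 : 0 < 1 + a * y := by nlinarith [ha.1, ha.2]
    exact mul_ne_zero ih (div_pos (by linarith) h3).ne'

theorem halfPetal_eq (ha : a ∈ Set.Ioo (0 : ℝ) 1) : halfPetal a =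
    ⋃ θ ∈ Set.Ioo (2 * Real.pi - Real.pi / 2) (2 * Real.pi + Real.pi / 2), linearizingRay a θ := by
  rw [halfPetal, petal, singularArg_eq_pi ha]
  ring_nf

theorem cos_pos_of_mem {θ : ℝ}
    (hθ : θ ∈ Set.Ioo (2 * Real.pi - Real.pi / 2) (2 * Real.pi + Real.pi / 2)) :
    0 < Real.cos θ := by
  rw [← Real.cos_sub_two_pi]
  exact Real.cos_pos_of_mem_Ioo ⟨by linarith [hθ.1], by linarith [hθ.2]⟩

theorem ray_subset_core (ha : a ∈ Set.Ioo (0 : ℝ) 1) {θ s : ℝ} (hθ : 0 < Real.cos θ)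
    (hs : 0 < s) {γ : ℝ → ℂ} (hγ : ContinuousOn γ (Set.Icc 0 s)) (hγ0 : γ 0 = 0)
    (h : ∀ t ∈ Set.Icc 0 s, γ t ∈ Metric.ball (0 : ℂ) 1 ∧
      linCoord a (γ t) = (t : ℂ) * Complex.exp ((θ : ℂ) * Complex.I)) :
    γ '' Set.Ioc 0 s ⊆ core a := by
  have hsub : Set.Ioc 0 s ⊆ Set.Icc 0 s := Set.Ioc_subset_Icc_self
  have hre : ∀ t ∈ Set.Ioc 0 s, 0 < (linCoord a (γ t)).re := by
    intro t ht
    rw [(h t (hsub ht)).2, Complex.re_ofReal_mul, Complex.exp_ofReal_mul_I_re]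
    exact mul_pos ht.1 hθ
  have hn : ∀ t ∈ Set.Ioc 0 s, ‖γ t‖ < 1 := fun t ht => by simpa using (h t (hsub ht)).1
  refine (isPreconnected_Ioc.image γ (hγ.mono hsub)).subset_of_closure_inter_subset
    (isOpen_core ha) ?_ ?_
  · have h0 : ContinuousWithinAt γ (Set.Ioc 0 s) 0 := (hγ 0 ⟨le_rfl, hs.le⟩).mono hsub
    have h1 : ∀ᶠ t in 𝓝[Set.Ioc 0 s] 0, ‖γ t‖ < a / 2 := by
      refine h0.norm.eventually_lt_const ?_
      simpa [hγ0] using ha.1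
    have hne : (𝓝[Set.Ioc 0 s] (0 : ℝ)).NeBot := by
      rw [nhdsWithin_Ioc_eq_nhdsGT hs]; infer_instance
    obtain ⟨t, ht1, ht2⟩ := (h1.and self_mem_nhdsWithin).exists
    exact ⟨γ t, ⟨t, ht2, rfl⟩, mem_core_of_norm_lt ha ht1 (hre t ht2)⟩
  · rintro _ ⟨hcl, ⟨t, ht, rfl⟩⟩
    exact mem_core_of_mem_closure ha (hn t ht) hcl (hre t ht)

theorem halfPetal_subset_core (ha : a ∈ Set.Ioo (0 : ℝ) 1) : halfPetal a ⊆ core a := by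
  intro z hz
  rw [halfPetal_eq ha, Set.mem_iUnion₂] at hz
  obtain ⟨θ, hθ, s, γ, hs, hγ, hγ0, rfl, h⟩ := hz
  exact ray_subset_core ha (cos_pos_of_mem hθ) hs hγ hγ0 h ⟨s, ⟨hs, le_rfl⟩, rfl⟩

end Core

/-! ### Preimages under the Blaschke product -/

section Preimages

variable {a : ℝ}

/-- The discriminant of the quadratic equation for the preimages of `w`. -/
def discr (a : ℝ) (w : ℂ) : ℂ := (a : ℂ) ^ 2 * (1 - w) ^ 2 + 4 * w

theorem blaschke_eq_iff (ha : a ∈ Set.Ioo (0 : ℝ) 1) {z w : ℂ} (hz : ‖z‖ < 1) :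
    blaschke a z = w ↔ z * (z + a) = w * (1 + a * z) := by
  rw [blaschke_apply, mul_div_assoc', div_eq_iff (one_add_mul_ne_zero ha hz)]

/-- For |z| ≥ 1 one has |z + a| ≥ |1 + az|, which is incompatible with |w| < 1. So both roots are in
the disk. -/
theorem norm_lt_one_of_quadratic (ha : a ∈ Set.Ioo (0 : ℝ) 1) {z w : ℂ} (hw : ‖w‖ < 1)
    (h : z * (z + a) = w * (1 + a * z)) : ‖z‖ < 1 := by
  by_contra hlt
  push Not at hlt
  have h1 : ‖1 + (a : ℂ) * z‖ ≤ ‖z + a‖ := by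
    have h2 := norm_one_sub_conj_mul_sq z (-(a : ℂ))
    rw [map_neg, Complex.conj_ofReal, neg_mul, sub_neg_eq_add, sub_neg_eq_add, norm_neg,
      Complex.norm_real, Real.norm_of_nonneg ha.1.le] at h2
    refine abs_le_of_sq_le_sq' ?_ (norm_nonneg _) |>.2
    rw [h2]
    have h3 : 0 ≤ ‖z‖ ^ 2 - 1 := by nlinarith
    have h4 : 0 ≤ 1 - a ^ 2 := by nlinarith [ha.1, ha.2]
    nlinarith [mul_nonneg h3 h4]
  have h2 := congrArg norm h
  rw [norm_mul, norm_mul] at h2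
  have h3 : ‖z + a‖ = 0 := by
    by_contra hne
    have hpos : 0 < ‖z + a‖ := lt_of_le_of_ne (norm_nonneg _) (Ne.symm hne)
    have h4 : ‖w‖ * ‖1 + (a : ℂ) * z‖ ≤ ‖w‖ * ‖z + a‖ :=
      mul_le_mul_of_nonneg_left h1 (norm_nonneg _)
    nlinarith
  rw [norm_eq_zero, add_eq_zero_iff_eq_neg] at h3
  rw [h3, norm_neg] at hlt
  exact absurd (norm_ofReal_param_lt_one ha) (not_lt.mpr hlt)

theorem quadratic_of_sq_eq_discr {w d : ℂ} (hd : d ^ 2 = discr a w) :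
    ((-(a * (1 - w)) + d) / 2) * ((-(a * (1 - w)) + d) / 2 + a)
      = w * (1 + a * ((-(a * (1 - w)) + d) / 2)) := by
  rw [discr] at hd
  linear_combination hd / 4

theorem norm_root_lt_one (ha : a ∈ Set.Ioo (0 : ℝ) 1) {w d : ℂ} (hw : ‖w‖ < 1)
    (hd : d ^ 2 = discr a w) : ‖(-(a * (1 - w)) + d) / 2‖ < 1 :=
  norm_lt_one_of_quadratic ha hw (quadratic_of_sq_eq_discr hd)

theorem blaschke_root (ha : a ∈ Set.Ioo (0 : ℝ) 1) {w d : ℂ} (hw : ‖w‖ < 1)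
    (hd : d ^ 2 = discr a w) : blaschke a ((-(a * (1 - w)) + d) / 2) = w :=
  (blaschke_eq_iff ha (norm_root_lt_one ha hw hd)).mpr (quadratic_of_sq_eq_discr hd)

theorem add_deck (ha : a ∈ Set.Ioo (0 : ℝ) 1) {z : ℂ} (hz : ‖z‖ < 1) :
    z + deck a z = -(a * (1 - blaschke a z)) := by
  have h := one_add_mul_ne_zero ha hz
  have h' : 1 + z * (a : ℂ) ≠ 0 := by rwa [mul_comm]
  rw [blaschke_apply, deck]
  field_simp
  ring

theorem sub_deck_sq (ha : a ∈ Set.Ioo (0 : ℝ) 1) {z : ℂ} (hz : ‖z‖ < 1) :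
    (z - deck a z) ^ 2 = discr a (blaschke a z) := by
  have h1 := add_deck ha hz
  have h2 := blaschke_eq_deck a z
  rw [discr]
  have : (a : ℂ) ^ 2 * (1 - blaschke a z) ^ 2 = (z + deck a z) ^ 2 := by rw [h1]; ring
  rw [this, h2]
  ring

theorem eq_root_of_blaschke_eq (ha : a ∈ Set.Ioo (0 : ℝ) 1) {z : ℂ} (hz : ‖z‖ < 1) :
    z = (-(a * (1 - blaschke a z)) + (z - deck a z)) / 2 := by
  rw [← add_deck ha hz]; ring

theorem deck_re_neg (ha : a ∈ Set.Ioo (0 : ℝ) 1) {z : ℂ} (hz : ‖z‖ < 1) (hre : 0 ≤ z.re) :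
    (deck a z).re < 0 := by
  have h0 : 0 < Complex.normSq (1 + a * z) := Complex.normSq_pos.mpr (one_add_mul_ne_zero ha hz)
  obtain ⟨ha0, ha1⟩ := ha
  rw [deck, Complex.neg_re, Complex.div_re, ← add_div]
  rw [neg_lt_zero]
  refine div_pos ?_ h0
  simp only [Complex.add_re, Complex.add_im, Complex.ofReal_re,
    Complex.ofReal_im, Complex.one_re, Complex.one_im, Complex.re_ofReal_mul,
    Complex.im_ofReal_mul]
  nlinarith [mul_nonneg ha0.le hre, mul_nonneg ha0.le (sq_nonneg z.re),
    mul_nonneg ha0.le (sq_nonneg z.im), mul_nonneg (mul_nonneg ha0.le ha0.le) hre]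

theorem sqrt_re_nonneg (w : ℂ) : 0 ≤ (Complex.sqrt w).re := by
  rw [Complex.sqrt, Complex.cpow_inv_two_re]
  positivity

theorem sqrt_sq (w : ℂ) : Complex.sqrt w ^ 2 = w := by
  simp [Complex.sqrt]

theorem differentiableAt_sqrt {w : ℂ} (hw : w ∈ Complex.slitPlane) :
    DifferentiableAt ℂ Complex.sqrt w := by
  unfold Complex.sqrt
  exact differentiableAt_id.cpow_const hw

theorem continuousAt_sqrt {w : ℂ} (hw : w ∈ Complex.slitPlane) : ContinuousAt Complex.sqrt w :=
  (differentiableAt_sqrt hw).continuousAt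

theorem sqrt_re_pos {w : ℂ} (hw : w ∈ Complex.slitPlane) : 0 < (Complex.sqrt w).re := by
  refine lt_of_le_of_ne (sqrt_re_nonneg w) fun h => ?_
  have h1 := sqrt_sq w
  set d := Complex.sqrt w
  have hre : w.re = -d.im ^ 2 := by
    rw [← h1, pow_two, Complex.mul_re, ← h]; ring
  have him : w.im = 0 := by
    rw [← h1, pow_two, Complex.mul_im, ← h]; ring
  rcases hw with hw | hw
  · nlinarith [sq_nonneg d.im]
  · exact hw him

theorem discr_im (w : ℂ) : (discr a w).im = w.im * (4 - 2 * a ^ 2 + 2 * a ^ 2 * w.re) := by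
  rw [discr, ← Complex.ofReal_pow, Complex.add_im, Complex.im_ofReal_mul, pow_two (1 - w)]
  simp only [Complex.mul_im, Complex.sub_re, Complex.sub_im, Complex.one_re, Complex.one_im,
    Complex.re_ofNat, Complex.im_ofNat]
  ring

theorem discr_ofReal (a x : ℝ) : discr a x = ((a ^ 2 * (1 - x) ^ 2 + 4 * x : ℝ) : ℂ) := by
  rw [discr]; push_cast; rfl

theorem discr_im_ne_zero (ha : a ∈ Set.Ioo (0 : ℝ) 1) {w : ℂ} (hw : ‖w‖ < 1) (him : w.im ≠ 0) :
    (discr a w).im ≠ 0 := by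
  rw [discr_im]
  refine mul_ne_zero him ?_
  have h1 := abs_le.mp (Complex.abs_re_le_norm w)
  have h2 : a ^ 2 < 1 := by nlinarith [ha.1, ha.2]
  nlinarith [h1.1, sq_nonneg a]

/-- The inverse branch of `f_a` that fixes the origin. -/
def mainBranch (a : ℝ) (w : ℂ) : ℂ := (-(a * (1 - w)) + Complex.sqrt (discr a w)) / 2

theorem mainBranch_blaschke (ha : a ∈ Set.Ioo (0 : ℝ) 1) {z : ℂ} (hz : ‖z‖ < 1)
    (hre : 0 ≤ z.re) : mainBranch a (blaschke a z) = z := by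
  have h1 : Complex.sqrt (discr a (blaschke a z)) ^ 2 = (z - deck a z) ^ 2 := by
    rw [sqrt_sq, sub_deck_sq ha hz]
  rcases sq_eq_sq_iff_eq_or_eq_neg.mp h1 with h | h
  · rw [mainBranch, h, ← eq_root_of_blaschke_eq ha hz]
  · have h2 := sqrt_re_nonneg (discr a (blaschke a z))
    rw [h, Complex.neg_re, Complex.sub_re] at h2
    linarith [deck_re_neg ha hz hre]

theorem mainBranch_zero (ha : a ∈ Set.Ioo (0 : ℝ) 1) : mainBranch a 0 = 0 := by
  have := mainBranch_blaschke ha (z := 0) (by simp) (by simp)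
  rwa [blaschke_zero] at this

theorem continuousAt_mainBranch {w : ℂ} (hw : discr a w ∈ Complex.slitPlane) :
    ContinuousAt (mainBranch a) w := by
  have h1 : ContinuousAt (discr a) w := by unfold discr; fun_prop
  have h2 : ContinuousAt (fun w => Complex.sqrt (discr a w)) w :=
    ContinuousAt.comp (f := discr a) (continuousAt_sqrt hw) h1
  unfold mainBranch
  fun_prop

theorem discr_mem_slitPlane (ha : a ∈ Set.Ioo (0 : ℝ) 1) {w : ℂ} (hw : ‖w‖ < 1)
    (hre : 0 ≤ w.re) : discr a w ∈ Complex.slitPlane := by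
  by_cases him : w.im = 0
  · left
    have e : w = (w.re : ℂ) := Complex.ext rfl (by simpa using him)
    rw [e, discr_ofReal, Complex.ofReal_re]
    have h0 := ha.1
    rcases hre.eq_or_lt with h | h
    · rw [← h]; norm_num; positivity
    · positivity
  · exact Or.inr (discr_im_ne_zero ha hw him)

/-- The branch divides φ_a by `a`, so composing with it and running time at speed `a` gives a ray of
the same argument. The core is in the right half-plane, where the branch is continuous. -/
theorem mainBranch_mem_linearizingRay (ha : a ∈ Set.Ioo (0 : ℝ) 1) {θ : ℝ}
    (hθ : 0 < Real.cos θ) {w : ℂ} (hw : w ∈ linearizingRay a θ) :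
    mainBranch a w ∈ linearizingRay a θ := by
  obtain ⟨s, γ, hs, hγ, hγ0, hγs, h⟩ := hw
  have hcore := ray_subset_core ha hθ hs hγ hγ0 h
  have ha0 := ha.1
  have hre : ∀ t ∈ Set.Icc 0 s, 0 ≤ (γ t).re := by
    intro t ht
    rcases ht.1.eq_or_lt with h0 | h0
    · rw [← h0, hγ0]; simp
    · exact ((hcore ⟨t, ⟨h0, ht.2⟩, rfl⟩).2.1 0).le
  have hn : ∀ t ∈ Set.Icc 0 s, ‖γ t‖ < 1 := fun t ht => by simpa using (h t ht).1
  have hmaps : Set.MapsTo (fun t => a * t) (Set.Icc 0 (s / a)) (Set.Icc 0 s) := by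
    intro t ht
    refine ⟨mul_nonneg ha0.le ht.1, ?_⟩
    exact (le_div_iff₀' ha0).mp ht.2
  refine ⟨s / a, fun t => mainBranch a (γ (a * t)), by positivity, ?_, ?_, ?_, ?_⟩
  · intro t ht
    have h1 : ContinuousWithinAt (fun t => γ (a * t)) (Set.Icc 0 (s / a)) t :=
      (hγ.comp (f := fun t => a * t) (by fun_prop) hmaps) t ht
    exact ContinuousAt.comp_continuousWithinAt (f := fun t => γ (a * t))
      (continuousAt_mainBranch (discr_mem_slitPlane ha (hn _ (hmaps ht)) (hre _ (hmaps ht)))) h1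
  · simp [hγ0, mainBranch_zero ha]
  · simp only
    rw [mul_div_cancel₀ _ ha0.ne', hγs]
  · intro t ht
    have h1 := norm_root_lt_one ha (hn _ (hmaps ht)) (sqrt_sq (discr a (γ (a * t))))
    have h2 := blaschke_root ha (hn _ (hmaps ht)) (sqrt_sq (discr a (γ (a * t))))
    refine ⟨by simpa [mainBranch] using h1, ?_⟩
    have h3 := linCoord_blaschke ha h1
    rw [h2, (h _ (hmaps ht)).2] at h3
    refine mul_left_cancel₀ (ofReal_param_ne_zero ha) ?_
    simp only [mainBranch]
    rw [← h3]
    push_cast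
    ring

/-- Near 0 the local inverse of φ_a draws the ray. Elsewhere the ray through f_a(z) is pulled back
by `mainBranch`, which recovers z because Re z > 0; the induction is on the time the orbit needs to
come near 0. -/
theorem core_subset_halfPetal (ha : a ∈ Set.Ioo (0 : ℝ) 1) : core a ⊆ halfPetal a := by
  obtain ⟨δ, hδ, ψ, hψc, hψ0, hψ, ε, hε, hεψ⟩ := exists_local_inverse ha
  have key : ∀ n : ℕ, ∀ z ∈ core a, ‖(blaschke a)^[n] z‖ < ε →
      ∃ θ, 0 < Real.cos θ ∧ θ ∈ Set.Ioo (2 * Real.pi - Real.pi / 2) (2 * Real.pi + Real.pi / 2) ∧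
        z ∈ linearizingRay a θ := by
    intro n
    induction n with
    | zero =>
      intro z hz hzε
      obtain ⟨h1, h2⟩ := hεψ z hzε
      set φ := linCoord a z with hφ
      have harg := abs_lt.mp (Complex.abs_arg_lt_pi_div_two_iff.mpr (Or.inl hz.2.2))
      -- The interval of arguments is centred at θ_c + π = 2π, hence the shift of the principal
      -- argument.
      have hmem : φ.arg + 2 * Real.pi ∈
          Set.Ioo (2 * Real.pi - Real.pi / 2) (2 * Real.pi + Real.pi / 2) :=
        ⟨by linarith [harg.1], by linarith [harg.2]⟩
      have hexp : Complex.exp (((φ.arg + 2 * Real.pi : ℝ) : ℂ) * Complex.I)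
          = Complex.exp (φ.arg * Complex.I) := by
        push_cast
        rw [add_mul, Complex.exp_add, Complex.exp_two_pi_mul_I, mul_one]
      have hsmall : ∀ t ∈ Set.Icc 0 ‖φ‖,
          ‖(t : ℂ) * Complex.exp (((φ.arg + 2 * Real.pi : ℝ) : ℂ) * Complex.I)‖ < δ := by
        intro t ht
        rw [norm_mul, Complex.norm_exp_ofReal_mul_I, mul_one, Complex.norm_real,
          Real.norm_of_nonneg ht.1]
        exact ht.2.trans_lt h1
      refine ⟨_, cos_pos_of_mem hmem, hmem, ‖φ‖,
        fun t => ψ ((t : ℂ) * Complex.exp (((φ.arg + 2 * Real.pi : ℝ) : ℂ) * Complex.I)),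
        ?_, ?_, ?_, ?_, ?_⟩
      · rw [norm_pos_iff]
        intro h0
        have := hz.2.2
        rw [← hφ, h0] at this
        simp at this
      · refine hψc.comp (by fun_prop) ?_
        intro t ht
        simpa using hsmall t ht
      · simp [hψ0]
      · simp only
        rw [hexp, Complex.norm_mul_exp_arg_mul_I]
        exact h2
      · intro t ht
        obtain ⟨h3, h4⟩ := hψ _ (hsmall t ht)
        exact ⟨by simpa using h3, h4⟩
    | succ n ih =>
      intro z hz hzε
      obtain ⟨θ, hθ, hθm, h⟩ := ih (blaschke a z) (iterate_mem_core ha hz 1)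
        (by rwa [← Function.iterate_succ_apply])
      refine ⟨θ, hθ, hθm, ?_⟩
      have := mainBranch_mem_linearizingRay ha hθ h
      rwa [mainBranch_blaschke ha hz.1 (hz.2.1 0).le] at this
  intro z hz
  obtain ⟨N, hN⟩ := exists_norm_iterate_lt ha hz.1 hε
  obtain ⟨θ, -, hθ, hray⟩ := key N z hz hN
  rw [halfPetal_eq ha, Set.mem_iUnion₂]
  exact ⟨θ, hθ, hray⟩

theorem halfPetal_eq_core (ha : a ∈ Set.Ioo (0 : ℝ) 1) : halfPetal a = core a :=
  (halfPetal_subset_core ha).antisymm (core_subset_halfPetal ha)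

end Preimages

/-! ### Levels: the time at which an orbit enters the half-petal -/

section Levels

variable {a : ℝ}

theorem mainBranch_mem_core (ha : a ∈ Set.Ioo (0 : ℝ) 1) {w : ℂ} (hw : w ∈ core a) :
    mainBranch a w ∈ core a := by
  rw [← halfPetal_eq_core ha, halfPetal_eq ha, Set.mem_iUnion₂] at hw ⊢
  obtain ⟨θ, hθ, h⟩ := hw
  exact ⟨θ, hθ, mainBranch_mem_linearizingRay ha (cos_pos_of_mem hθ) h⟩

/-- Every ray in the core starts inside the image of a small half-disk under the local inverse of
φ_a, and this image is a connected common hub. -/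
theorem isPreconnected_core (ha : a ∈ Set.Ioo (0 : ℝ) 1) : IsPreconnected (core a) := by
  obtain ⟨δ, hδ, ψ, hψc, hψ0, hψ, ε, hε, hεψ⟩ := exists_local_inverse ha
  have hψc0 : ContinuousAt ψ 0 := hψc.continuousAt (Metric.ball_mem_nhds 0 hδ)
  have hev : ∀ᶠ w in 𝓝 (0 : ℂ), ‖w‖ < δ ∧ ‖ψ w‖ < a / 2 := by
    refine Eventually.and ?_ ?_
    · exact continuous_norm.continuousAt.eventually_lt_const (by simpa)
    · refine hψc0.norm.eventually_lt_const ?_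
      simpa [hψ0] using ha.1
  obtain ⟨δ', hδ', hδψ⟩ := Metric.eventually_nhds_iff.mp hev
  set V : Set ℂ := Metric.ball 0 δ' ∩ {w | 0 < w.re} with hV
  have hVc : IsPreconnected V :=
    ((convex_ball (0 : ℂ) δ').inter (convex_halfSpace_re_gt 0)).isPreconnected
  have hVδ : ∀ w ∈ V, ‖w‖ < δ ∧ ‖ψ w‖ < a / 2 := fun w hw => hδψ (Metric.mem_ball.mp hw.1)
  set H := ψ '' V with hH
  have hHc : IsPreconnected H :=
    hVc.image ψ (hψc.mono fun w hw => by simpa using (hVδ w hw).1)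
  have hHcore : H ⊆ core a := by
    rintro _ ⟨w, hw, rfl⟩
    refine mem_core_of_norm_lt ha (hVδ w hw).2 ?_
    rw [(hψ w (hVδ w hw).1).2]
    exact hw.2
  have hx : ψ ((δ' / 2 : ℝ) : ℂ) ∈ H := by
    refine ⟨_, ⟨?_, ?_⟩, rfl⟩
    · rw [mem_ball_zero_iff, Complex.norm_real, Real.norm_of_nonneg (by linarith)]; linarith
    · simpa using hδ'
  refine isPreconnected_of_forall (ψ ((δ' / 2 : ℝ) : ℂ)) fun z hz => ?_
  have hz' := hz
  rw [← halfPetal_eq_core ha, halfPetal_eq ha, Set.mem_iUnion₂] at hz'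
  obtain ⟨θ, hθm, s, γ, hs, hγ, hγ0, rfl, h⟩ := hz'
  have hθ := cos_pos_of_mem hθm
  have hcore := ray_subset_core ha hθ hs hγ hγ0 h
  have hsub : Set.Ioc 0 s ⊆ Set.Icc 0 s := Set.Ioc_subset_Icc_self
  refine ⟨H ∪ γ '' Set.Ioc 0 s, Set.union_subset hHcore hcore, Or.inl hx,
    Or.inr ⟨s, ⟨hs, le_rfl⟩, rfl⟩, ?_⟩
  refine IsPreconnected.union' ?_ hHc (isPreconnected_Ioc.image γ (hγ.mono hsub))
  have h0 : ContinuousWithinAt γ (Set.Ioc 0 s) 0 := (hγ 0 ⟨le_rfl, hs.le⟩).mono hsub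
  have h1 : ∀ᶠ t in 𝓝[Set.Ioc 0 s] 0, ‖γ t‖ < ε := by
    refine h0.norm.eventually_lt_const ?_
    simpa [hγ0] using hε
  have h2 : ∀ᶠ t in 𝓝[Set.Ioc 0 s] (0 : ℝ), t < δ' :=
    (eventually_lt_nhds hδ').filter_mono nhdsWithin_le_nhds
  have hne : (𝓝[Set.Ioc 0 s] (0 : ℝ)).NeBot := by
    rw [nhdsWithin_Ioc_eq_nhdsGT hs]; infer_instance
  obtain ⟨t, ⟨ht1, ht2⟩, ht3⟩ := ((h1.and h2).and self_mem_nhdsWithin).exists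
  refine ⟨γ t, ⟨linCoord a (γ t), ⟨?_, ?_⟩, (hεψ _ ht1).2⟩, ⟨t, ht3, rfl⟩⟩
  · rw [(h t (hsub ht3)).2, mem_ball_zero_iff, norm_mul, Complex.norm_exp_ofReal_mul_I, mul_one,
      Complex.norm_real, Real.norm_of_nonneg ht3.1.le]
    exact ht2
  · exact (hcore ⟨t, ht3, rfl⟩).2.2

theorem ofReal_mem_core (ha : a ∈ Set.Ioo (0 : ℝ) 1) {x : ℝ} (hx : x ∈ Set.Ioo (0 : ℝ) 1) :
    (x : ℂ) ∈ core a := by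
  have hxn : ‖(x : ℂ)‖ < 1 := norm_ofReal_lt_one (by linarith [hx.1]) hx.2
  have key : ∀ n, ∃ y ∈ Set.Ioo (0 : ℝ) 1, (blaschke (a : ℂ))^[n] x = (y : ℂ) := by
    intro n
    induction n with
    | zero => exact ⟨x, hx, rfl⟩
    | succ n ih =>
      obtain ⟨y, ⟨hy1, hy2⟩, hy⟩ := ih
      refine ⟨_, ?_, by rw [Function.iterate_succ_apply', hy, blaschke_ofReal]⟩
      obtain ⟨ha0, ha1⟩ := ha
      have h1 : 0 < 1 + a * y := by positivity
      have h2 : (y + a) / (1 + a * y) < 1 := by rw [div_lt_one h1]; nlinarith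
      have h3 : 0 < (y + a) / (1 + a * y) := by positivity
      constructor
      · positivity
      · nlinarith
  have h := tendsto_linApprox ha hxn
  have e : ∀ n, ∃ y ≥ (0 : ℝ), linApprox a n x = (y : ℂ) := by
    intro n
    obtain ⟨y, hy, hn⟩ := key n
    refine ⟨(a ^ n)⁻¹ * y, ?_, by rw [linApprox, hn]; push_cast; rfl⟩
    exact mul_nonneg (inv_nonneg.mpr (pow_nonneg ha.1.le n)) hy.1.le
  have him : (linCoord a x).im = 0 := by
    refine tendsto_nhds_unique ((Complex.continuous_im.tendsto _).comp h) ?_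
    refine tendsto_const_nhds.congr fun n => ?_
    obtain ⟨y, hy, hn⟩ := e n
    simp [hn]
  have hre : 0 ≤ (linCoord a x).re := by
    refine ge_of_tendsto ((Complex.continuous_re.tendsto _).comp h) (Eventually.of_forall fun n => ?_)
    obtain ⟨y, hy, hn⟩ := e n
    simpa [hn] using hy
  refine ⟨hxn, fun n => ?_, lt_of_le_of_ne hre fun h0 => ?_⟩
  · obtain ⟨y, hy, hn⟩ := key n
    rw [hn]; simpa using hy.1
  · refine linCoord_ne_zero ha hxn (fun n => ?_) (Complex.ext h0.symm him)
    obtain ⟨y, hy, hn⟩ := key n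
    rw [hn, Complex.ofReal_ne_zero]
    exact hy.1.ne'

theorem mem_core_or_deck_mem_core (ha : a ∈ Set.Ioo (0 : ℝ) 1) {z : ℂ} (hz : ‖z‖ < 1)
    (h : blaschke a z ∈ core a) : z ∈ core a ∨ deck a z ∈ core a := by
  have h1 := mainBranch_mem_core ha h
  have h2 : blaschke a (mainBranch a (blaschke a z)) = blaschke a z :=
    blaschke_root ha h.1 (sqrt_sq _)
  rcases eq_or_eq_deck_of_blaschke_eq ha h1.1 hz h2 with h3 | h3
  · left; rwa [← h3]
  · right; rwa [← h3]

/-- The points whose orbit enters the half-petal at time `n`. -/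
def level (a : ℝ) : ℕ → Set ℂ
  | 0 => core a
  | n + 1 => {z | ‖z‖ < 1 ∧ deck a ((blaschke a)^[n] z) ∈ core a}

theorem norm_lt_one_of_mem_level {n : ℕ} {z : ℂ} (hz : z ∈ level a n) : ‖z‖ < 1 := by
  cases n with
  | zero => exact hz.1
  | succ n => exact hz.1

theorem mem_level_add_two (ha : a ∈ Set.Ioo (0 : ℝ) 1) {n : ℕ} {z : ℂ} (hz : ‖z‖ < 1) :
    z ∈ level a (n + 2) ↔ blaschke a z ∈ level a (n + 1) := by
  simp only [level, Set.mem_ofPred_eq, hz, norm_blaschke_lt_one ha hz, true_and,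
    Function.iterate_succ_apply]

theorem iterate_succ_mem_core_of_mem_level (ha : a ∈ Set.Ioo (0 : ℝ) 1) {n m : ℕ} {z : ℂ}
    (hz : z ∈ level a n) (hnm : n ≤ m) : (blaschke a)^[m] z ∈ core a := by
  obtain ⟨k, rfl⟩ := Nat.exists_eq_add_of_le' hnm
  rw [Function.iterate_add_apply]
  refine iterate_mem_core ha ?_ k
  cases n with
  | zero => exact hz
  | succ n =>
    have h := iterate_mem_core ha hz.2 1
    rw [Function.iterate_one, blaschke_deck ha (norm_iterate_lt_one ha hz.1 n)] at h
    rwa [Function.iterate_succ_apply']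

theorem deck_notMem_core (ha : a ∈ Set.Ioo (0 : ℝ) 1) {z : ℂ} (hz : z ∈ core a) :
    deck a z ∉ core a := by
  intro h
  have h1 := deck_re_neg ha hz.1 (hz.2.1 0).le
  have h2 := h.2.1 0
  simp only [Function.iterate_zero, id_eq] at h2
  linarith

theorem level_disjoint_of_lt (ha : a ∈ Set.Ioo (0 : ℝ) 1) {m n : ℕ} (hmn : m < n) {z : ℂ}
    (hm : z ∈ level a m) : z ∉ level a n := by
  intro hn
  obtain ⟨k, rfl⟩ : ∃ k, n = k + 1 := ⟨n - 1, by omega⟩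
  exact deck_notMem_core ha (iterate_succ_mem_core_of_mem_level ha hm (Nat.lt_succ_iff.mp hmn)) hn.2

theorem level_unique (ha : a ∈ Set.Ioo (0 : ℝ) 1) {m n : ℕ} {z : ℂ}
    (hm : z ∈ level a m) (hn : z ∈ level a n) : m = n := by
  rcases lt_trichotomy m n with h | h | h
  · exact absurd hn (level_disjoint_of_lt ha h hm)
  · exact h
  · exact absurd hm (level_disjoint_of_lt ha h hn)

theorem isOpen_level (ha : a ∈ Set.Ioo (0 : ℝ) 1) (n : ℕ) : IsOpen (level a n) := by
  cases n with
  | zero => exact isOpen_core ha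
  | succ n =>
    have h1 : ContinuousOn (fun z => deck a ((blaschke a)^[n] z)) (Metric.ball 0 1) := by
      refine (differentiableOn_deck ha).continuousOn.comp
        (differentiableOn_iterate ha n).continuousOn ?_
      intro z hz
      simpa using norm_iterate_lt_one ha (by simpa using hz) n
    have := h1.isOpen_inter_preimage Metric.isOpen_ball (isOpen_core ha)
    convert this using 1
    ext z
    simp [level]

theorem mem_preim_iff (ha : a ∈ Set.Ioo (0 : ℝ) 1) {m : ℕ} {z : ℂ} :
    z ∈ preim a m (halfPetal a) ↔ ∃ j ≤ m, z ∈ level a j := by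
  rw [halfPetal_eq_core ha, preim]
  constructor
  · rintro ⟨hz, h⟩
    have hz1 : ‖z‖ < 1 := by simpa using hz
    induction m with
    | zero => exact ⟨0, le_rfl, h⟩
    | succ m ih =>
      rw [Function.iterate_succ_apply'] at h
      rcases mem_core_or_deck_mem_core ha (norm_iterate_lt_one ha hz1 m) h with h1 | h1
      · obtain ⟨j, hj, hzj⟩ := ih h1
        exact ⟨j, by omega, hzj⟩
      · exact ⟨m + 1, le_rfl, hz1, h1⟩
  · rintro ⟨j, hj, hzj⟩
    exact ⟨by simpa using norm_lt_one_of_mem_level hzj,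
      iterate_succ_mem_core_of_mem_level ha hzj hj⟩

/-- The levels are open and disjoint and cover the preimage. -/
theorem subset_level_of_isPreconnected (ha : a ∈ Set.Ioo (0 : ℝ) 1) {m j : ℕ} {Y : Set ℂ}
    (hY : IsPreconnected Y) (hsub : Y ⊆ preim a m (halfPetal a)) {z : ℂ} (hz : z ∈ Y)
    (hzj : z ∈ level a j) : Y ⊆ level a j := by
  refine hY.subset_left_of_subset_union (isOpen_level ha j)
    (v := ⋃ i ∈ {i : ℕ | i ≠ j}, level a i) ?_ ?_ ?_ ⟨z, hz, hzj⟩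
  · exact isOpen_biUnion fun i _ => isOpen_level ha i
  · rw [Set.disjoint_left]
    intro w hw hw'
    obtain ⟨i, hi, hwi⟩ := Set.mem_iUnion₂.mp hw'
    exact hi (level_unique ha hwi hw)
  · intro w hw
    obtain ⟨i, -, hwi⟩ := (mem_preim_iff ha).mp (hsub hw)
    by_cases hij : i = j
    · left; rwa [← hij]
    · right; exact Set.mem_iUnion₂.mpr ⟨i, hij, hwi⟩

/-- A pre-petal lies in one level, and contains every connected subset of that level that it
meets. -/
theorem IsPrePetal.exists_level (ha : a ∈ Set.Ioo (0 : ℝ) 1) {P : Set ℂ} (hP : IsPrePetal a P)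
    {z : ℂ} (hz : z ∈ P) : ∃ j, z ∈ level a j ∧ P ⊆ level a j ∧ IsPreconnected P ∧
      ∀ Y ⊆ level a j, IsPreconnected Y → z ∈ Y → Y ⊆ P := by
  obtain ⟨m, z₀, hz₀, rfl⟩ := hP
  have hpre : IsPreconnected (connectedComponentIn (preim a m (halfPetal a)) z₀) :=
    isPreconnected_connectedComponentIn
  have hsub := connectedComponentIn_subset (preim a m (halfPetal a)) z₀
  obtain ⟨j, hj, hzj⟩ := (mem_preim_iff ha).mp (hsub hz)
  refine ⟨j, hzj, subset_level_of_isPreconnected ha hpre hsub hz hzj, hpre, ?_⟩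
  intro Y hY hYc hzY
  rw [connectedComponentIn_eq hz]
  exact hYc.subset_connectedComponentIn hzY fun w hw => (mem_preim_iff ha).mpr ⟨j, hj, hY hw⟩

/-! ### Inverse branches on the slit disk -/

/-- The unit disk without the real points that have real preimages. -/
def slitDisk (a : ℝ) : Set ℂ := {w | ‖w‖ < 1 ∧ -discr a w ∈ Complex.slitPlane}

theorem mem_slitDisk_of_im_ne_zero (ha : a ∈ Set.Ioo (0 : ℝ) 1) {w : ℂ} (hw : ‖w‖ < 1)
    (him : w.im ≠ 0) : w ∈ slitDisk a :=
  ⟨hw, Or.inr (by rw [Complex.neg_im, neg_ne_zero]; exact discr_im_ne_zero ha hw him)⟩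

theorem im_ne_zero_of_blaschke_mem (ha : a ∈ Set.Ioo (0 : ℝ) 1) {z : ℂ} (hz : ‖z‖ < 1)
    (h : blaschke a z ∈ slitDisk a) : z.im ≠ 0 := by
  intro him
  have e : z = (z.re : ℂ) := Complex.ext rfl (by simpa using him)
  have h1 := sub_deck_sq ha hz
  have h2 : z - deck a z = ((z.re + (z.re + a) / (1 + a * z.re) : ℝ) : ℂ) := by
    rw [deck, e]; push_cast; simp
  have h3 := h.2
  rw [← h1, h2, ← Complex.ofReal_pow, ← Complex.ofReal_neg, Complex.ofReal_mem_slitPlane] at h3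
  nlinarith [sq_nonneg (z.re + (z.re + a) / (1 + a * z.re))]

/-- A real point x of such a level satisfies x ≤ -a: (0,1) is in the core, and (-a,0] is invariant
with `deck` image in the left half-plane. Then the discriminant is at most 4a^2 - 4a < 0. -/
theorem level_succ_subset_slitDisk (ha : a ∈ Set.Ioo (0 : ℝ) 1) (n : ℕ) :
    level a (n + 1) ⊆ slitDisk a := by
  intro w hw
  have hw1 := norm_lt_one_of_mem_level hw
  by_cases him : w.im = 0
  · refine ⟨hw1, ?_⟩
    obtain ⟨x, rfl⟩ : ∃ x : ℝ, w = x := ⟨w.re, Complex.ext rfl (by simpa using him)⟩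
    have hx := hw1
    rw [Complex.norm_real, Real.norm_eq_abs, abs_lt] at hx
    rw [discr_ofReal, ← Complex.ofReal_neg, Complex.ofReal_mem_slitPlane]
    have hx0 : x ≤ 0 := by
      by_contra h
      push Not at h
      exact level_disjoint_of_lt ha n.succ_pos
        (show (x : ℂ) ∈ level a 0 from ofReal_mem_core ha ⟨h, hx.2⟩) hw
    have hxa : x ≤ -a := by
      by_contra h
      push Not at h
      obtain ⟨y, ⟨hy1, hy2⟩, hy⟩ := iterate_real_nonpos ha ⟨h, hx0⟩ n
      have h1 := hw.2.2.1 0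
      rw [hy] at h1
      have h2 : deck a (y : ℂ) = ((-((y + a) / (1 + a * y)) : ℝ) : ℂ) := by
        rw [deck]; push_cast; rfl
      simp only [Function.iterate_zero, id_eq, h2, Complex.ofReal_re] at h1
      have h3 : 0 < 1 + a * y := by nlinarith [ha.1, ha.2]
      have h4 : 0 < (y + a) / (1 + a * y) := div_pos (by linarith) h3
      linarith
    obtain ⟨ha0, ha1⟩ := ha
    have h1 : (1 - x) ^ 2 ≤ 4 := by nlinarith
    have h2 : a ^ 2 * (1 - x) ^ 2 ≤ a ^ 2 * 4 := by gcongr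
    nlinarith
  · exact mem_slitDisk_of_im_ne_zero ha hw1 him

/-- The inverse branches of `f_a` on the slit disk with values in the upper half-plane
(for `e = 1`) and in the lower half-plane (for `e = -1`). -/
def halfBranch (a e : ℝ) (w : ℂ) : ℂ :=
  (-(a * (1 - w)) + e * Complex.I * Complex.sqrt (-discr a w)) / 2

theorem halfBranch_sq {e : ℝ} (he : e ^ 2 = 1) (w : ℂ) :
    ((e : ℂ) * Complex.I * Complex.sqrt (-discr a w)) ^ 2 = discr a w := by
  rw [mul_pow, mul_pow, sqrt_sq, Complex.I_sq, ← Complex.ofReal_pow, he]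
  simp

theorem norm_halfBranch_lt_one (ha : a ∈ Set.Ioo (0 : ℝ) 1) {e : ℝ} (he : e ^ 2 = 1) {w : ℂ}
    (hw : w ∈ slitDisk a) : ‖halfBranch a e w‖ < 1 :=
  norm_root_lt_one ha hw.1 (halfBranch_sq he w)

theorem blaschke_halfBranch (ha : a ∈ Set.Ioo (0 : ℝ) 1) {e : ℝ} (he : e ^ 2 = 1) {w : ℂ}
    (hw : w ∈ slitDisk a) : blaschke a (halfBranch a e w) = w :=
  blaschke_root ha hw.1 (halfBranch_sq he w)

theorem halfBranch_mem_slitDisk (ha : a ∈ Set.Ioo (0 : ℝ) 1) {e : ℝ} (he : e ^ 2 = 1) {w : ℂ}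
    (hw : w ∈ slitDisk a) : halfBranch a e w ∈ slitDisk a := by
  have h1 := norm_halfBranch_lt_one ha he hw
  refine mem_slitDisk_of_im_ne_zero ha h1 (im_ne_zero_of_blaschke_mem ha h1 ?_)
  rwa [blaschke_halfBranch ha he hw]

theorem deck_im_mul (ha : a ∈ Set.Ioo (0 : ℝ) 1) {z : ℂ} (hz : ‖z‖ < 1) :
    (deck a z).im * ‖1 + (a : ℂ) * z‖ ^ 2 = -(z.im * (1 - a ^ 2)) := by
  have h0 : ‖1 + (a : ℂ) * z‖ ^ 2 ≠ 0 :=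
    pow_ne_zero 2 (norm_ne_zero_iff.mpr (one_add_mul_ne_zero ha hz))
  rw [deck, Complex.neg_im, Complex.div_im, Complex.normSq_eq_norm_sq, neg_mul, sub_mul,
    div_mul_cancel₀ _ h0, div_mul_cancel₀ _ h0]
  simp only [Complex.add_re, Complex.add_im, Complex.ofReal_re,
    Complex.ofReal_im, Complex.one_re, Complex.one_im, Complex.re_ofReal_mul,
    Complex.im_ofReal_mul]
  ring

theorem mul_deck_im_neg (ha : a ∈ Set.Ioo (0 : ℝ) 1) {z : ℂ} (hz : ‖z‖ < 1) {e : ℝ}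
    (h : 0 < e * z.im) : e * (deck a z).im < 0 := by
  have h0 : 0 < ‖1 + (a : ℂ) * z‖ ^ 2 :=
    pow_pos (norm_pos_iff.mpr (one_add_mul_ne_zero ha hz)) 2
  have h1 := deck_im_mul ha hz
  have h2 : 0 < 1 - a ^ 2 := by nlinarith [ha.1, ha.2]
  have h3 : e * (deck a z).im * ‖1 + (a : ℂ) * z‖ ^ 2 < 0 := by
    rw [mul_assoc, h1]; nlinarith [mul_pos h h2]
  exact neg_of_mul_neg_left h3 h0.le

/-- The preimages z and `deck a z` lie on opposite sides of the real axis, so the sign `e` selects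
the right root. -/
theorem halfBranch_blaschke (ha : a ∈ Set.Ioo (0 : ℝ) 1) {e : ℝ} (he : e ^ 2 = 1) {z : ℂ}
    (hz : ‖z‖ < 1) (him : 0 < e * z.im) (h : blaschke a z ∈ slitDisk a) :
    halfBranch a e (blaschke a z) = z := by
  have h1 : ((e : ℂ) * Complex.I * Complex.sqrt (-discr a (blaschke a z))) ^ 2
      = (z - deck a z) ^ 2 := by
    rw [halfBranch_sq he, sub_deck_sq ha hz]
  rcases sq_eq_sq_iff_eq_or_eq_neg.mp h1 with h2 | h2
  · rw [halfBranch, h2, ← eq_root_of_blaschke_eq ha hz]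
  · have h3 := sqrt_re_pos h.2
    have h4 := congrArg Complex.im h2
    rw [mul_assoc, Complex.im_ofReal_mul, Complex.I_mul_im, Complex.neg_im, Complex.sub_im] at h4
    have h5 := mul_deck_im_neg ha hz him
    have h6 : e ^ 2 * (Complex.sqrt (-discr a (blaschke a z))).re
        = -(e * z.im - e * (deck a z).im) := by rw [pow_two, mul_assoc, h4]; ring
    rw [he] at h6
    linarith

theorem differentiableOn_halfBranch (a e : ℝ) :
    DifferentiableOn ℂ (halfBranch a e) (slitDisk a) := by
  intro w hw
  refine DifferentiableAt.differentiableWithinAt ?_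
  have h1 : DifferentiableAt ℂ (fun w => -discr a w) w := by unfold discr; fun_prop
  have h2 : DifferentiableAt ℂ (fun w => Complex.sqrt (-discr a w)) w :=
    DifferentiableAt.comp (f := fun w => -discr a w) w (differentiableAt_sqrt hw.2) h1
  unfold halfBranch
  fun_prop

end Levels

section Branches

variable {a : ℝ}

/-! ### A disk tangent to the unit circle at `1` -/

/-- The disk with diameter `(-1/3, 1)`. -/
def horodisk : Set ℂ := Metric.ball (1 / 3) (2 / 3)

/-- The affine map of `horodisk` onto the unit disk. -/
def horoChart (z : ℂ) : ℂ := (3 * z - 1) / 2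

theorem norm_horoChart_sq (z : ℂ) :
    1 - ‖horoChart z‖ ^ 2 = 3 / 4 * (1 - 3 * ‖z‖ ^ 2 + 2 * z.re) := by
  rw [norm_sq_eq_re_im, norm_sq_eq_re_im, horoChart]
  simp
  ring

theorem mem_horodisk_iff {z : ℂ} : z ∈ horodisk ↔ ‖horoChart z‖ < 1 := by
  have : horoChart z = (3 / 2) * (z - 1 / 3) := by rw [horoChart]; ring
  rw [horodisk, Metric.mem_ball, dist_eq_norm, this, norm_mul]
  norm_num
  constructor <;> intro h <;> linarith

theorem mem_horodisk_of_pos {z : ℂ} (h : 0 < 1 - 3 * ‖z‖ ^ 2 + 2 * z.re) : z ∈ horodisk := by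
  rw [mem_horodisk_iff]
  have := norm_horoChart_sq z
  nlinarith [norm_nonneg (horoChart z)]

theorem norm_lt_one_of_mem_horodisk {z : ℂ} (hz : z ∈ horodisk) : ‖z‖ < 1 := by
  rw [horodisk, Metric.mem_ball, dist_eq_norm] at hz
  have := norm_add_le (z - 1 / 3) (1 / 3)
  rw [sub_add_cancel] at this
  have h2 : ‖(1 / 3 : ℂ)‖ = 1 / 3 := by norm_num
  linarith

theorem le_of_mem_koebeCone {z : ℂ} (hz : z ∈ koebeCone) :
    1 - ‖z‖ ^ 2 ≤ 1 - 3 * ‖z‖ ^ 2 + 2 * z.re := by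
  have h1 := hz.2
  have h2 : 0 ≤ ‖z‖ ^ 2 := by positivity
  have h3 := one_sub_norm_sq_pos hz.1
  have hre := re_pos_of_mem_koebeCone hz
  nlinarith

theorem koebeCone_subset_horodisk : koebeCone ⊆ horodisk := fun _ hz =>
  mem_horodisk_of_pos ((one_sub_norm_sq_pos hz.1).trans_le (le_of_mem_koebeCone hz))

theorem ofReal_mem_horodisk {x : ℝ} (h0 : 0 ≤ x) (h1 : x < 1) : (x : ℂ) ∈ horodisk := by
  refine mem_horodisk_of_pos ?_
  rw [Complex.norm_real, Real.norm_of_nonneg h0, Complex.ofReal_re]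
  nlinarith

/-- The cone condition forces |1 - z| ≤ 1 - |z|^2, a nontangential approach to 1; compare z and |z|
through 1. -/
theorem norm_sub_norm_le_of_mem_koebeCone {z : ℂ} (hz : z ∈ koebeCone) :
    ‖z - (‖z‖ : ℝ)‖ ≤ 2 * (1 - ‖z‖ ^ 2) := by
  have h0 := norm_nonneg z
  have h1 : ‖1 - z‖ ≤ 1 - ‖z‖ ^ 2 := by
    have h3 := one_sub_norm_sq_pos hz.1
    refine abs_le_of_sq_le_sq' ?_ h3.le |>.2
    have e : ‖1 - z‖ ^ 2 = 1 - 2 * z.re + ‖z‖ ^ 2 := by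
      rw [norm_sq_eq_re_im, norm_sq_eq_re_im]; simp; ring
    rw [e]
    have h4 := hz.2
    have hρ : 0 ≤ ‖z‖ ^ 2 := by positivity
    generalize ‖z‖ ^ 2 = R at *
    have h5 : (1 - 2 * z.re + R) * (1 + R) ≤ (1 - R) ^ 2 * (1 + R) := by nlinarith
    exact le_of_mul_le_mul_right h5 (by linarith)
  have h2 : z - (‖z‖ : ℝ) = ((1 - ‖z‖ : ℝ) : ℂ) - (1 - z) := by push_cast; ring
  have h3 : ‖((1 - ‖z‖ : ℝ) : ℂ)‖ = 1 - ‖z‖ := by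
    rw [Complex.norm_real, Real.norm_of_nonneg (by linarith [hz.1])]
  rw [h2]
  refine (norm_sub_le _ _).trans ?_
  rw [h3]
  nlinarith [hz.1]

theorem norm_norm_lt_one {z : ℂ} (hz : ‖z‖ < 1) : ‖((‖z‖ : ℝ) : ℂ)‖ < 1 := by
  rwa [Complex.norm_real, norm_norm]

theorem hypDist_norm_le {z : ℂ} (hz : z ∈ koebeCone) :
    hypDist z (‖z‖ : ℝ) ≤ 2 * Real.arsinh 2 := by
  refine hypDist_le_of_norm_sub_le hz.1 (norm_norm_lt_one hz.1) ?_
  rw [Complex.norm_real, norm_norm, Real.sqrt_mul_self (one_sub_norm_sq_pos hz.1).le]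
  exact norm_sub_norm_le_of_mem_koebeCone hz

theorem hypDist_horoChart_norm_le {z : ℂ} (hz : z ∈ koebeCone) :
    hypDist (horoChart z) (horoChart (‖z‖ : ℝ)) ≤ 2 * Real.arsinh 4 := by
  have h0 := norm_nonneg z
  have h1 := one_sub_norm_sq_pos hz.1
  refine hypDist_le_of_norm_sub_le (mem_horodisk_iff.mp (koebeCone_subset_horodisk hz))
    (mem_horodisk_iff.mp (ofReal_mem_horodisk h0 hz.1)) ?_
  rw [norm_horoChart_sq, norm_horoChart_sq, Complex.norm_real, norm_norm, Complex.ofReal_re]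
  have h2 : horoChart z - horoChart (‖z‖ : ℝ) = (3 / 2 : ℂ) * (z - (‖z‖ : ℝ)) := by
    rw [horoChart, horoChart]; ring
  have h3 : ‖(3 / 2 : ℂ)‖ = 3 / 2 := by norm_num
  rw [h2, norm_mul, h3]
  -- On the cone |z|^2 ≤ Re z, so the depth in `horodisk` is at least 3/4 of the depth in the disk.
  -- The constant 4 is (3/2 · 2)/(3/4).
  have h4 : 3 / 4 * (1 - ‖z‖ ^ 2) ≤ √(3 / 4 * (1 - 3 * ‖z‖ ^ 2 + 2 * z.re) *
      (3 / 4 * (1 - 3 * ‖z‖ ^ 2 + 2 * ‖z‖))) := by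
    refine Real.le_sqrt_of_sq_le ?_
    rw [pow_two]
    have := le_of_mem_koebeCone hz
    refine mul_le_mul (by linarith) ?_ (by linarith) (by linarith)
    nlinarith [hz.1]
  linarith [norm_sub_norm_le_of_mem_koebeCone hz]

theorem hypDist_horoChart_radial_le {s t : ℝ} (hs : 0 ≤ s) (hst : s ≤ t) :
    hypDist (horoChart (radial s)) (horoChart (radial t)) ≤ t - s + Real.log 3 := by
  have hx := radial_nonneg hs
  have hxy := radial_mono hst
  have hy := radial_lt_one t
  have e : ∀ x : ℝ, horoChart x = (((3 * x - 1) / 2 : ℝ) : ℂ) := fun x => by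
    rw [horoChart]; push_cast; rfl
  rw [← Real.exp_le_exp, Real.exp_add, Real.exp_log (by norm_num), ← hypDist_radial_of_le hst, e, e,
    exp_hypDist_real (by linarith) (by linarith) (by linarith),
    exp_hypDist_real (by linarith) hxy hy]
  generalize radial s = x at *
  generalize radial t = y at *
  have h1 : 0 < 1 - y := by linarith
  have h2 : 0 < 1 + x := by linarith
  have h3 : 0 < 1 - x := by linarith
  have h4 : 0 < 3 * x + 1 := by linarith
  have h5 : (1 + (3 * y - 1) / 2) * (1 - (3 * x - 1) / 2) /
      ((1 - (3 * y - 1) / 2) * (1 + (3 * x - 1) / 2))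
      = (3 * y + 1) * (1 - x) / ((1 - y) * (3 * x + 1)) := by
    have h6 : (1 - (3 * y - 1) / 2) ≠ 0 := by intro h; linarith
    have h7 : (1 + (3 * x - 1) / 2) ≠ 0 := by intro h; linarith
    rw [div_eq_div_iff (mul_ne_zero h6 h7) (by positivity)]
    ring
  rw [h5, div_mul_eq_mul_div, div_le_div_iff₀ (by positivity) (by positivity)]
  have h8 : (3 * y + 1) * (1 + x) ≤ 3 * ((1 + y) * (3 * x + 1)) := by nlinarith
  have h9 := mul_le_mul_of_nonneg_left h8 (mul_pos h3 h1).le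
  linarith

/-- The Schwarz–Pick lemma for maps of `horodisk` into the unit disk. -/
theorem hypDist_le_horoChart {g : ℂ → ℂ} (hd : DifferentiableOn ℂ g horodisk)
    (hg : ∀ z ∈ horodisk, ‖g z‖ < 1) {z w : ℂ} (hz : z ∈ horodisk) (hw : w ∈ horodisk) :
    hypDist (g z) (g w) ≤ hypDist (horoChart z) (horoChart w) := by
  have hinv : ∀ v : ℂ, horoChart ((2 * v + 1) / 3) = v := fun v => by rw [horoChart]; ring
  have hinv' : ∀ v : ℂ, (2 * horoChart v + 1) / 3 = v := fun v => by rw [horoChart]; ring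
  have hmem : ∀ v : ℂ, ‖v‖ < 1 → (2 * v + 1) / 3 ∈ horodisk := fun v hv => by
    rw [mem_horodisk_iff, hinv]; exact hv
  have h := hypDist_le_of_mapsTo (g := fun v => g ((2 * v + 1) / 3)) ?_ ?_
    (mem_horodisk_iff.mp hz) (mem_horodisk_iff.mp hw)
  · simpa only [hinv'] using h
  · refine hd.comp (f := fun v : ℂ => (2 * v + 1) / 3) (by fun_prop) ?_
    intro v hv
    exact hmem v (by simpa using hv)
  · intro v hv
    exact hg _ (hmem v hv)

/-! ### The pre-petals as images of the half-petal -/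

theorem core_subset_horodisk (ha : a ∈ Set.Ioo (0 : ℝ) 1) : core a ⊆ horodisk :=
  (core_subset_koebeCone ha).trans koebeCone_subset_horodisk

theorem mem_Ioo_of_mem_Ico (ha : a ∈ Set.Ico (1 / 2 : ℝ) 1) : a ∈ Set.Ioo (0 : ℝ) 1 :=
  ⟨by linarith [ha.1], ha.2⟩

theorem deck_ofReal (a x : ℝ) : deck a x = ((-((x + a) / (1 + a * x)) : ℝ) : ℂ) := by
  rw [deck]; push_cast; rfl

/-- This lets every inverse branch start on all of `horodisk`. Off the real axis it is immediate;
the real trace (-1/3,1) has to be mapped to the left of the slit. -/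
theorem deck_mem_slitDisk (ha' : a ∈ Set.Ico (1 / 2 : ℝ) 1) {z : ℂ} (hz : z ∈ horodisk) :
    deck a z ∈ slitDisk a := by
  have ha := mem_Ioo_of_mem_Ico ha'
  have hz1 := norm_lt_one_of_mem_horodisk hz
  by_cases him : z.im = 0
  · refine ⟨norm_deck_lt_one ha hz1, ?_⟩
    obtain ⟨x, rfl⟩ : ∃ x : ℝ, z = x := ⟨z.re, Complex.ext rfl (by simpa using him)⟩
    have hx : -1 / 3 < x := by
      have h := norm_horoChart_sq x
      have h2 := one_sub_norm_sq_pos (mem_horodisk_iff.mp hz)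
      rw [h, Complex.norm_real, Complex.ofReal_re, Real.norm_eq_abs, sq_abs] at h2
      nlinarith
    have hx1 : x < 1 := by
      rw [Complex.norm_real] at hz1
      exact (le_abs_self x).trans_lt hz1
    obtain ⟨ha0, ha1⟩ := ha'
    rw [deck_ofReal, discr_ofReal, ← Complex.ofReal_neg, Complex.ofReal_mem_slitPlane]
    have h1 : 0 < 1 + a * x := by nlinarith
    have hu1 : (x + a) / (1 + a * x) < 1 := by rw [div_lt_one h1]; nlinarith
    have hu0 : (3 * a - 1) / (3 - a) < (x + a) / (1 + a * x) := by
      rw [div_lt_div_iff₀ (by linarith) h1]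
      nlinarith [mul_pos (show 0 < 1 - a ^ 2 by nlinarith) (show 0 < 3 * x + 1 by linarith)]
    have hv1 : (3 * a - 1) / (3 - a) < 1 := hu0.trans hu1
    -- Here v corresponds to the endpoint x = -1/3. A lower bound on `a` is needed for the cubic to
    -- be positive; 1/2 suffices.
    have hv : 0 < 4 * ((3 * a - 1) / (3 - a)) - a ^ 2 * (1 + (3 * a - 1) / (3 - a)) ^ 2 := by
      have h3 : 0 < 3 - a := by linarith
      have e : 4 * ((3 * a - 1) / (3 - a)) - a ^ 2 * (1 + (3 * a - 1) / (3 - a)) ^ 2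
          = 4 * ((1 - a) * (a ^ 3 + 3 * a ^ 2 + 7 * a - 3)) / (3 - a) ^ 2 := by
        field_simp; ring
      rw [e]
      refine div_pos (mul_pos four_pos (mul_pos (by linarith) ?_)) (by positivity)
      nlinarith [pow_pos (show 0 < a by linarith) 3, pow_pos (show 0 < a by linarith) 2]
    generalize (x + a) / (1 + a * x) = u at *
    generalize (3 * a - 1) / (3 - a) = v at *
    -- The quadratic is concave in u and positive at v and at 1; this is its interpolation between
    -- them.
    have key : (4 * u - a ^ 2 * (1 + u) ^ 2) * (1 - v)
        = (1 - u) * (4 * v - a ^ 2 * (1 + v) ^ 2) + (u - v) * (4 * (1 - a ^ 2))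
          + a ^ 2 * ((1 - u) * (u - v) * (1 - v)) := by ring
    have h5 : 0 < (4 * u - a ^ 2 * (1 + u) ^ 2) * (1 - v) := by
      rw [key]
      have p1 : 0 < 1 - u := by linarith
      have p2 : 0 < u - v := by linarith
      have p3 : 0 < 1 - v := by linarith
      have p4 : 0 < 1 - a ^ 2 := by nlinarith
      positivity
    have h6 := pos_of_mul_pos_left h5 (by linarith)
    linarith
  · refine mem_slitDisk_of_im_ne_zero ha (norm_deck_lt_one ha hz1) fun h => ?_
    have h1 := deck_im_mul ha hz1
    have h2 : (1 : ℝ) - a ^ 2 ≠ 0 := by nlinarith [ha.1, ha.2]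
    rw [h, zero_mul, eq_comm, neg_eq_zero] at h1
    exact (mul_ne_zero him h2) h1

theorem exists_sign {x : ℝ} (hx : x ≠ 0) : ∃ e : ℝ, e ^ 2 = 1 ∧ 0 < e * x := by
  rcases lt_or_gt_of_ne hx with h | h
  · exact ⟨-1, by norm_num, by linarith⟩
  · exact ⟨1, by norm_num, by linarith⟩

/-- The preimage of a level is covered by the two half-disks. -/
theorem mul_im_pos_of_isPreconnected (ha : a ∈ Set.Ioo (0 : ℝ) 1) {n : ℕ} {Y : Set ℂ}
    (hY : Y ⊆ level a (n + 2)) (hYc : IsPreconnected Y) {e : ℝ} {z : ℂ} (hz : z ∈ Y)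
    (hez : 0 < e * z.im) : ∀ y ∈ Y, 0 < e * y.im := by
  have hcont : Continuous fun y : ℂ => e * y.im := by fun_prop
  refine hYc.subset_left_of_subset_union (u := {y : ℂ | 0 < e * y.im})
    (v := {y : ℂ | e * y.im < 0}) (isOpen_lt continuous_const hcont)
    (isOpen_lt hcont continuous_const) ?_ ?_ ⟨z, hz, hez⟩
  · rw [Set.disjoint_left]
    intro y (h1 : 0 < e * y.im) (h2 : e * y.im < 0)
    linarith
  · intro y hy
    have hy1 := norm_lt_one_of_mem_level (hY hy)
    have h0 := im_ne_zero_of_blaschke_mem ha hy1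
      (level_succ_subset_slitDisk ha n ((mem_level_add_two ha hy1).mp (hY hy)))
    have he : e ≠ 0 := by rintro rfl; simp at hez
    rcases lt_or_gt_of_ne (mul_ne_zero he h0) with h | h
    · exact Or.inr h
    · exact Or.inl h

theorem continuousOn_blaschke_of_subset_level (ha : a ∈ Set.Ioo (0 : ℝ) 1) {n : ℕ} {Y : Set ℂ}
    (hY : Y ⊆ level a n) : ContinuousOn (blaschke a) Y :=
  (differentiableOn_blaschke ha).continuousOn.mono fun y hy => by
    simpa using norm_lt_one_of_mem_level (hY hy)

/-- Every point of a level after the first is on the image of the half-petal under an inverse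
branch that is defined on `horodisk`, and this image is maximal among connected subsets. -/
theorem exists_branch (ha' : a ∈ Set.Ico (1 / 2 : ℝ) 1) (n : ℕ) :
    ∀ z ∈ level a (n + 1), ∃ g : ℂ → ℂ, DifferentiableOn ℂ g horodisk ∧
      (∀ ζ ∈ horodisk, g ζ ∈ slitDisk a ∧ (blaschke a)^[n] (g ζ) = deck a ζ) ∧
      z ∈ g '' core a ∧
      ∀ Y ⊆ level a (n + 1), IsPreconnected Y → z ∈ Y → Y ⊆ g '' core a := by
  have ha := mem_Ioo_of_mem_Ico ha'
  induction n with
  | zero =>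
    intro z hz
    have hsub : level a 1 ⊆ deck a '' core a := fun y hy => ⟨deck a y, hy.2, deck_deck ha hy.1⟩
    refine ⟨deck a, ?_, fun ζ hζ => ⟨deck_mem_slitDisk ha' hζ, rfl⟩, hsub hz,
      fun Y hY _ _ => hY.trans hsub⟩
    exact (differentiableOn_deck ha).mono fun ζ hζ => by
      simpa using norm_lt_one_of_mem_horodisk hζ
  | succ n ih =>
    intro z hz
    have hz1 := norm_lt_one_of_mem_level hz
    have hfz := (mem_level_add_two ha hz1).mp hz
    obtain ⟨g, hgd, hg, ⟨p, hp, hgp⟩, hmax⟩ := ih _ hfz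
    have hfzs := level_succ_subset_slitDisk ha n hfz
    -- The half-disk containing z determines the branch to compose with.
    obtain ⟨e, he, hez⟩ := exists_sign (im_ne_zero_of_blaschke_mem ha hz1 hfzs)
    refine ⟨fun ζ => halfBranch a e (g ζ), ?_, ?_, ?_, ?_⟩
    · exact (differentiableOn_halfBranch a e).comp hgd fun ζ hζ => (hg ζ hζ).1
    · intro ζ hζ
      refine ⟨halfBranch_mem_slitDisk ha he (hg ζ hζ).1, ?_⟩
      rw [Function.iterate_succ_apply, blaschke_halfBranch ha he (hg ζ hζ).1, (hg ζ hζ).2]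
    · refine ⟨p, hp, ?_⟩
      simp only
      rw [hgp, halfBranch_blaschke ha he hz1 hez hfzs]
    -- A connected Y stays in that half-disk, so the branch inverts f_a on Y, and maximality is
    -- inherited from the image of Y.
    · intro Y hY hYc hzY y hy
      have hy1 := norm_lt_one_of_mem_level (hY hy)
      have hey := mul_im_pos_of_isPreconnected ha hY hYc hzY hez y hy
      have himg : blaschke a '' Y ⊆ level a (n + 1) := by
        rintro _ ⟨v, hv, rfl⟩
        exact (mem_level_add_two ha (norm_lt_one_of_mem_level (hY hv))).mp (hY hv)
      obtain ⟨q, hq, hgq⟩ := hmax _ himg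
        (hYc.image _ (continuousOn_blaschke_of_subset_level ha hY)) ⟨z, hzY, rfl⟩ ⟨y, hy, rfl⟩
      refine ⟨q, hq, ?_⟩
      simp only
      rw [hgq]
      exact halfBranch_blaschke ha he hy1 hey
        (level_succ_subset_slitDisk ha n (himg ⟨y, hy, rfl⟩))

/-- The constant of the coarse rays. -/
def rayConst : ℝ := Real.log 3 + 2 * Real.arsinh 4 + 1

theorem log_three_nonneg : 0 ≤ Real.log 3 := Real.log_nonneg (by norm_num)

theorem arsinh_two_le : 2 * Real.arsinh 2 ≤ rayConst := by
  have h1 : Real.arsinh 2 ≤ Real.arsinh 4 := Real.arsinh_le_arsinh.mpr (by norm_num)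
  rw [rayConst]; linarith [log_three_nonneg]

theorem arsinh_four_nonneg : 0 ≤ Real.arsinh 4 := Real.arsinh_nonneg_iff.mpr (by norm_num)

theorem exists_radial_eq {x : ℝ} (hx : 0 ≤ x) (hx1 : x < 1) : ∃ s, 0 ≤ s ∧ radial s = x := by
  have hn : ‖(x : ℂ)‖ = x := by rw [Complex.norm_real, Real.norm_of_nonneg hx]
  exact ⟨hypDist 0 x, hypDist_nonneg _ _, by rw [radial_hypDist_zero (by rwa [hn]), hn]⟩

theorem radial_mem_core (ha : a ∈ Set.Ioo (0 : ℝ) 1) {s : ℝ} (hs : 0 < s) :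
    (radial s : ℂ) ∈ core a := by
  refine ofReal_mem_core ha ⟨?_, radial_lt_one s⟩
  refine lt_of_le_of_ne (radial_nonneg hs.le) fun h => ?_
  have := one_add_radial_div s
  rw [← h, add_zero, sub_zero, div_one, eq_comm, Real.exp_eq_one_iff] at this
  exact hs.ne' this

theorem isQuasiRay_core (ha : a ∈ Set.Ioo (0 : ℝ) 1) :
    IsQuasiRay rayConst (core a) (fun s => (radial s : ℂ)) := by
  have h3 := log_three_nonneg
  have h4 := arsinh_four_nonneg
  refine ⟨fun s _ => norm_radial_lt_one s, fun s t _ hst => (hypDist_radial_of_le hst).ge,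
    fun s t _ hst => ?_, fun z hz => hz.1, fun z hz => ?_, fun s hs => ?_⟩
  · rw [hypDist_radial_of_le hst, rayConst]; linarith
  · obtain ⟨s, hs, h⟩ := exists_radial_eq (norm_nonneg z) hz.1
    refine ⟨s, hs, ?_⟩
    rw [h]
    exact (hypDist_norm_le (core_subset_koebeCone ha hz)).trans arsinh_two_le
  -- The origin is not in the core, so move out by one; this is the 1 in `rayConst`.
  · refine ⟨_, radial_mem_core ha (s := s + 1) (by linarith), ?_⟩
    rw [hypDist_radial_of_le (by linarith), rayConst]
    linarith

/-- Lower bound: f_a^n does not expand, and f_a^n∘g is the isometry `deck`. Upper bound: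
Schwarz–Pick for g on `horodisk`, whose metric on [0,1) exceeds that of the disk by at most log 3 in
total length. -/
theorem isQuasiRay_image (ha : a ∈ Set.Ioo (0 : ℝ) 1) {n : ℕ} {g : ℂ → ℂ}
    (hgd : DifferentiableOn ℂ g horodisk)
    (hg : ∀ ζ ∈ horodisk, g ζ ∈ slitDisk a ∧ (blaschke a)^[n] (g ζ) = deck a ζ) :
    IsQuasiRay rayConst (g '' core a) (fun s => g (radial s)) := by
  have h3 := log_three_nonneg
  have h4 := arsinh_four_nonneg
  have hg1 : ∀ ζ ∈ horodisk, ‖g ζ‖ < 1 := fun ζ hζ => (hg ζ hζ).1.1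
  have hrad : ∀ s, 0 ≤ s → (radial s : ℂ) ∈ horodisk := fun s hs =>
    ofReal_mem_horodisk (radial_nonneg hs) (radial_lt_one s)
  have hupp : ∀ s t, 0 ≤ s → s ≤ t →
      hypDist (g (radial s)) (g (radial t)) ≤ t - s + Real.log 3 := fun s t hs hst =>
    (hypDist_le_horoChart hgd hg1 (hrad s hs) (hrad t (hs.trans hst))).trans
      (hypDist_horoChart_radial_le hs hst)
  refine ⟨fun s hs => hg1 _ (hrad s hs), fun s t hs hst => ?_, fun s t hs hst => ?_, ?_, ?_,
    fun s hs => ?_⟩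
  · have h := hypDist_iterate_le ha n (hg1 _ (hrad s hs)) (hg1 _ (hrad t (hs.trans hst)))
    rw [(hg _ (hrad s hs)).2, (hg _ (hrad t (hs.trans hst))).2,
      hypDist_deck ha (norm_radial_lt_one s) (norm_radial_lt_one t), hypDist_radial_of_le hst] at h
    exact h
  · refine (hupp s t hs hst).trans ?_
    rw [rayConst]; linarith
  · rintro _ ⟨ζ, hζ, rfl⟩
    exact hg1 ζ (core_subset_horodisk ha hζ)
  · rintro _ ⟨ζ, hζ, rfl⟩
    obtain ⟨s, hs, h⟩ := exists_radial_eq (norm_nonneg ζ) hζ.1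
    refine ⟨s, hs, ?_⟩
    have h1 := hypDist_le_horoChart hgd hg1 (core_subset_horodisk ha hζ) (hrad s hs)
    have h2 := hypDist_horoChart_norm_le (core_subset_koebeCone ha hζ)
    rw [← h] at h2
    rw [rayConst]; linarith
  · refine ⟨_, ⟨_, radial_mem_core ha (s := s + 1) (by linarith), rfl⟩, ?_⟩
    have := hupp s (s + 1) hs (by linarith)
    rw [rayConst]; linarith

theorem IsPrePetal.exists_isQuasiRay (ha' : a ∈ Set.Ico (1 / 2 : ℝ) 1) {P : Set ℂ}
    (hP : IsPrePetal a P) : ∃ q, IsQuasiRay rayConst P q := by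
  have ha := mem_Ioo_of_mem_Ico ha'
  obtain ⟨z, hz⟩ : P.Nonempty := by
    obtain ⟨m, z, hz, rfl⟩ := hP
    exact ⟨z, mem_connectedComponentIn hz⟩
  obtain ⟨j, hzj, hPj, hPc, hmax⟩ := hP.exists_level ha hz
  cases j with
  | zero =>
    have : P = core a := hPj.antisymm (hmax _ subset_rfl (isPreconnected_core ha) hzj)
    rw [this]
    exact ⟨_, isQuasiRay_core ha⟩
  | succ n =>
    obtain ⟨g, hgd, hg, hzg, hgmax⟩ := exists_branch ha' n z hzj
    have : P = g '' core a := by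
      refine (hgmax P hPj hPc hz).antisymm (hmax _ ?_ ?_ hzg)
      · rintro _ ⟨ζ, hζ, rfl⟩
        have h1 := hg ζ (core_subset_horodisk ha hζ)
        refine ⟨h1.1.1, ?_⟩
        rw [h1.2, deck_deck ha hζ.1]
        exact hζ
      · exact (isPreconnected_core ha).image g
          (hgd.continuousOn.mono (core_subset_horodisk ha))
    rw [this]
    exact ⟨_, isQuasiRay_image ha hgd hg⟩

end Branches

/-! ### Separation of pre-petals -/

section Separation

variable {a : ℝ}

theorem hypDist_zero_neg (z : ℂ) : hypDist 0 (-z) = hypDist 0 z := by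
  rw [← neg_zero, hypDist_neg, neg_zero]

theorem exp_hypDist_zero_half : Real.exp (hypDist (0 : ℂ) ((1 / 2 : ℝ) : ℂ)) = 3 := by
  have := exp_hypDist_real (x := 0) (y := 1 / 2) (by norm_num) (by norm_num) (by norm_num)
  rw [Complex.ofReal_zero] at this
  rw [this]; norm_num

theorem hypDist_zero_half : hypDist (0 : ℂ) ((1 / 2 : ℝ) : ℂ) = Real.log 3 := by
  rw [← exp_hypDist_zero_half, Real.log_exp]

/-- The half-petal and its image under the deck involution are far apart. -/
theorem le_hypDist_core_deck (ha : a ∈ Set.Ioo (0 : ℝ) 1) {z v : ℂ} (hz : z ∈ core a)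
    (hv : v ∈ core a) : hypDist 0 a - 4 * Real.arsinh 2 ≤ hypDist z (deck a v) := by
  have hz1 := norm_norm_lt_one hz.1
  have hv1 := norm_norm_lt_one hv.1
  have h1 := hypDist_norm_le (core_subset_koebeCone ha hz)
  have h2 := hypDist_norm_le (core_subset_koebeCone ha hv)
  rw [← hypDist_deck ha hv.1 hv1] at h2
  -- The involution sends [0,1) to (-1,-a], so the segment between the two real points contains
  -- [-a,0].
  have h3 : hypDist 0 a ≤ hypDist (‖z‖ : ℝ) (deck a (‖v‖ : ℝ)) := by
    have hx := norm_nonneg z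
    have hy := norm_nonneg v
    have hx1 := hz.1
    have hy1 := hv.1
    obtain ⟨ha0, ha1⟩ := ha
    generalize ‖z‖ = x at *
    generalize ‖v‖ = y at *
    rw [hypDist_comm hz1 (norm_deck_lt_one ⟨ha0, ha1⟩ hv1), ← hypDist_zero_neg,
      hypDist_comm (by simp) (norm_neg_param_lt_one ⟨ha0, ha1⟩), deck_ofReal]
    have h4 : 0 < 1 + a * y := by positivity
    have h5 : (y + a) / (1 + a * y) < 1 := by rw [div_lt_one h4]; nlinarith
    have h6 : a ≤ (y + a) / (1 + a * y) := by
      rw [le_div_iff₀ h4]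
      nlinarith [mul_nonneg hy (show 0 ≤ 1 - a ^ 2 by nlinarith)]
    rw [hypDist_real_add (y := -a) (by linarith) (by linarith) (by linarith) hx1,
      hypDist_real_add (x := -a) (y := 0) (by linarith) (by linarith) hx hx1]
    have h7 := hypDist_nonneg ((-((y + a) / (1 + a * y)) : ℝ) : ℂ) ((-a : ℝ) : ℂ)
    have h8 := hypDist_nonneg ((0 : ℝ) : ℂ) x
    have h9 : hypDist ((-a : ℝ) : ℂ) ((0 : ℝ) : ℂ) = hypDist (-(a : ℂ)) 0 := by simp
    linarith
  have h4 := hypDist_triangle hz1 hz.1 (norm_deck_lt_one ha hv1)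
  have h5 := hypDist_triangle hz.1 (norm_deck_lt_one ha hv.1) (norm_deck_lt_one ha hv1)
  rw [hypDist_comm hz1 hz.1] at h4
  linarith

/-- Push forward by f_a^{j-1}, which does not expand: w lands in the core and z in its `deck` image.
-/
theorem le_hypDist_of_level_lt (ha : a ∈ Set.Ioo (0 : ℝ) 1) {i j : ℕ} (hij : i < j) {z w : ℂ}
    (hz : z ∈ level a j) (hw : w ∈ level a i) :
    hypDist 0 a - 4 * Real.arsinh 2 ≤ hypDist z w := by
  obtain ⟨k, rfl⟩ : ∃ k, j = k + 1 := ⟨j - 1, by omega⟩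
  have hz1 := norm_lt_one_of_mem_level hz
  have hw1 := norm_lt_one_of_mem_level hw
  have h1 := le_hypDist_core_deck ha
    (iterate_succ_mem_core_of_mem_level ha hw (Nat.lt_succ_iff.mp hij)) hz.2
  rw [deck_deck ha (norm_iterate_lt_one ha hz1 k)] at h1
  refine h1.trans ?_
  rw [hypDist_comm hz1 hw1]
  exact hypDist_iterate_le ha k hw1 hz1

/-- A geodesic between the two half-disks crosses the real axis. -/
theorem exists_real_between {z w : ℂ} (hz : ‖z‖ < 1) (hw : ‖w‖ < 1) {e : ℝ} (hez : 0 < e * z.im)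
    (hew : e * w.im < 0) : ∃ x : ℝ, ‖(x : ℂ)‖ < 1 ∧ hypDist z w = hypDist z x + hypDist x w := by
  have hnz : ‖-z‖ < 1 := by rwa [norm_neg]
  set m := mob z w with hm
  have hm1 : ‖m‖ < 1 := norm_mob_lt_one hz hw
  have htm : ∀ t ∈ Set.Icc (0 : ℝ) 1, ‖(t : ℂ) * m‖ < 1 := by
    intro t ht
    rw [norm_mul, Complex.norm_real, Real.norm_of_nonneg ht.1]
    nlinarith [norm_nonneg m, ht.2]
  have hback : ∀ v : ℂ, ‖v‖ < 1 → mob z (mob (-z) v) = v := fun v hv => by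
    have := mob_neg_mob hnz hv
    rwa [neg_neg] at this
  have hγ0 : mob (-z) 0 = z := by simp [mob]
  have hγ1 : mob (-z) m = w := mob_neg_mob hz hw
  have hcont : ContinuousOn (fun t : ℝ => e * (mob (-z) ((t : ℂ) * m)).im) (Set.Icc 0 1) := by
    have : ContinuousOn (fun t : ℝ => mob (-z) ((t : ℂ) * m)) (Set.Icc 0 1) := by
      unfold mob
      refine ContinuousOn.div (by fun_prop) (by fun_prop) ?_
      intro t ht
      exact one_sub_conj_mul_ne_zero (htm t ht) hnz
    fun_prop
  obtain ⟨t, ht, h0⟩ := intermediate_value_Icc' zero_le_one hcont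
    (show (0 : ℝ) ∈ Set.Icc _ _ by
      simp only [Complex.ofReal_one, one_mul, Complex.ofReal_zero, zero_mul, hγ0, hγ1]
      exact ⟨hew.le, hez.le⟩)
  have he : e ≠ 0 := by rintro rfl; simp at hez
  set p := mob (-z) ((t : ℂ) * m) with hp
  have hp1 : ‖p‖ < 1 := norm_mob_lt_one hnz (htm t ht)
  have him : p.im = 0 := (mul_eq_zero.mp h0).resolve_left he
  have hpx : ((p.re : ℝ) : ℂ) = p := Complex.ext rfl (by simpa using him.symm)
  refine ⟨p.re, by rwa [hpx], ?_⟩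
  rw [hpx, ← hypDist_mob hz hz hw, ← hypDist_mob hz hz hp1, ← hypDist_mob hz hp1 hw, mob_self, hp,
    hback _ (htm t ht), ← hm]
  have hm0 : m ≠ 0 := by
    intro h
    have hzw : w = z := by rw [← hγ1, h, hγ0]
    rw [hzw] at hew
    linarith
  have hn0 : (‖m‖ : ℂ) ≠ 0 := by exact_mod_cast (norm_ne_zero_iff.mpr hm0)
  have hu : ‖m / (‖m‖ : ℂ)‖ = 1 := by
    rw [norm_div, Complex.norm_real, norm_norm, div_self (norm_ne_zero_iff.mpr hm0)]
  have e1 : m = ((‖m‖ : ℝ) : ℂ) * (m / (‖m‖ : ℂ)) := by field_simp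
  have e2 : (t : ℂ) * m = ((t * ‖m‖ : ℝ) : ℂ) * (m / (‖m‖ : ℂ)) := by
    push_cast; field_simp
  have e3 : (0 : ℂ) = ((0 : ℝ) : ℂ) * (m / (‖m‖ : ℂ)) := by simp
  have hpos := norm_nonneg m
  have ht1 : t * ‖m‖ ≤ ‖m‖ := by nlinarith [ht.2]
  have ht0 : 0 ≤ t * ‖m‖ := mul_nonneg ht.1 hpos
  have n0 : ‖((0 : ℝ) : ℂ)‖ < 1 := by simp
  have n1 : ‖((t * ‖m‖ : ℝ) : ℂ)‖ < 1 := norm_ofReal_lt_one (by linarith) (by linarith)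
  have n2 : ‖((‖m‖ : ℝ) : ℂ)‖ < 1 := norm_norm_lt_one hm1
  calc hypDist 0 m = hypDist ((0 : ℝ) : ℂ) (‖m‖ : ℝ) := by
        rw [← hypDist_mul_right hu n0 n2, ← e1, ← e3]
    _ = hypDist ((0 : ℝ) : ℂ) (t * ‖m‖ : ℝ) + hypDist (t * ‖m‖ : ℝ) (‖m‖ : ℝ) :=
        hypDist_real_add (by norm_num) ht0 ht1 hm1
    _ = _ := by
        rw [← hypDist_mul_right hu n0 n1, ← hypDist_mul_right hu n1 n2, ← e1, ← e2, ← e3]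

/-- The separation constant. -/
def sepConst : ℝ := 2 * (4 * Real.arsinh 2 + Real.log 3)

theorem arsinh_two_nonneg : 0 ≤ Real.arsinh 2 := Real.arsinh_nonneg_iff.mpr (by norm_num)

theorem deck_zero (a : ℝ) : deck a 0 = -(a : ℂ) := by simp [deck]

/-- Points of levels after the first are far from the real axis. -/
theorem le_hypDist_ofReal (ha : a ∈ Set.Ioo (0 : ℝ) 1) {n : ℕ} {z : ℂ}
    (hz : z ∈ level a (n + 2)) {x : ℝ} (hx : ‖(x : ℂ)‖ < 1) :
    hypDist 0 a / 2 - sepConst / 2 ≤ hypDist z x := by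
  have hz1 := norm_lt_one_of_mem_level hz
  have hx' := hx
  rw [Complex.norm_real, Real.norm_eq_abs, abs_lt] at hx'
  have hA := arsinh_two_nonneg
  have hL := log_three_nonneg
  have hd := hypDist_nonneg 0 (a : ℂ)
  have ha0 := ha.1
  have ha1 := ha.2
  have hhalf : ((1 / 2 : ℝ) : ℂ) ∈ core a := ofReal_mem_core ha ⟨by norm_num, by norm_num⟩
  have hdn : ‖deck a ((1 / 2 : ℝ) : ℂ)‖ < 1 := norm_deck_lt_one ha hhalf.1
  have hlev1 : ∀ v ∈ core a, deck a v ∈ level a 1 := fun v hv => by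
    refine ⟨norm_deck_lt_one ha hv.1, ?_⟩
    rw [Function.iterate_zero, id, deck_deck ha hv.1]
    exact hv
  rw [sepConst]
  rcases lt_or_ge 0 x with hpos | hneg
  · have := le_hypDist_of_level_lt ha (Nat.succ_pos (n + 1)) hz
      (show (x : ℂ) ∈ level a 0 from ofReal_mem_core ha ⟨hpos, hx'.2⟩)
    linarith
  rcases lt_or_ge x (-a) with hlt | hge
  · have hmem : (x : ℂ) ∈ level a 1 := by
      rw [← deck_deck ha hx]
      refine hlev1 _ ?_
      rw [deck_ofReal]
      have h1 : 0 < 1 + a * x := by nlinarith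
      refine ofReal_mem_core ha ⟨?_, ?_⟩
      · rw [neg_pos]; exact div_neg_of_neg_of_pos (by linarith) h1
      · rw [neg_lt, lt_div_iff₀ h1]; nlinarith
    have := le_hypDist_of_level_lt ha (by omega : 1 < n + 2) hz hmem
    linarith
  -- For x in [-a,0], z is far from both 0 and -a, and d(-a,x) + d(x,0) = d(0,a). Adding the two
  -- triangle inequalities through x leaves half of d(0,a). The endpoints are not in the levels, so
  -- 1/2 and its `deck` image replace them at cost log 3 = d(0,1/2).
  · have h0 := le_hypDist_of_level_lt ha (Nat.succ_pos (n + 1)) hz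
      (show ((1 / 2 : ℝ) : ℂ) ∈ level a 0 from hhalf)
    have h1 := le_hypDist_of_level_lt ha (by omega : 1 < n + 2) hz (hlev1 _ hhalf)
    have h2 : hypDist (deck a 0) (deck a ((1 / 2 : ℝ) : ℂ)) = Real.log 3 := by
      rw [hypDist_deck ha (by simp) hhalf.1, hypDist_zero_half]
    have t0 := hypDist_triangle hz1 (by simp : ‖(0 : ℂ)‖ < 1) hhalf.1
    have t0' := hypDist_triangle hz1 hx (by simp : ‖(0 : ℂ)‖ < 1)
    have hna := norm_neg_param_lt_one ha
    rw [deck_zero] at h2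
    have t1 := hypDist_triangle hz1 hna hdn
    have t1' := hypDist_triangle hz1 hx hna
    have hsum := hypDist_real_add (x := -a) (y := x) (t := 0) (by linarith) hge hneg (by norm_num)
    rw [Complex.ofReal_neg, Complex.ofReal_zero, hypDist_comm hna (by simp), hypDist_zero_neg,
      hypDist_comm hna hx] at hsum
    rw [hypDist_zero_half] at t0
    linarith

/-- Induct on the level. If the images under f_a are already far apart, so are the points. If they
are joined by a connected set, one branch lifts it when the points are in the same half-disk;
otherwise the geodesic between them crosses the real axis. -/
theorem exists_connected_or_le_hypDist (ha' : a ∈ Set.Ico (1 / 2 : ℝ) 1) (n : ℕ) :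
    ∀ z ∈ level a (n + 1), ∀ w ∈ level a (n + 1),
      (∃ Y ⊆ level a (n + 1), IsPreconnected Y ∧ z ∈ Y ∧ w ∈ Y) ∨
        hypDist 0 a - sepConst ≤ hypDist z w := by
  have ha := mem_Ioo_of_mem_Ico ha'
  induction n with
  | zero =>
    intro z hz w hw
    refine Or.inl ⟨deck a '' core a, ?_, ?_, ⟨_, hz.2, deck_deck ha hz.1⟩,
      ⟨_, hw.2, deck_deck ha hw.1⟩⟩
    · rintro _ ⟨v, hv, rfl⟩
      refine ⟨norm_deck_lt_one ha hv.1, ?_⟩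
      rw [Function.iterate_zero, id, deck_deck ha hv.1]
      exact hv
    · refine (isPreconnected_core ha).image _ ((differentiableOn_deck ha).continuousOn.mono ?_)
      intro v hv
      simpa using hv.1
  | succ n ih =>
    intro z hz w hw
    have hz1 := norm_lt_one_of_mem_level hz
    have hw1 := norm_lt_one_of_mem_level hw
    have hfz := (mem_level_add_two ha hz1).mp hz
    have hfw := (mem_level_add_two ha hw1).mp hw
    have hfzs := level_succ_subset_slitDisk ha n hfz
    have hfws := level_succ_subset_slitDisk ha n hfw
    rcases ih _ hfz _ hfw with ⟨Y, hY, hYc, hzY, hwY⟩ | h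
    · obtain ⟨e, he, hez⟩ := exists_sign (im_ne_zero_of_blaschke_mem ha hz1 hfzs)
      have he0 : e ≠ 0 := by rintro rfl; simp at hez
      have hw0 := mul_ne_zero he0 (im_ne_zero_of_blaschke_mem ha hw1 hfws)
      rcases lt_or_gt_of_ne hw0 with hew | hew
      · right
        obtain ⟨x, hx, hsum⟩ := exists_real_between hz1 hw1 hez hew
        have h1 := le_hypDist_ofReal ha hz hx
        have h2 := le_hypDist_ofReal ha hw hx
        rw [hypDist_comm hw1 hx] at h2
        rw [hsum]
        linarith
      · left
        have hYs : Y ⊆ slitDisk a := hY.trans (level_succ_subset_slitDisk ha n)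
        refine ⟨halfBranch a e '' Y, ?_, ?_, ⟨_, hzY, halfBranch_blaschke ha he hz1 hez hfzs⟩,
          ⟨_, hwY, halfBranch_blaschke ha he hw1 hew hfws⟩⟩
        · rintro _ ⟨v, hv, rfl⟩
          rw [mem_level_add_two ha (norm_halfBranch_lt_one ha he (hYs hv)),
            blaschke_halfBranch ha he (hYs hv)]
          exact hY hv
        · exact hYc.image _ ((differentiableOn_halfBranch a e).continuousOn.mono hYs)
    · exact Or.inr (h.trans (hypDist_blaschke_le ha hz1 hw1))

theorem IsPrePetal.eq_of_connected (ha : a ∈ Set.Ioo (0 : ℝ) 1) {P Q : Set ℂ}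
    (hP : IsPrePetal a P) (hQ : IsPrePetal a Q) {z w : ℂ} (hz : z ∈ P) (hw : w ∈ Q) {j : ℕ}
    {Y : Set ℂ} (hY : Y ⊆ level a j) (hYc : IsPreconnected Y) (hzY : z ∈ Y) (hwY : w ∈ Y) :
    P = Q := by
  have key : ∀ {P Q : Set ℂ}, IsPrePetal a P → IsPrePetal a Q → ∀ v ∈ P, v ∈ Q → Q ⊆ P := by
    intro P Q hP hQ v hvP hvQ
    obtain ⟨i, hi, -, -, hmax⟩ := hP.exists_level ha hvP
    obtain ⟨i', hi', hQi, hQc, -⟩ := hQ.exists_level ha hvQ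
    obtain rfl := level_unique ha hi hi'
    exact hmax Q hQi hQc hvQ
  obtain ⟨i, hi, -, -, hmax⟩ := hP.exists_level ha hz
  obtain rfl := level_unique ha hi (hY hzY)
  have hwP := hmax Y hY hYc hzY hwY
  exact (key hQ hP w hw hwP).antisymm (key hP hQ w hwP hw)

theorem IsPrePetal.le_hypDist (ha' : a ∈ Set.Ico (1 / 2 : ℝ) 1) {P Q : Set ℂ}
    (hP : IsPrePetal a P) (hQ : IsPrePetal a Q) (hPQ : P ≠ Q) {z w : ℂ} (hz : z ∈ P)
    (hw : w ∈ Q) : hypDist 0 a - sepConst ≤ hypDist z w := by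
  have ha := mem_Ioo_of_mem_Ico ha'
  have hA := arsinh_two_nonneg
  have hL := log_three_nonneg
  obtain ⟨i, hzi, -, -, -⟩ := hP.exists_level ha hz
  obtain ⟨j, hwj, -, -, -⟩ := hQ.exists_level ha hw
  rcases lt_trichotomy i j with h | rfl | h
  · have := le_hypDist_of_level_lt ha h hwj hzi
    rw [hypDist_comm (norm_lt_one_of_mem_level hzi) (norm_lt_one_of_mem_level hwj), sepConst]
    linarith
  · cases i with
    | zero =>
      exact absurd (hP.eq_of_connected ha hQ hz hw (Y := core a) (j := 0) subset_rfl
        (isPreconnected_core ha) hzi hwj) hPQ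
    | succ n =>
      rcases exists_connected_or_le_hypDist ha' n z hzi w hwj with ⟨Y, hY, hYc, hzY, hwY⟩ | h
      · exact absurd (hP.eq_of_connected ha hQ hz hw hY hYc hzY hwY) hPQ
      · exact h
  · have := le_hypDist_of_level_lt ha h hzi hwj
    rw [sepConst]
    linarith

/-! ### The length of the garden on circles -/

theorem exists_prePetal_of_mem_garden {z : ℂ} (hz : z ∈ garden a) :
    ∃ P, IsPrePetal a P ∧ z ∈ P := by
  obtain ⟨n, hn⟩ := Set.mem_iUnion.mp hz
  exact ⟨_, ⟨n, z, hn, rfl⟩, mem_connectedComponentIn hn⟩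

theorem circleLength_le_two_pi (G : Set ℂ) {r : ℝ} (hr : r ≤ 1) :
    circleLength G r ≤ ENNReal.ofReal (2 * Real.pi) := by
  have h1 : volume {θ : ℝ | θ ∈ Set.Ioc (-Real.pi) Real.pi ∧ circleMap 0 r θ ∈ G}
      ≤ ENNReal.ofReal (2 * Real.pi) := by
    refine (measure_mono (t := Set.Ioc (-Real.pi) Real.pi) fun θ hθ => hθ.1).trans ?_
    rw [Real.volume_Ioc]
    exact ENNReal.ofReal_le_ofReal (by linarith)
  calc circleLength G r ≤ 1 * _ := by
        refine mul_le_mul_left ?_ _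
        rw [← ENNReal.ofReal_one]
        exact ENNReal.ofReal_le_ofReal hr
    _ ≤ _ := by rw [one_mul]; exact h1

/-- The size of the intersection of a pre-petal with a circle. -/
def arcConst : ℝ := 3 * Real.exp (4 * rayConst)

/-- The constant of the length estimate. -/
def lengthConst : ℝ := 32 * Real.pi ^ 2 * Real.exp (sepConst / 2) * arcConst +
  12 * Real.pi * arcConst + 4 * Real.pi * Real.exp (sepConst / 2)

theorem arcConst_pos : 0 < arcConst := by rw [arcConst]; positivity

/-- A chord of S_r is (1-r^2) sinh(d/2), and e^{d(0,a)/2} = √((1+a)/(1-a)) ≥ 1/√(1-a). -/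
theorem gap_le_norm_sub (ha : a ∈ Set.Ico (1 / 2 : ℝ) 1)
    (hs : √(1 - a) * Real.exp (sepConst / 2) ≤ 1 / 2) {r : ℝ} (hr : r < 1) {z w : ℂ}
    (hz : ‖z‖ = r) (hw : ‖w‖ = r) (hd : hypDist 0 a - sepConst ≤ hypDist z w) :
    (1 - r ^ 2) / (4 * (√(1 - a) * Real.exp (sepConst / 2))) ≤ ‖z - w‖ := by
  obtain ⟨ha0, ha1⟩ := ha
  have hr2 : 0 < 1 - r ^ 2 := by
    have := one_sub_norm_sq_pos (z := z) (by rwa [hz])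
    rwa [hz] at this
  have hs0 : 0 < √(1 - a) := Real.sqrt_pos.mpr (by linarith)
  have hs2 : √(1 - a) ^ 2 = 1 - a := Real.sq_sqrt (by linarith)
  set s := √(1 - a) with hsdef
  set E := Real.exp (sepConst / 2) with hE
  have hE0 : 0 < E := Real.exp_pos _
  have h1 : 1 / s ≤ Real.exp (hypDist 0 a / 2) := by
    have h2 : Real.exp (hypDist 0 a / 2) ^ 2 = (1 + a) / (1 - a) := by
      rw [← Real.exp_nat_mul]
      push_cast
      rw [mul_div_cancel₀ _ two_ne_zero,
        exp_hypDist_zero (norm_ofReal_lt_one (by linarith) ha1), Complex.norm_real,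
        Real.norm_of_nonneg (by linarith)]
    refine abs_le_of_sq_le_sq' ?_ (Real.exp_pos _).le |>.2
    rw [h2, div_pow, hs2, one_pow]
    exact div_le_div_of_nonneg_right (by linarith) (by linarith)
  have h2 : 1 / (s * E) ≤ Real.exp (hypDist z w / 2) := by
    have h3 : Real.exp (hypDist 0 a / 2) / E ≤ Real.exp (hypDist z w / 2) := by
      rw [hE, ← Real.exp_sub, Real.exp_le_exp]; linarith
    refine le_trans ?_ h3
    rw [← div_div]
    exact div_le_div_of_nonneg_right h1 hE0.le
  -- For T ≥ 2 one has (T - 1)/2 ≥ T/4; this gives the 4 in the gap.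
  have h3 : 2 ≤ 1 / (s * E) := by
    rw [le_div_iff₀ (by positivity)]; linarith
  have h4 : Real.exp (-(hypDist z w / 2)) ≤ 1 :=
    Real.exp_le_one_iff.mpr (by linarith [hypDist_nonneg z w])
  rw [norm_sub_eq_of_norm_eq hz hw hr, Real.sinh_eq]
  have h5 : (1 - r ^ 2) / (4 * (s * E)) = (1 - r ^ 2) * (1 / (s * E) / 4) := by
    field_simp
  rw [h5]
  refine mul_le_mul_of_nonneg_left ?_ hr2.le
  linarith

/-- Points of the garden closer than the gap share a pre-petal, so the three point condition applies
with δ proportional to 1-r^2. The term δ/ε is independent of r, and the leftover multiple of 1-r^2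
is absorbed by `hrs`. -/
theorem circleLength_garden_le (ha : a ∈ Set.Ico (1 / 2 : ℝ) 1) {r : ℝ} (hr : 1 / 2 ≤ r)
    (hr1 : r < 1) (hrs : 1 - r ^ 2 ≤ √(1 - a)) :
    circleLength (garden a) r ≤ ENNReal.ofReal (lengthConst * √(1 - a)) := by
  have hr2 : 0 < 1 - r ^ 2 := by nlinarith
  have hs0 : 0 < √(1 - a) := Real.sqrt_pos.mpr (by linarith [ha.2])
  have hpi := Real.pi_pos
  have hM := arcConst_pos
  have hE0 : 0 < Real.exp (sepConst / 2) := Real.exp_pos _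
  by_cases hs : √(1 - a) * Real.exp (sepConst / 2) ≤ 1 / 2
  · have hgap := fun {z w : ℂ} => gap_le_norm_sub ha hs hr1 (z := z) (w := w)
    have h := circleLength_le (G := garden a) hr hr1
      (ε := (1 - r ^ 2) / (4 * (√(1 - a) * Real.exp (sepConst / 2))))
      (δ := arcConst * (1 - r ^ 2)) (by positivity) (by positivity) ?_
    · refine h.trans (ENNReal.ofReal_le_ofReal ?_)
      rw [lengthConst]
      generalize √(1 - a) = s at *
      generalize Real.exp (sepConst / 2) = E at *
      generalize arcConst = M at *
      have e : (2 * Real.pi / ((1 - r ^ 2) / (4 * (s * E))) + 3) *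
          (4 * (Real.pi * (M * (1 - r ^ 2))))
          = 32 * Real.pi ^ 2 * E * M * s + 12 * Real.pi * M * (1 - r ^ 2) := by
        field_simp
        ring
      rw [e, add_mul, add_mul]
      have h1 : 12 * Real.pi * M * (1 - r ^ 2) ≤ 12 * Real.pi * M * s := by gcongr
      have h2 : 0 ≤ 4 * Real.pi * E * s := by positivity
      linarith
    · intro z₁ hz₁ z₂ hz₂ z₃ hz₃ h₁ h₂ h₃ h₁₂ h₂₃ h₁₃
      obtain ⟨P₁, hP₁, hm₁⟩ := exists_prePetal_of_mem_garden hz₁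
      obtain ⟨P₂, hP₂, hm₂⟩ := exists_prePetal_of_mem_garden hz₂
      obtain ⟨P₃, hP₃, hm₃⟩ := exists_prePetal_of_mem_garden hz₃
      have e₁₂ : P₁ = P₂ := by
        by_contra hne
        exact absurd (hgap h₁ h₂ (hP₁.le_hypDist ha hP₂ hne hm₁ hm₂)) (not_le.mpr h₁₂)
      have e₁₃ : P₁ = P₃ := by
        by_contra hne
        exact absurd (hgap h₁ h₃ (hP₁.le_hypDist ha hP₃ hne hm₁ hm₃)) (not_le.mpr h₁₃)
      rw [← e₁₂] at hm₂
      rw [← e₁₃] at hm₃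
      obtain ⟨q, hq⟩ := hP₁.exists_isQuasiRay ha
      exact hq.three_point hr1 h₁ h₂ h₃ hm₁ hm₂ hm₃
  -- Here `a` is bounded away from 1, and the trivial bound 2π is covered by the last term of
  -- `lengthConst`.
  · push Not at hs
    refine (circleLength_le_two_pi _ hr1.le).trans (ENNReal.ofReal_le_ofReal ?_)
    rw [lengthConst]
    generalize √(1 - a) = s at *
    generalize Real.exp (sepConst / 2) = E at *
    generalize arcConst = M at *
    have h1 : 0 ≤ (32 * Real.pi ^ 2 * E * M + 12 * Real.pi * M) * s := by positivity
    have h2 : 4 * Real.pi * (1 / 2) ≤ 4 * Real.pi * (s * E) := by gcongr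
    nlinarith

theorem limsup_circleLength_garden_le (ha : a ∈ Set.Ico (1 / 2 : ℝ) 1) :
    limsup (fun r : ℝ => circleLength (garden a) r) (𝓝[<] (1 : ℝ))
      ≤ ENNReal.ofReal (lengthConst * √(1 - a)) := by
  have hs0 : 0 < √(1 - a) := Real.sqrt_pos.mpr (by linarith [ha.2])
  refine limsup_le_of_le (h := ?_)
  have h1 : ∀ᶠ r : ℝ in 𝓝[<] (1 : ℝ), 1 / 2 < r :=
    (eventually_gt_nhds (by norm_num)).filter_mono nhdsWithin_le_nhds
  have h2 : ∀ᶠ r : ℝ in 𝓝[<] (1 : ℝ), 1 - r ^ 2 < √(1 - a) := by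
    have : Tendsto (fun r : ℝ => 1 - r ^ 2) (𝓝[<] (1 : ℝ)) (𝓝 (1 - 1 ^ 2)) :=
      (Continuous.tendsto (by fun_prop) 1).mono_left nhdsWithin_le_nhds
    refine this.eventually_lt_const ?_
    simpa using hs0
  filter_upwards [h1, h2, self_mem_nhdsWithin] with r hr hr2 hr1
  exact circleLength_garden_le ha hr.le hr1 hr2.le

end Separation

end HalfFlower

end

theorem mainTheorem6 :
    ∃ C : ℝ, ∀ a : ℝ, a ∈ Set.Ico (1 / 2 : ℝ) 1 →
      limsup (fun r : ℝ => HalfFlower.circleLength (HalfFlower.garden a) r) (𝓝[<] (1 : ℝ))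
          ≤ ENNReal.ofReal (C * Real.sqrt (1 - |a|)) ∧
      (∀ P : Set ℂ, HalfFlower.IsPrePetal a P →
        ∃ S : Set ℂ, HalfFlower.IsGeodesicSegment S ∧
          (∀ z ∈ P, ∃ w ∈ S, HalfFlower.hypDist z w ≤ C) ∧
          (∀ w ∈ S, ∃ z ∈ P, HalfFlower.hypDist w z ≤ C)) ∧
      (∀ P Q : Set ℂ, HalfFlower.IsPrePetal a P → HalfFlower.IsPrePetal a Q → P ≠ Q →
        ∀ z ∈ P, ∀ w ∈ Q, HalfFlower.hypDist 0 (a : ℂ) - C ≤ HalfFlower.hypDist z w) := by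
  refine ⟨max HalfFlower.lengthConst
    (max (HalfFlower.geodesicConst HalfFlower.rayConst) HalfFlower.sepConst), fun a ha => ?_⟩
  set C := max HalfFlower.lengthConst
    (max (HalfFlower.geodesicConst HalfFlower.rayConst) HalfFlower.sepConst)
  have h1 : HalfFlower.lengthConst ≤ C := le_max_left _ _
  have h2 : HalfFlower.geodesicConst HalfFlower.rayConst ≤ C :=
    (le_max_left _ _).trans (le_max_right _ _)
  have h3 : HalfFlower.sepConst ≤ C := (le_max_right _ _).trans (le_max_right _ _)
  refine ⟨?_, fun P hP => ?_, fun P Q hP hQ hPQ z hz w hw => ?_⟩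
  · refine (HalfFlower.limsup_circleLength_garden_le ha).trans (ENNReal.ofReal_le_ofReal ?_)
    rw [abs_of_nonneg (by linarith [ha.1])]
    exact mul_le_mul_of_nonneg_right h1 (Real.sqrt_nonneg _)
  · obtain ⟨q, hq⟩ := hP.exists_isQuasiRay ha
    obtain ⟨S, hS, hPS, hSP⟩ := hq.exists_geodesic
    refine ⟨S, hS, fun z hz => ?_, fun w hw => ?_⟩
    · obtain ⟨w, hw, h⟩ := hPS z hz
      exact ⟨w, hw, h.trans h2⟩
    · obtain ⟨z, hz, h⟩ := hSP w hw
      exact ⟨z, hz, h.trans h2⟩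
  · exact (by linarith : _ ≤ HalfFlower.hypDist 0 (a : ℂ) - HalfFlower.sepConst).trans
      (hP.le_hypDist ha hQ hPQ hz hw)
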